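/- Let $D=(d_1\ge d_2\ge\dots\ge d_n)$ be the degree sequence of a tree, and let $G(D)$ be the greedy tree with degree sequence $D$: its vertices $v_1,\dots,v_n$ are taken in breadth-first order (level by level from the root $v_1$, and from left to right within each level), $v_1$ gets $d_1$ children, and each $v_i$ with $i\ge 2$ gets $d_i-1$ children, the children of $v_i$ being the first vertices in this order that have not yet been placed when $v_i$ is reached. In other words, with $c_1=d_1$ and $c_i=d_i-1$ for $i\ge2$, the children of $v_i$ are the vertices $v_{j+1}$ with $1+\sum_{m<i}c_m\le j\le\sum_{m\le i}c_m$. Then $G(D)$ is a tree with degree sequence $D$. For a finite graph $G$ whose adjacency matrix has the eigenvalues $\lambda_1,\dots,\lambda_n$ (with multiplicity) and for $f:\mathbb{R}\to\mathbb{R}$, put $E_f(G)=\sum_{i=1}^n f(\lambda_i)$, and let $EE(G)=\sum_{i=1}^n e^{\lambda_i}$ be the Estrada index. Let $T$ be any tree with degree sequence $D$. (1) If $f(x)=\sum_{k=0}^\infty a_kx^k$ for all $x\in\mathbb{R}$, where the series converges for every real $x$ and $a_k\ge 0$ for all $k$, then $$E_f(T)\le E_f(G(D)).$$ (2) If moreover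 $a_k>0$ for infinitely many even $k$ and $T$ is not isomorphic to $G(D)$, then $E_f(T)<E_f(G(D))$. (3) In particular, if $T$ is not isomorphic to $G(D)$, then $EE(T)<EE(G(D))$. -/

import Mathlib

/-- `G` has degree sequence `D = (D 0 ≥ D 1 ≥ ⋯ ≥ D (n-1))`: the sequence is non-increasing and
lists the degrees of the vertices of `G`, each vertex once. -/
def HasDegreeSequence {V : Type*} [Fintype V] (G : SimpleGraph V) [DecidableRel G.Adj]
    {n : ℕ} (D : Fin n → ℕ) : Prop :=
  Antitone D ∧ ∃ σ : Fin n ≃ V, ∀ i, G.degree (σ i) = D i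

/-- The number of children of the `i`-th vertex, if that vertex is to have degree `D i`: the root
(the vertex `0`) has `D 0` children, and every other vertex has `D i - 1` children, since one of
its neighbours is its parent. -/
def greedyChildCount {n : ℕ} (D : Fin n → ℕ) (i : Fin n) : ℕ :=
  if (i : ℕ) = 0 then D i else D i - 1

/-- The greedy algorithm goes through the vertices level by level, and from left to right within
each level (the order `g¹₁; g²₁, g²₂, …; g³₁, g³₂, …; …`, here numbered `0, 1, 2, …`). The vertex
reached at step `i` has degree `D i`, the largest one still available, and its children are the
first vertices that have not been used up by the root and by the children of the vertices before
`i`. That is, they are the vertices `j` with `1 + ∑_{m < i} c m ≤ j ≤ ∑_{m ≤ i} c m`, where `c m`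
is the number of children of `m`. -/
def IsGreedyChild {n : ℕ} (D : Fin n → ℕ) (i j : Fin n) : Prop :=
  1 + ∑ m with m < i, greedyChildCount D m ≤ (j : ℕ) ∧
    (j : ℕ) ≤ ∑ m with m ≤ i, greedyChildCount D m

instance {n : ℕ} (D : Fin n → ℕ) : DecidableRel (IsGreedyChild D) := fun i j =>
  inferInstanceAs (Decidable (1 + ∑ m with m < i, greedyChildCount D m ≤ (j : ℕ) ∧
    (j : ℕ) ≤ ∑ m with m ≤ i, greedyChildCount D m))

/-- The greedy tree `G(D)` of the degree sequence `D` of a tree: two vertices are adjacent if and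
only if one of them is a child of the other. -/
def greedyTree {n : ℕ} (D : Fin n → ℕ) : SimpleGraph (Fin n) :=
  SimpleGraph.fromRel (IsGreedyChild D)

instance {n : ℕ} (D : Fin n → ℕ) : DecidableRel (greedyTree D).Adj := fun i j =>
  inferInstanceAs (Decidable (i ≠ j ∧ (IsGreedyChild D i j ∨ IsGreedyChild D j i)))

theorem adjMatrix_isHermitian {V : Type*} (G : SimpleGraph V) [DecidableRel G.Adj] :
    (G.adjMatrix ℝ).IsHermitian := by
  rw [Matrix.IsHermitian, Matrix.conjTranspose_eq_transpose_of_trivial]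
  exact G.isSymm_adjMatrix

/-- `E_f(G) = f(λ₁) + ⋯ + f(λₙ)`, where `λ₁, …, λₙ` are the eigenvalues of the adjacency matrix
of `G`, listed with multiplicity. -/
noncomputable def spectralSum {V : Type*} [Fintype V] [DecidableEq V] (f : ℝ → ℝ)
    (G : SimpleGraph V) [DecidableRel G.Adj] : ℝ :=
  ∑ i, f ((adjMatrix_isHermitian G).eigenvalues i)

/-- The Estrada index `EE(G) = e^{λ₁} + ⋯ + e^{λₙ}`. -/
noncomputable def estradaIndex {V : Type*} [Fintype V] [DecidableEq V]
    (G : SimpleGraph V) [DecidableRel G.Adj] : ℝ :=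
  spectralSum Real.exp G

/-! ### Weak majorization, stable under sums and products -/

section WeakMajorization

open Finset

/-! Expanding `f` in its power series writes the spectral sum as `∑ a k * M k`, where `M k` is the
`k`-th spectral moment. There are finitely many parent functions on `Fin n`, so some tree with
degree sequence `D` maximizes the sum. The core is `IsSpectralMax.nonempty_iso_greedyTree`: if
infinitely many even coefficients are positive, every maximizer is the greedy tree. The weak
inequality for an arbitrary `f` follows by adding a small multiple of `exp`.

Moments under rearrangement. Root a tree and let `w v` be the generating series of the closed walks
in the branch at `v`; then `w v * (1 - X ^ 2 * ∑ w u) = 1`, the sum running over the children of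
`v`. The factors `1 - X ^ 2 * ∑ w u` multiply to `det (1 - X A)` (`IsParentFun.det_eq_prod`), whose
negative logarithmic derivative generates the moments. Keep the levels and all child counts, order
each level by decreasing child count, and hand out the children in the order of their parents.
Within each level, the coefficients of the old series are weakly majorized by those of the new one
(`IsGreedyForest.weakMaj_coeff`), because weak majorization survives sums, suitable products and
summation over children. So no moment decreases. If all even moments stay equal, the levels were
ordered already: otherwise exchanging values or branches would raise a sum that is at its bound. All
this also works for a tree rooted at an edge, where the two adjacent roots contribute `edgeDet`.

Structure of a maximizer. By maximality the levels are ordered as seen from every vertex and from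
every edge. Root at a centroid. The vertex version orders the degrees within a level. To compare `x`
with `y` one level below, find the edge `qc` at which their paths to the root separate, with `x` on
the side of `q`, `y` on the side of `c`, both at the same distance from their end. One side
dominates the other; if it is the side of `c`, the centroid property makes it no larger, and the two
sides agree in all child counts of a level. Hence degrees decrease along a breadth-first order,
which characterizes the greedy tree. -/

theorem Finset.sum_le_sum_of_dominated {ι κ : Type*} {A : Finset ι} {B : Finset κ} {f : ι → ℝ}
    {g : κ → ℝ} (hcard : A.card ≤ B.card) (hfg : ∀ a ∈ A, ∀ b ∈ B, f a ≤ g b)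
    (hg : ∀ b ∈ B, 0 ≤ g b) : ∑ a ∈ A, f a ≤ ∑ b ∈ B, g b := by
  classical
  obtain ⟨C, hCB, hC⟩ := Finset.exists_subset_card_eq hcard
  have e : A ≃ C := Finset.equivOfCardEq hC.symm
  calc ∑ a ∈ A, f a = ∑ a : A, f a := (Finset.sum_coe_sort A f).symm
    _ ≤ ∑ a : A, g (e a) :=
        Finset.sum_le_sum fun a _ => hfg a a.2 _ (hCB (e a).2)
    _ = ∑ c : C, g c := Equiv.sum_comp e (fun c : C => g c)
    _ = ∑ c ∈ C, g c := Finset.sum_coe_sort C g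
    _ ≤ ∑ b ∈ B, g b := Finset.sum_le_sum_of_subset_of_nonneg hCB fun b hb _ => hg b hb

/-- Deleting `a` and `b` leaves a dominated pair of families, so a strict inequality `f a < g b`
could not be compensated elsewhere. -/
theorem Finset.eq_of_dominated_of_sum_eq {ι κ : Type*} {A : Finset ι} {B : Finset κ} {f : ι → ℝ}
    {g : κ → ℝ} (hcard : A.card = B.card) (hfg : ∀ a ∈ A, ∀ b ∈ B, f a ≤ g b)
    (hg : ∀ b ∈ B, 0 ≤ g b) (hsum : ∑ a ∈ A, f a = ∑ b ∈ B, g b) {a : ι} {b : κ} (ha : a ∈ A)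
    (hb : b ∈ B) : f a = g b := by
  classical
  have h := Finset.sum_le_sum_of_dominated (A := A.erase a) (B := B.erase b) (f := f) (g := g)
    (by rw [Finset.card_erase_of_mem ha, Finset.card_erase_of_mem hb, hcard])
    (fun x hx y hy => hfg x (Finset.mem_of_mem_erase hx) y (Finset.mem_of_mem_erase hy))
    (fun y hy => hg y (Finset.mem_of_mem_erase hy))
  have h1 := Finset.add_sum_erase A f ha
  have h2 := Finset.add_sum_erase B g hb
  have h3 := hfg a ha b hb
  linarith

/-- `K` consists of the first elements of `A`. -/
def Finset.IsInitialIn {ι : Type*} [LinearOrder ι] (K A : Finset ι) : Prop :=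
  K ⊆ A ∧ ∀ a ∈ K, ∀ b ∈ A, b ≤ a → b ∈ K

/-- The sum of any `k` values of `α` on `A` is at most the sum of the first `k` values of `β`. -/
def WeakMaj {ι : Type*} [LinearOrder ι] (A : Finset ι) (α β : ι → ℝ) : Prop :=
  ∀ J ⊆ A, ∀ K : Finset ι, K.IsInitialIn A → J.card ≤ K.card → ∑ i ∈ J, α i ≤ ∑ i ∈ K, β i

variable {ι : Type*} [LinearOrder ι] {A : Finset ι} {α β α' β' : ι → ℝ}

theorem WeakMaj.sum_le (h : WeakMaj A α β) : ∑ i ∈ A, α i ≤ ∑ i ∈ A, β i :=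
  h A subset_rfl A ⟨subset_rfl, fun _ _ _ h _ => h⟩ le_rfl

theorem WeakMaj.sum {κ : Type*} (s : Finset κ) {α β : κ → ι → ℝ}
    (h : ∀ k ∈ s, WeakMaj A (α k) (β k)) :
    WeakMaj A (fun i => ∑ k ∈ s, α k i) (fun i => ∑ k ∈ s, β k i) := fun J hJ K hK hc => by
  rw [Finset.sum_comm, Finset.sum_comm (s := K)]
  exact Finset.sum_le_sum fun k hk => h k hk J hJ K hK hc

theorem WeakMaj.const {c : ℝ} (hc : 0 ≤ c) : WeakMaj A (fun _ => c) (fun _ => c) :=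
  fun J _ K _ hJK => by
    simp only [Finset.sum_const, nsmul_eq_mul]
    exact mul_le_mul_of_nonneg_right (by exact_mod_cast hJK) hc

theorem WeakMaj.const_mul {c : ℝ} (hc : 0 ≤ c) (h : WeakMaj A α β) :
    WeakMaj A (fun i => c * α i) (fun i => c * β i) := fun J hJ K hK hJK => by
  rw [← Finset.mul_sum, ← Finset.mul_sum]
  exact mul_le_mul_of_nonneg_left (h J hJ K hK hJK) hc

/-- Since `K` is initial, every element of `K \ J` precedes every element of `J \ K`, and there are
at least as many of them. -/
theorem WeakMaj.of_antitoneOn (hα : AntitoneOn α A) (h0 : ∀ i ∈ A, 0 ≤ α i) : WeakMaj A α α := by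
  intro J hJ K hK hJK
  have h := Finset.sum_le_sum_of_dominated (A := J \ K) (B := K \ J) (f := α) (g := α)
    (by
      have h1 := Finset.card_sdiff_add_card_inter J K
      have h2 := Finset.card_sdiff_add_card_inter K J
      rw [Finset.inter_comm] at h2
      omega)
    (fun a ha b hb => by
      rw [Finset.mem_sdiff] at ha hb
      refine hα (hK.1 hb.1) (hJ ha.1) (le_of_not_ge fun hab => ha.2 ?_)
      exact hK.2 b hb.1 a (hJ ha.1) hab)
    (fun b hb => h0 b (hK.1 (Finset.mem_sdiff.1 hb).1))
  have h1 := Finset.sum_inter_add_sum_sdiff J K α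
  have h2 := Finset.sum_inter_add_sum_sdiff K J α
  rw [Finset.inter_comm] at h2
  linarith

/-- The left-hand family enters only through arbitrary subsets, so its order is irrelevant. This is
what allows exchange arguments in the case of equality. -/
theorem WeakMaj.comp_perm (h : WeakMaj A α β) (τ : Equiv.Perm ι) (hτ : ∀ i ∈ A, τ i ∈ A) :
    WeakMaj A (α ∘ τ) β := fun J hJ K hK hJK => by
  have := h (J.map τ.toEmbedding) (by
    intro x hx
    obtain ⟨y, hy, rfl⟩ := Finset.mem_map.1 hx
    exact hτ y (hJ hy)) K hK (by rwa [Finset.card_map])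
  rwa [Finset.sum_map] at this

/-- Abel summation: by induction, the weighted partial sum is at least the last weight times the
plain partial sum. -/
theorem sum_range_mul_nonneg_of_antitone {d y : ℕ → ℝ} {m : ℕ}
    (hd : ∀ k ≤ m, 0 ≤ ∑ i ∈ range k, d i) (hy : ∀ i j, i ≤ j → j < m → y j ≤ y i)
    (h0 : ∀ i < m, 0 ≤ y i) : 0 ≤ ∑ i ∈ range m, d i * y i := by
  have key : ∀ k, k < m → y k * ∑ i ∈ range (k + 1), d i ≤ ∑ i ∈ range (k + 1), d i * y i := by
    intro k
    induction k with
    | zero => intro _; simp [mul_comm]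
    | succ k ih =>
      intro hk
      rw [Finset.sum_range_succ, Finset.sum_range_succ _ (k + 1), mul_add]
      have h1 := ih (by omega)
      have h2 := mul_le_mul_of_nonneg_right (hy k (k + 1) (by omega) hk) (hd (k + 1) (by omega))
      linarith [mul_comm (y (k + 1)) (d (k + 1))]
  rcases Nat.eq_zero_or_pos m with rfl | hm
  · simp
  · obtain ⟨k, rfl⟩ : ∃ k, m = k + 1 := ⟨m - 1, by omega⟩
    exact (mul_nonneg (h0 k (by omega)) (hd _ le_rfl)).trans (key k (by omega))

theorem exists_antitone_enum {κ : Type*} (J : Finset κ) (f : κ → ℝ) :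
    ∃ e : Fin J.card ≃ J, Antitone fun i => f (e i) := by
  let e₀ : Fin J.card ≃ J := J.equivFin.symm
  let g : Fin J.card → ℝ := fun i => - f (e₀ i)
  refine ⟨(Tuple.sort g).trans e₀, fun i j hij => ?_⟩
  have := Tuple.monotone_sort g hij
  simpa [g] using this

theorem Finset.sum_range_extend {m k : ℕ} (hk : k ≤ m) (f : Fin m → ℝ) :
    ∑ i ∈ range k, (if h : i < m then f ⟨i, h⟩ else 0)
      = ∑ i ∈ univ.filter (fun i : Fin m => (i : ℕ) < k), f i := by
  rw [Finset.sum_filter, Finset.sum_fin_eq_sum_range, ← Finset.sum_subset (Finset.range_mono hk)]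
  · refine Finset.sum_congr rfl fun i hi => ?_
    rw [Finset.mem_range] at hi
    rw [dif_pos (lt_of_lt_of_le hi hk), dif_pos (lt_of_lt_of_le hi hk), if_pos hi]
  · intro i _ hi
    rw [Finset.mem_range] at hi
    split_ifs <;> rfl

/-- The rearrangement inequality lets both factors be sorted decreasingly on `J`. Abel summation
then replaces `α` by `β` against the decreasing weights `α'`, and `α'` by `β'` against the
decreasing weights `β`. -/
theorem WeakMaj.mul (h : WeakMaj A α β) (h' : WeakMaj A α' β')
    (hα' : ∀ i ∈ A, 0 ≤ α' i) (hβ : AntitoneOn β A)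
    (hβ0 : ∀ i ∈ A, 0 ≤ β i) (hβ0' : ∀ i ∈ A, 0 ≤ β' i) :
    WeakMaj A (fun i => α i * α' i) (fun i => β i * β' i) := by
  intro J hJ K hK hJK
  obtain ⟨m, hm⟩ : ∃ m, m = J.card := ⟨_, rfl⟩
  obtain ⟨e, he⟩ : ∃ e : Fin m ≃ J, Antitone fun i => α (e i) := hm ▸ exists_antitone_enum J α
  obtain ⟨f, hf⟩ : ∃ e : Fin m ≃ J, Antitone fun i => α' (e i) := hm ▸ exists_antitone_enum J α'
  rw [← hm] at hJK
  have hKe := K.orderEmbOfFin_mem rfl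
  set s := K.orderEmbOfFin rfl with hs
  let c : Fin m → Fin K.card := Fin.castLE hJK
  -- The first `k` elements of `K` again form an initial subset of `A`, so weak majorization bounds
  -- every partial sum of any enumeration of `J`.
  have part : ∀ (γ δ : ι → ℝ) (g : Fin m ≃ J), WeakMaj A γ δ → ∀ k ≤ m,
      ∑ i ∈ univ.filter (fun i : Fin m => (i : ℕ) < k), γ (g i) ≤ ∑ i ∈ univ.filter (fun i : Fin m => (i : ℕ) < k), δ (s (c i)) := by
    intro γ δ g hγ k hk
    let F : Finset (Fin m) := univ.filter fun i => (i : ℕ) < k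
    let g' : Fin m ↪ ι := g.toEmbedding.trans (Function.Embedding.subtype _)
    let s' : Fin m ↪ ι := (Fin.castLEEmb hJK).trans s.toEmbedding
    have := hγ (F.map g') (by
      intro x hx
      obtain ⟨i, _, rfl⟩ := Finset.mem_map.1 hx
      exact hJ (g i).2) (F.map s') ⟨by
        intro x hx
        obtain ⟨i, _, rfl⟩ := Finset.mem_map.1 hx
        exact hK.1 (hKe _), by
        intro x hx b hb hbx
        obtain ⟨i, hi, rfl⟩ := Finset.mem_map.1 hx
        have hbK : b ∈ K := hK.2 _ (hKe (c i)) b hb hbx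
        have : b ∈ Set.range s := by rw [hs, Finset.range_orderEmbOfFin]; exact hbK
        obtain ⟨j, rfl⟩ := this
        have hji : j ≤ c i := s.le_iff_le.1 hbx
        have hji' : (j : ℕ) ≤ i := hji
        have hi' : (i : ℕ) < k := (Finset.mem_filter.1 hi).2
        refine Finset.mem_map.2 ⟨⟨j, lt_of_le_of_lt hji' i.2⟩, ?_, rfl⟩
        exact Finset.mem_filter.2 ⟨Finset.mem_univ _, lt_of_le_of_lt hji' hi'⟩⟩ (by simp)
    rw [Finset.sum_map, Finset.sum_map] at this
    exact this
  have abel : ∀ x x' y : Fin m → ℝ, Antitone y → (∀ i, 0 ≤ y i) →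
      (∀ k ≤ m, ∑ i ∈ univ.filter (fun i : Fin m => (i : ℕ) < k), x i ≤ ∑ i ∈ univ.filter (fun i : Fin m => (i : ℕ) < k), x' i) →
      ∑ i, x i * y i ≤ ∑ i, x' i * y i := by
    intro x x' y hy hy0 hx
    have := sum_range_mul_nonneg_of_antitone (m := m)
      (d := fun i => if h : i < m then x' ⟨i, h⟩ - x ⟨i, h⟩ else 0)
      (y := fun i => if h : i < m then y ⟨i, h⟩ else 0)
      (by
        intro k hk
        rw [Finset.sum_range_extend hk (fun i => x' i - x i), Finset.sum_sub_distrib]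
        linarith [hx k hk])
      (by
        intro i j hij hj
        simp only [hj, lt_of_le_of_lt hij hj, dif_pos]
        exact hy hij)
      (by
        intro i hi
        simp only [hi, dif_pos]
        exact hy0 _)
    have h2 : ∑ i, (x' i - x i) * y i = ∑ i ∈ range m,
        (if h : i < m then x' ⟨i, h⟩ - x ⟨i, h⟩ else 0) * (if h : i < m then y ⟨i, h⟩ else 0) := by
      rw [Finset.sum_fin_eq_sum_range]
      refine Finset.sum_congr rfl fun i hi => ?_
      rw [Finset.mem_range] at hi
      simp only [hi, dif_pos]
    rw [← h2] at this
    simp only [sub_mul, Finset.sum_sub_distrib] at this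
    linarith
  have hβs : ∀ (γ : ι → ℝ), AntitoneOn γ A → Antitone fun i => γ (s (c i)) := fun γ hγ i j hij =>
    hγ (hK.1 (hKe _)) (hK.1 (hKe _)) (s.monotone (show c i ≤ c j from hij))
  calc ∑ i ∈ J, α i * α' i = ∑ i : J, α i * α' i := (Finset.sum_coe_sort J _).symm
    _ = ∑ i, α (e i) * α' (e i) := (Equiv.sum_comp e (fun i : J => α i * α' i)).symm
    _ = ∑ i, α (e i) * α' (f ((e.trans f.symm) i)) := by simp
    _ ≤ ∑ i, α (e i) * α' (f i) :=
        (he.monovary hf).sum_mul_comp_perm_le_sum_mul (σ := e.trans f.symm)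
    _ ≤ ∑ i, β (s (c i)) * α' (f i) :=
        abel _ _ _ hf (fun i => hα' _ (hJ (f i).2)) (part α β e h)
    _ = ∑ i, α' (f i) * β (s (c i)) := by simp only [mul_comm]
    _ ≤ ∑ i, β' (s (c i)) * β (s (c i)) :=
        abel _ _ _ (hβs β hβ) (fun i => hβ0 _ (hK.1 (hKe _))) (part α' β' f h')
    _ = ∑ i, β (s (c i)) * β' (s (c i)) := by simp only [mul_comm]
    _ = ∑ x ∈ univ.map ((Fin.castLEEmb hJK).trans s.toEmbedding), β x * β' x := by
        rw [Finset.sum_map]; rfl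
    _ ≤ ∑ x ∈ K, β x * β' x := by
        refine Finset.sum_le_sum_of_subset_of_nonneg ?_ fun i hi _ =>
          mul_nonneg (hβ0 i (hK.1 hi)) (hβ0' i (hK.1 hi))
        intro x hx
        obtain ⟨i, _, rfl⟩ := Finset.mem_map.1 hx
        exact hKe _

end WeakMajorization

/-! ### Closed-walk series of levelled forests, and their majorization by the greedy arrangement -/

section LevelForest

open Finset PowerSeries

variable {n : ℕ}

/-- The children of `v` under the parent function `p`; vertices of level `0` have no parent. -/
def levelChildren (lv : Fin n → ℕ) (p : Fin n → Fin n) (v : Fin n) : Finset (Fin n) :=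
  univ.filter fun u => lv u ≠ 0 ∧ p u = v

/-- The parent of a vertex lies one level above it. -/
def IsLevelForest (lv : Fin n → ℕ) (p : Fin n → Fin n) : Prop :=
  ∀ j, lv j ≠ 0 → lv (p j) + 1 = lv j

/-- The sum of a family of power series over the children of `v`. -/
noncomputable def childSum (lv : Fin n → ℕ) (p : Fin n → Fin n) (w : Fin n → ℝ⟦X⟧) (v : Fin n) :
    ℝ⟦X⟧ :=
  ∑ u ∈ levelChildren lv p v, w u

/-- `w v` is the generating function of the closed walks from `v` in the branch below `v`. -/
def IsBranchSeries (lv : Fin n → ℕ) (p : Fin n → Fin n) (w : Fin n → ℝ⟦X⟧) : Prop :=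
  ∀ v, w v * (1 - X ^ 2 * childSum lv p w v) = 1

/-- The vertices of level `l`. -/
def levelSet (lv : Fin n → ℕ) (l : ℕ) : Finset (Fin n) := univ.filter fun v => lv v = l

/-- A forest in which, in each level, the numbers of children decrease from left to right, and
the children are arranged in the same order as their parents. -/
structure IsGreedyForest (lv : Fin n → ℕ) (q : Fin n → Fin n) : Prop where
  forest : IsLevelForest lv q
  mono : ∀ i j, i ≤ j → lv i ≠ 0 → lv i = lv j → q i ≤ q j
  anti : ∀ u v, u ≤ v → lv u = lv v → (levelChildren lv q v).card ≤ (levelChildren lv q u).card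

variable {lv : Fin n → ℕ} {p q : Fin n → Fin n} {w ws : Fin n → ℝ⟦X⟧}

theorem mem_levelChildren {u v : Fin n} : u ∈ levelChildren lv p v ↔ lv u ≠ 0 ∧ p u = v := by
  simp [levelChildren]

theorem mem_levelSet {v : Fin n} {l : ℕ} : v ∈ levelSet lv l ↔ lv v = l := by
  simp [levelSet]

theorem IsLevelForest.lv_child (hp : IsLevelForest lv p) {u v : Fin n}
    (h : u ∈ levelChildren lv p v) : lv u = lv v + 1 := by
  rw [mem_levelChildren] at h
  rw [← hp u h.1, h.2]

theorem constantCoeff_one_sub_X_sq_mul (S : ℝ⟦X⟧) : constantCoeff (1 - X ^ 2 * S) = 1 := by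
  simp

/-- Iterate the defining equation. The value at `v` depends only on deeper levels, so it is
stationary once the number of iterations reaches the number of levels from `v` downwards. -/
theorem exists_isBranchSeries (hp : IsLevelForest lv p) : ∃ w, IsBranchSeries lv p w := by
  let wf : ℕ → Fin n → ℝ⟦X⟧ := fun k => Nat.rec (fun _ => 1)
    (fun _ f v => (1 - X ^ 2 * childSum lv p f v)⁻¹) k
  have hwf : ∀ k v, wf (k + 1) v = (1 - X ^ 2 * childSum lv p (wf k) v)⁻¹ := fun k v => rfl
  let B := (univ.sup lv) + 1
  have hB : ∀ v, lv v < B := fun v => Nat.lt_succ_of_le (Finset.le_sup (Finset.mem_univ v))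
  have stable : ∀ k v, B ≤ lv v + k → wf k v = wf (k + 1) v := by
    intro k
    induction k with
    | zero => intro v hv; exact absurd (hB v) (by omega)
    | succ k ih =>
      intro v hv
      rw [hwf k, hwf (k + 1)]
      have : childSum lv p (wf k) v = childSum lv p (wf (k + 1)) v :=
        Finset.sum_congr rfl fun u hu => ih u (by rw [hp.lv_child hu]; omega)
      rw [this]
  refine ⟨wf B, fun v => ?_⟩
  rw [stable B v (by omega), hwf B]
  have : childSum lv p (wf (B + 1)) v = childSum lv p (wf B) v :=
    Finset.sum_congr rfl fun u _ => (stable B u (by omega)).symm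
  have h2 : childSum lv p (fun v => wf B v) v = childSum lv p (wf B) v := rfl
  rw [h2]
  exact PowerSeries.inv_mul_cancel _ (by rw [constantCoeff_one_sub_X_sq_mul]; exact one_ne_zero)

namespace IsBranchSeries

/-- Decomposition at the first return: a nonempty closed walk steps to a child, walks in that
branch, comes back, and continues. -/
theorem eq_one_add (hw : IsBranchSeries lv p w) (v : Fin n) :
    w v = 1 + X ^ 2 * (childSum lv p w v * w v) := by
  linear_combination hw v

theorem coeff_zero (hw : IsBranchSeries lv p w) (v : Fin n) : coeff 0 (w v) = 1 := by
  rw [hw.eq_one_add v]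
  simp

theorem coeff_one (hw : IsBranchSeries lv p w) (v : Fin n) : coeff 1 (w v) = 0 := by
  rw [hw.eq_one_add v, map_add, coeff_X_pow_mul']
  simp [PowerSeries.coeff_one]

theorem coeff_add_two (hw : IsBranchSeries lv p w) (v : Fin n) (N : ℕ) :
    coeff (N + 2) (w v) =
      ∑ x ∈ antidiagonal N, coeff x.1 (childSum lv p w v) * coeff x.2 (w v) := by
  conv_lhs => rw [hw.eq_one_add v]
  rw [map_add, coeff_X_pow_mul, coeff_mul, PowerSeries.coeff_one]
  simp

theorem coeff_childSum (w : Fin n → ℝ⟦X⟧) (v : Fin n) (N : ℕ) :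
    coeff N (childSum lv p w v) = ∑ u ∈ levelChildren lv p v, coeff N (w u) := by
  rw [childSum, map_sum]

/-- The factor `X ^ 2` makes the coefficient `N + 2` depend only on coefficients up to `N`.
Inducting on the coefficient rather than on the depth treats all levels at once. -/
theorem coeff_induction {P : ℕ → Prop} (h0 : P 0) (h1 : P 1)
    (h2 : ∀ N, (∀ i ≤ N, P i) → P (N + 2)) (N : ℕ) : P N := by
  induction N using Nat.strong_induction_on with
  | _ N ih =>
    match N with
    | 0 => exact h0
    | 1 => exact h1
    | N + 2 => exact h2 N fun i hi => ih i (by omega)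

theorem coeff_nonneg (hw : IsBranchSeries lv p w) (N : ℕ) : ∀ v, 0 ≤ coeff N (w v) := by
  induction N using coeff_induction with
  | h0 => intro v; rw [hw.coeff_zero]; exact zero_le_one
  | h1 => intro v; rw [hw.coeff_one]
  | h2 N ih =>
    intro v
    rw [hw.coeff_add_two]
    refine Finset.sum_nonneg fun x hx => ?_
    have := mem_antidiagonal.1 hx
    rw [coeff_childSum]
    exact mul_nonneg (Finset.sum_nonneg fun u _ => ih _ (by omega) u) (ih _ (by omega) v)

theorem childSum_nonneg (hw : IsBranchSeries lv p w) (N : ℕ) (v : Fin n) :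
    0 ≤ coeff N (childSum lv p w v) := by
  rw [coeff_childSum]
  exact Finset.sum_nonneg fun u _ => hw.coeff_nonneg N u

theorem coeff_odd (hw : IsBranchSeries lv p w) (N : ℕ) : ∀ v, Odd N → coeff N (w v) = 0 := by
  induction N using coeff_induction with
  | h0 => intro v h; exact absurd h (by decide)
  | h1 => intro v _; rw [hw.coeff_one]
  | h2 N ih =>
    intro v hN
    rw [hw.coeff_add_two]
    refine Finset.sum_eq_zero fun x hx => ?_
    have hx' := mem_antidiagonal.1 hx
    rcases Nat.even_or_odd x.1 with h | h
    · rw [ih x.2 (by omega) v (by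
        rw [Nat.odd_iff] at hN ⊢; rw [Nat.even_iff] at h; omega), mul_zero]
    · rw [coeff_childSum, Finset.sum_eq_zero fun u _ => ih x.1 (by omega) u h, zero_mul]

theorem childSum_odd (hw : IsBranchSeries lv p w) {N : ℕ} (v : Fin n) (hN : Odd N) :
    coeff N (childSum lv p w v) = 0 := by
  rw [coeff_childSum]
  exact Finset.sum_eq_zero fun u _ => hw.coeff_odd N u hN

theorem childSum_coeff_zero (hw : IsBranchSeries lv p w) (v : Fin n) :
    coeff 0 (childSum lv p w v) = (levelChildren lv p v).card := by
  rw [coeff_childSum, Finset.sum_congr rfl fun u _ => hw.coeff_zero u]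
  simp

end IsBranchSeries

namespace IsGreedyForest

/-- The earlier vertex has at least as many children, and all of them come before those of the later
one in the next level. -/
theorem childSum_antitone (hq : IsGreedyForest lv q) {N : ℕ}
    (h0 : ∀ v, 0 ≤ coeff N (ws v))
    (h : ∀ u v, u ≤ v → lv u = lv v → coeff N (ws v) ≤ coeff N (ws u)) {u v : Fin n}
    (huv : u ≤ v) (hl : lv u = lv v) :
    coeff N (childSum lv q ws v) ≤ coeff N (childSum lv q ws u) := by
  rcases huv.eq_or_lt with rfl | huv
  · exact le_rfl
  rw [IsBranchSeries.coeff_childSum, IsBranchSeries.coeff_childSum]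
  refine Finset.sum_le_sum_of_dominated (hq.anti u v huv.le hl) (fun a ha b hb => ?_)
    fun b _ => h0 b
  have hab : lv a = lv b := by rw [hq.forest.lv_child ha, hq.forest.lv_child hb, hl]
  rw [mem_levelChildren] at ha hb
  refine h b a (le_of_not_ge fun hle => ?_) hab.symm
  have := hq.mono a b hle ha.1 hab
  rw [ha.2, hb.2] at this
  exact absurd this (not_le.2 huv)

theorem coeff_antitone (hq : IsGreedyForest lv q) (hw : IsBranchSeries lv q ws) (N : ℕ) :
    ∀ u v, u ≤ v → lv u = lv v → coeff N (ws v) ≤ coeff N (ws u) := by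
  induction N using IsBranchSeries.coeff_induction with
  | h0 => intro _ _ _ _; rw [hw.coeff_zero, hw.coeff_zero]
  | h1 => intro u v _ _; rw [hw.coeff_one, hw.coeff_one]
  | h2 N ih =>
    intro u v huv hl
    rw [hw.coeff_add_two, hw.coeff_add_two]
    refine Finset.sum_le_sum fun x hx => ?_
    have hx' := mem_antidiagonal.1 hx
    exact mul_le_mul
      (hq.childSum_antitone (fun v => hw.coeff_nonneg _ v) (ih x.1 (by omega)) huv hl)
      (ih x.2 (by omega) u v huv hl) (hw.coeff_nonneg _ _) (hw.childSum_nonneg _ _)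

theorem childSum_antitoneOn (hq : IsGreedyForest lv q) (hw : IsBranchSeries lv q ws) (N l : ℕ) :
    AntitoneOn (fun v => coeff N (childSum lv q ws v)) (levelSet lv l) := fun _ hu _ hv huv =>
  hq.childSum_antitone (hw.coeff_nonneg N) (hq.coeff_antitone hw N) huv
    ((mem_levelSet.1 hu).trans (mem_levelSet.1 hv).symm)

/-- The greedy children of an initial part of a level form an initial part of the next level.
Because child counts decrease along the level, they are at least as many as the children of any set
of at most as many vertices. -/
theorem weakMaj_sum_children (hq : IsGreedyForest lv q) (hp : IsLevelForest lv p)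
    (hc : ∀ v, (levelChildren lv p v).card = (levelChildren lv q v).card) {l : ℕ}
    {α β : Fin n → ℝ} (h : WeakMaj (levelSet lv (l + 1)) α β) :
    WeakMaj (levelSet lv l) (fun v => ∑ u ∈ levelChildren lv p v, α u)
      (fun v => ∑ u ∈ levelChildren lv q v, β u) := by
  intro J hJ K hK hJK
  have hdis : ∀ r : Fin n → Fin n, ∀ s : Set (Fin n),
      s.PairwiseDisjoint (levelChildren lv r) := by
    intro r s u _ v _ huv
    refine Finset.disjoint_left.2 fun a ha hb => huv ?_
    exact (mem_levelChildren.1 ha).2.symm.trans (mem_levelChildren.1 hb).2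
  change ∑ v ∈ J, ∑ u ∈ levelChildren lv p v, α u ≤ ∑ v ∈ K, ∑ u ∈ levelChildren lv q v, β u
  rw [← Finset.sum_biUnion (hdis p _), ← Finset.sum_biUnion (hdis q _)]
  refine h _ ?_ _ ⟨?_, ?_⟩ ?_
  · intro u hu
    obtain ⟨v, hv, huv⟩ := Finset.mem_biUnion.1 hu
    rw [mem_levelSet, hp.lv_child huv, mem_levelSet.1 (hJ hv)]
  · intro u hu
    obtain ⟨v, hv, huv⟩ := Finset.mem_biUnion.1 hu
    rw [mem_levelSet, hq.forest.lv_child huv, mem_levelSet.1 (hK.1 hv)]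
  · intro a ha b hb hba
    obtain ⟨v, hv, hav⟩ := Finset.mem_biUnion.1 ha
    have hla := hq.forest.lv_child hav
    rw [mem_levelSet.1 (hK.1 hv)] at hla
    rw [mem_levelSet] at hb
    rw [mem_levelChildren] at hav
    have h1 := hq.mono b a hba (by omega) (by omega)
    rw [hav.2] at h1
    have h2 := hq.forest b (by omega)
    exact Finset.mem_biUnion.2 ⟨q b, hK.2 v hv (q b) (mem_levelSet.2 (by omega)) h1,
      mem_levelChildren.2 ⟨by omega, rfl⟩⟩
  · rw [Finset.card_biUnion fun _ _ _ _ huv => hdis p Set.univ trivial trivial huv,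
      Finset.card_biUnion fun _ _ _ _ huv => hdis q Set.univ trivial trivial huv,
      Finset.sum_congr rfl fun v _ => hc v]
    have := WeakMaj.of_antitoneOn (A := levelSet lv l)
      (α := fun v => ((levelChildren lv q v).card : ℝ))
      (fun u hu v hv huv => by
        exact Nat.cast_le.2 <| hq.anti u v huv ((mem_levelSet.1 hu).trans (mem_levelSet.1 hv).symm))
      (fun _ _ => Nat.cast_nonneg _) J hJ K hK hJK
    beta_reduce at this
    exact_mod_cast this

variable (hq : IsGreedyForest lv q) (hp : IsLevelForest lv p)
  (hc : ∀ v, (levelChildren lv p v).card = (levelChildren lv q v).card)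
  (hws : IsBranchSeries lv q ws) (hw : IsBranchSeries lv p w)

include hq hp hc hws hw

/-- Each coefficient is a sum of products of lower coefficients of child sums and of the series
itself, and all these operations preserve weak majorization. -/
theorem weakMaj_coeff (N : ℕ) : ∀ l, WeakMaj (levelSet lv l) (fun v => coeff N (w v))
    (fun v => coeff N (ws v)) := by
  induction N using IsBranchSeries.coeff_induction with
  | h0 => intro l; simp only [hw.coeff_zero, hws.coeff_zero]; exact WeakMaj.const zero_le_one
  | h1 => intro l; simp only [hw.coeff_one, hws.coeff_one]; exact WeakMaj.const le_rfl
  | h2 N ih =>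
    intro l
    simp only [hw.coeff_add_two, hws.coeff_add_two]
    refine WeakMaj.sum _ fun x hx => ?_
    have hx' := mem_antidiagonal.1 hx
    refine WeakMaj.mul ?_ (ih x.2 (by omega) l) (fun v _ => hw.coeff_nonneg _ v)
      (hq.childSum_antitoneOn hws _ _) (fun v _ => hws.childSum_nonneg _ v)
      (fun v _ => hws.coeff_nonneg _ v)
    simp only [IsBranchSeries.coeff_childSum]
    exact hq.weakMaj_sum_children hp hc (ih x.1 (by omega) (l + 1))

theorem weakMaj_childSum (N l : ℕ) : WeakMaj (levelSet lv l)
    (fun v => coeff N (childSum lv p w v)) (fun v => coeff N (childSum lv q ws v)) := by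
  simp only [IsBranchSeries.coeff_childSum]
  exact hq.weakMaj_sum_children hp hc (hq.weakMaj_coeff hp hc hws hw N (l + 1))

end IsGreedyForest

end LevelForest

/-! ### Coefficients of `X * f'` -/

section LogDerivative

open Finset PowerSeries

theorem PowerSeries.coeff_X_mul_derivative (f : ℝ⟦X⟧) (N : ℕ) :
    coeff N (X * d⁄dX ℝ f) = N * coeff N f := by
  cases N with
  | zero => simp
  | succ N => rw [coeff_succ_X_mul, coeff_derivative]; push_cast; ring

theorem PowerSeries.coeff_X_mul_derivative_mul (f g : ℝ⟦X⟧) (N : ℕ) :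
    coeff N (X * d⁄dX ℝ f * g) = ∑ x ∈ antidiagonal N, x.1 * (coeff x.1 f * coeff x.2 g) := by
  rw [coeff_mul]
  exact Finset.sum_congr rfl fun x _ => by rw [coeff_X_mul_derivative, mul_assoc]

end LogDerivative

/-! ### What equality in the contribution of a level implies -/

section EqualityInLevels

open Finset PowerSeries

variable {n : ℕ} {lv : Fin n → ℕ} {p q : Fin n → Fin n} {w ws : Fin n → ℝ⟦X⟧}

namespace IsGreedyForest

theorem coeff_X_sq_mul_nonneg {S : ℝ⟦X⟧} (h : ∀ i, 0 ≤ coeff i S) (i : ℕ) :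
    0 ≤ coeff i (X ^ 2 * S) := by
  rw [coeff_X_pow_mul']
  split_ifs
  · exact h _
  · exact le_rfl

theorem X_sq_childSum_antitoneOn (hq : IsGreedyForest lv q) (hws : IsBranchSeries lv q ws)
    (i l : ℕ) :
    AntitoneOn (fun v => coeff i (X ^ 2 * childSum lv q ws v)) (levelSet lv l) := by
  simp only [coeff_X_pow_mul']
  split_ifs
  · exact hq.childSum_antitoneOn hws _ _
  · exact antitoneOn_const

variable (hq : IsGreedyForest lv q) (hp : IsLevelForest lv p)
  (hc : ∀ v, (levelChildren lv p v).card = (levelChildren lv q v).card)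
  (hws : IsBranchSeries lv q ws) (hw : IsBranchSeries lv p w)

include hq hp hc hws hw

theorem weakMaj_X_sq_childSum (i l : ℕ) : WeakMaj (levelSet lv l)
    (fun v => coeff i (X ^ 2 * childSum lv p w v))
    (fun v => coeff i (X ^ 2 * childSum lv q ws v)) := by
  simp only [coeff_X_pow_mul']
  split_ifs
  · exact hq.weakMaj_childSum hp hc hws hw _ _
  · exact WeakMaj.const le_rfl

theorem weakMaj_mul_coeff (i j l : ℕ) : WeakMaj (levelSet lv l)
    (fun v => coeff i (X ^ 2 * childSum lv p w v) * coeff j (w v))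
    (fun v => coeff i (X ^ 2 * childSum lv q ws v) * coeff j (ws v)) :=
  (hq.weakMaj_X_sq_childSum hp hc hws hw i l).mul (hq.weakMaj_coeff hp hc hws hw j l)
    (fun v _ => hw.coeff_nonneg j v) (hq.X_sq_childSum_antitoneOn hws i l)
    (fun v _ => coeff_X_sq_mul_nonneg (fun i => hws.childSum_nonneg i v) i)
    (fun v _ => hws.coeff_nonneg j v)

/-- The contribution is a combination of products of two coefficients with nonnegative weights, the
weights coming from the derivative. -/
theorem sum_level_le (N l : ℕ) :
    ∑ v ∈ levelSet lv l, coeff N (X * d⁄dX ℝ (X ^ 2 * childSum lv p w v) * w v) ≤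
      ∑ v ∈ levelSet lv l, coeff N (X * d⁄dX ℝ (X ^ 2 * childSum lv q ws v) * ws v) := by
  simp only [coeff_X_mul_derivative_mul]
  refine WeakMaj.sum_le ?_
  refine WeakMaj.sum _ fun x _ => ?_
  exact (hq.weakMaj_mul_coeff hp hc hws hw x.1 x.2 l).const_mul (Nat.cast_nonneg _)

theorem sum_mul_coeff_eq_of_sum_level_eq {N l : ℕ}
    (h : ∑ v ∈ levelSet lv l, coeff N (X * d⁄dX ℝ (X ^ 2 * childSum lv p w v) * w v) =
      ∑ v ∈ levelSet lv l, coeff N (X * d⁄dX ℝ (X ^ 2 * childSum lv q ws v) * ws v))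
    {i j : ℕ} (hij : i + j = N) (hi : i ≠ 0) :
    ∑ v ∈ levelSet lv l, coeff i (X ^ 2 * childSum lv p w v) * coeff j (w v) =
      ∑ v ∈ levelSet lv l, coeff i (X ^ 2 * childSum lv q ws v) * coeff j (ws v) := by
  simp only [coeff_X_mul_derivative_mul] at h
  rw [Finset.sum_comm, Finset.sum_comm (s := levelSet lv l)] at h
  simp only [← Finset.mul_sum] at h
  have := (Finset.sum_eq_sum_iff_of_le fun x _ => mul_le_mul_of_nonneg_left
    (hq.weakMaj_mul_coeff hp hc hws hw x.1 x.2 l).sum_le (Nat.cast_nonneg x.1)).1 h (i, j)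
    (mem_antidiagonal.2 hij)
  exact mul_left_cancel₀ (Nat.cast_ne_zero.2 hi) this

/-- If the greedy forest does not increase the contribution of the level `l`, then it does not
increase the sums of products of two coefficients either. -/
theorem sum_childSum_mul_eq {l : ℕ}
    (h : ∀ N, Even N →
      ∑ v ∈ levelSet lv l, coeff N (X * d⁄dX ℝ (X ^ 2 * childSum lv p w v) * w v) =
      ∑ v ∈ levelSet lv l, coeff N (X * d⁄dX ℝ (X ^ 2 * childSum lv q ws v) * ws v))
    (i j : ℕ) (hij : Even (i + j)) :
    ∑ v ∈ levelSet lv l, coeff i (childSum lv p w v) * coeff j (childSum lv p w v) =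
      ∑ v ∈ levelSet lv l, coeff i (childSum lv q ws v) * coeff j (childSum lv q ws v) := by
  -- The shifts by 2 undo the factor `X ^ 2` and expand the second coefficient through its
  -- recursion. In that expansion the index `(j, 0)` isolates the wanted product, since the series
  -- have constant term 1.
  have h1 := hq.sum_mul_coeff_eq_of_sum_level_eq hp hc hws hw
    (h (i + 2 + (j + 2)) (by
      rw [show i + 2 + (j + 2) = i + j + 4 by ring]; exact hij.add (by decide))) rfl (by omega)
  simp only [coeff_X_pow_mul, hw.coeff_add_two, hws.coeff_add_two, Finset.mul_sum] at h1
  rw [Finset.sum_comm, Finset.sum_comm (s := levelSet lv l)] at h1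
  have h2 : ∀ x ∈ antidiagonal j,
      ∑ v ∈ levelSet lv l, coeff i (childSum lv p w v) *
        (coeff x.1 (childSum lv p w v) * coeff x.2 (w v)) ≤
      ∑ v ∈ levelSet lv l, coeff i (childSum lv q ws v) *
        (coeff x.1 (childSum lv q ws v) * coeff x.2 (ws v)) := by
    intro x _
    refine WeakMaj.sum_le ((hq.weakMaj_childSum hp hc hws hw i l).mul
      ((hq.weakMaj_childSum hp hc hws hw x.1 l).mul (hq.weakMaj_coeff hp hc hws hw x.2 l)
        (fun v _ => hw.coeff_nonneg _ v) (hq.childSum_antitoneOn hws _ _)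
        (fun v _ => hws.childSum_nonneg _ v) (fun v _ => hws.coeff_nonneg _ v))
      (fun v _ => mul_nonneg (hw.childSum_nonneg _ v) (hw.coeff_nonneg _ v))
      (hq.childSum_antitoneOn hws _ _) (fun v _ => hws.childSum_nonneg _ v)
      (fun v _ => mul_nonneg (hws.childSum_nonneg _ v) (hws.coeff_nonneg _ v)))
  have h3 := (Finset.sum_eq_sum_iff_of_le h2).1 h1 (j, 0) (mem_antidiagonal.2 rfl)
  simpa only [hw.coeff_zero, hws.coeff_zero, mul_one] using h3

end IsGreedyForest

/-- Coefficientwise comparison of power series. -/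
def PowerSeries.CoeffLE (f g : ℝ⟦X⟧) : Prop := ∀ i, coeff i f ≤ coeff i g

theorem PowerSeries.CoeffLE.refl (f : ℝ⟦X⟧) : CoeffLE f f := fun _ => le_rfl

theorem PowerSeries.CoeffLE.trans {f g h : ℝ⟦X⟧} (h1 : CoeffLE f g) (h2 : CoeffLE g h) :
    CoeffLE f h := fun i => (h1 i).trans (h2 i)

theorem PowerSeries.CoeffLE.exists_lt {f g : ℝ⟦X⟧} (hne : ¬ CoeffLE g f) :
    ∃ i, coeff i f < coeff i g := by
  by_contra! hcon
  exact hne hcon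

/-- Two power series are comparable if no two coefficients are ordered in opposite ways. -/
theorem PowerSeries.coeffLE_total_of {f g : ℝ⟦X⟧}
    (h : ∀ i j, coeff i f < coeff i g → coeff j g < coeff j f → False) :
    CoeffLE f g ∨ CoeffLE g f := by
  by_contra! hcon
  obtain ⟨h1, h2⟩ := hcon
  simp only [CoeffLE, not_forall, not_le] at h1 h2
  obtain ⟨i, hi⟩ := h1
  obtain ⟨j, hj⟩ := h2
  exact h j i hj hi

theorem IsBranchSeries.coeffLE_of_childSum_le (hw : IsBranchSeries lv p w) {u v : Fin n}
    (h : CoeffLE (childSum lv p w v) (childSum lv p w u)) : CoeffLE (w v) (w u) := by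
  intro N
  induction N using IsBranchSeries.coeff_induction with
  | h0 => rw [hw.coeff_zero, hw.coeff_zero]
  | h1 => rw [hw.coeff_one, hw.coeff_one]
  | h2 N ih =>
    rw [hw.coeff_add_two, hw.coeff_add_two]
    refine Finset.sum_le_sum fun x hx => ?_
    have hx' := mem_antidiagonal.1 hx
    exact mul_le_mul (h x.1) (ih x.2 (by omega)) (hw.coeff_nonneg _ _) (hw.childSum_nonneg _ _)

/-- If the child sums were ordered the other way, both branch series would coincide, and then the
defining equation makes the child sums equal. -/
theorem IsBranchSeries.childSum_le_of_coeffLE (hw : IsBranchSeries lv p w) {u v : Fin n}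
    (htot : CoeffLE (childSum lv p w v) (childSum lv p w u) ∨
      CoeffLE (childSum lv p w u) (childSum lv p w v))
    (h : CoeffLE (w v) (w u)) : CoeffLE (childSum lv p w v) (childSum lv p w u) := by
  rcases htot with h1 | h1
  · exact h1
  have h2 := hw.coeffLE_of_childSum_le h1
  have hwe : w v = w u := PowerSeries.ext fun i => le_antisymm (h i) (h2 i)
  have h0 : w u ≠ 0 := fun h => by have := hw.coeff_zero u; rw [h] at this; simp at this
  have hs : X ^ 2 * childSum lv p w v = X ^ 2 * childSum lv p w u := by
    have e1 := hw v
    have e2 := hw u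
    rw [hwe] at e1
    have := mul_left_cancel₀ h0 (e1.trans e2.symm)
    linear_combination -this
  rw [mul_left_cancel₀ (pow_ne_zero 2 X_ne_zero) hs]
  exact CoeffLE.refl _

theorem sum_mul_comp_swap_sub {ι : Type*} [DecidableEq ι] {A : Finset ι} {u v : ι} (hu : u ∈ A)
    (hv : v ∈ A) (huv : u ≠ v) (f g : ι → ℝ) :
    ∑ x ∈ A, f x * g (Equiv.swap u v x) - ∑ x ∈ A, f x * g x = (f u - f v) * (g v - g u) := by
  rw [← Finset.sum_sub_distrib, ← Finset.sum_subset (s₁ := {u, v})]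
  · rw [Finset.sum_pair huv, Equiv.swap_apply_left, Equiv.swap_apply_right]
    ring
  · intro x hx
    rcases Finset.mem_insert.1 hx with rfl | hx
    · exact hu
    · rw [Finset.mem_singleton.1 hx]; exact hv
  · intro x _ hx
    rw [Finset.mem_insert, Finset.mem_singleton, not_or] at hx
    rw [Equiv.swap_apply_of_ne_of_ne hx.1 hx.2, sub_self]

/-- The forest in which the branches below `a` and `b` have been exchanged. -/
theorem IsLevelForest.comp_swap (hp : IsLevelForest lv p) {a b : Fin n} (hab : lv a = lv b) :
    IsLevelForest lv (p ∘ Equiv.swap a b) := by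
  have hl : ∀ j, lv (Equiv.swap a b j) = lv j := by
    intro j
    rcases eq_or_ne j a with rfl | ha
    · rw [Equiv.swap_apply_left, hab]
    rcases eq_or_ne j b with rfl | hb
    · rw [Equiv.swap_apply_right, hab]
    · rw [Equiv.swap_apply_of_ne_of_ne ha hb]
  intro j hj
  have := hp (Equiv.swap a b j) (by rwa [hl])
  rwa [hl] at this

theorem levelChildren_comp_swap {a b : Fin n} (hab : lv a = lv b) (v : Fin n) :
    levelChildren lv (p ∘ Equiv.swap a b) v =
      (levelChildren lv p v).map (Equiv.swap a b).toEmbedding := by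
  ext j
  rw [Finset.mem_map_equiv, mem_levelChildren, mem_levelChildren, Equiv.symm_swap]
  have : lv (Equiv.swap a b j) = lv j := by
    rcases eq_or_ne j a with rfl | ha
    · rw [Equiv.swap_apply_left, hab]
    rcases eq_or_ne j b with rfl | hb
    · rw [Equiv.swap_apply_right, hab]
    · rw [Equiv.swap_apply_of_ne_of_ne ha hb]
  rw [this]
  rfl

theorem sum_levelChildren_comp_swap {a b : Fin n} (hab : lv a = lv b) (ha : lv a ≠ 0)
    (hpab : p a ≠ p b) (α : Fin n → ℝ) :
    (∑ x ∈ levelChildren lv (p ∘ Equiv.swap a b) (p a), α x =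
      ∑ x ∈ levelChildren lv p (p a), α x + (α b - α a)) ∧
    (∑ x ∈ levelChildren lv (p ∘ Equiv.swap a b) (p b), α x =
      ∑ x ∈ levelChildren lv p (p b), α x - (α b - α a)) ∧
    ∀ v, v ≠ p a → v ≠ p b → ∑ x ∈ levelChildren lv (p ∘ Equiv.swap a b) v, α x =
      ∑ x ∈ levelChildren lv p v, α x := by
  have key : ∀ v, ∑ x ∈ levelChildren lv (p ∘ Equiv.swap a b) v, α x =
      ∑ x ∈ levelChildren lv p v, α x +
      ∑ x ∈ levelChildren lv p v, (α (Equiv.swap a b x) - α x) := by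
    intro v
    rw [levelChildren_comp_swap hab, Finset.sum_map, Finset.sum_sub_distrib]
    simp
  refine ⟨?_, ?_, fun v hva hvb => ?_⟩
  · rw [key, Finset.sum_eq_single_of_mem (f := fun x => α (Equiv.swap a b x) - α x) a
      (mem_levelChildren.2 ⟨ha, rfl⟩), Equiv.swap_apply_left]
    intro x hx hxa
    rw [mem_levelChildren] at hx
    rw [Equiv.swap_apply_of_ne_of_ne hxa (by rintro rfl; exact hpab hx.2.symm), sub_self]
  · rw [key, Finset.sum_eq_single_of_mem (f := fun x => α (Equiv.swap a b x) - α x) b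
      (mem_levelChildren.2 ⟨hab ▸ ha, rfl⟩), Equiv.swap_apply_right]
    · ring
    intro x hx hxb
    rw [mem_levelChildren] at hx
    rw [Equiv.swap_apply_of_ne_of_ne (by rintro rfl; exact hpab hx.2) hxb, sub_self]
  · rw [key, Finset.sum_eq_zero (f := fun x => α (Equiv.swap a b x) - α x), add_zero]
    intro x hx
    rw [mem_levelChildren] at hx
    rw [Equiv.swap_apply_of_ne_of_ne (by rintro rfl; exact hva hx.2.symm)
      (by rintro rfl; exact hvb hx.2.symm), sub_self]

namespace IsGreedyForest

variable (hq : IsGreedyForest lv q) (hp : IsLevelForest lv p)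
  (hc : ∀ v, (levelChildren lv p v).card = (levelChildren lv q v).card)
  (hws : IsBranchSeries lv q ws) (hw : IsBranchSeries lv p w)

include hq hp hc hws hw

/-- If `u` and `v` were ordered oppositely by coefficients `i` and `j`, exchanging their `j`-th
coefficients would increase the sum of products. The exchanged family is still weakly majorized by
the greedy one, whose sum of products is already attained. Only even indices matter, because odd
coefficients vanish. -/
theorem childSum_total_of_sum_eq {l : ℕ}
    (h : ∀ i j, Even (i + j) →
      ∑ v ∈ levelSet lv l, coeff i (childSum lv p w v) * coeff j (childSum lv p w v) =
      ∑ v ∈ levelSet lv l, coeff i (childSum lv q ws v) * coeff j (childSum lv q ws v))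
    {u v : Fin n} (hu : lv u = l) (hv : lv v = l) :
    CoeffLE (childSum lv p w v) (childSum lv p w u) ∨
      CoeffLE (childSum lv p w u) (childSum lv p w v) := by
  rcases eq_or_ne u v with rfl | huv
  · exact Or.inl (CoeffLE.refl _)
  refine coeffLE_total_of fun i j hi hj => ?_
  have hi' : Even i := by
    rw [← Nat.not_odd_iff_even]
    intro ho
    rw [hw.childSum_odd v ho, hw.childSum_odd u ho] at hi
    exact lt_irrefl _ hi
  have hj' : Even j := by
    rw [← Nat.not_odd_iff_even]
    intro ho
    rw [hw.childSum_odd v ho, hw.childSum_odd u ho] at hj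
    exact lt_irrefl _ hj
  have hperm : WeakMaj (levelSet lv l)
      ((fun v => coeff j (childSum lv p w v)) ∘ Equiv.swap u v)
      (fun v => coeff j (childSum lv q ws v)) := by
    refine (hq.weakMaj_childSum hp hc hws hw j l).comp_perm _ fun x hx => ?_
    rcases eq_or_ne x u with rfl | hxu
    · rw [Equiv.swap_apply_left]; exact mem_levelSet.2 hv
    rcases eq_or_ne x v with rfl | hxv
    · rw [Equiv.swap_apply_right]; exact mem_levelSet.2 hu
    · rwa [Equiv.swap_apply_of_ne_of_ne hxu hxv]
  have h1 := ((hq.weakMaj_childSum hp hc hws hw i l).mul hperm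
    (fun x _ => hw.childSum_nonneg j _) (hq.childSum_antitoneOn hws _ _)
    (fun v _ => hws.childSum_nonneg _ v) (fun v _ => hws.childSum_nonneg _ v)).sum_le
  rw [← h i j (hi'.add hj')] at h1
  have h2 := sum_mul_comp_swap_sub (A := levelSet lv l) (mem_levelSet.2 hu) (mem_levelSet.2 hv)
    huv (fun v => coeff i (childSum lv p w v)) (fun v => coeff j (childSum lv p w v))
  have h3 : 0 < (coeff i (childSum lv p w u) - coeff i (childSum lv p w v)) *
      (coeff j (childSum lv p w v) - coeff j (childSum lv p w u)) :=
    mul_pos (sub_pos.2 hi) (sub_pos.2 hj)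
  simp only [Function.comp_apply] at h1
  linarith

/-- If the better parent had the worse child, exchanging the branches at `a` and `b` would spread
the two child sums of the parents further apart and increase their sum of squares. The exchanged
forest has the same child counts, so it cannot exceed the greedy bound. -/
theorem children_le_of_sum_eq {l : ℕ}
    (h : ∀ i, ∑ v ∈ levelSet lv l, coeff i (childSum lv p w v) * coeff i (childSum lv p w v) =
      ∑ v ∈ levelSet lv l, coeff i (childSum lv q ws v) * coeff i (childSum lv q ws v))
    (htot : ∀ a b, lv a = l + 1 → lv b = l + 1 →
      CoeffLE (childSum lv p w b) (childSum lv p w a) ∨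
        CoeffLE (childSum lv p w a) (childSum lv p w b))
    {a b : Fin n} (ha : lv a = l + 1) (hb : lv b = l + 1) (hab : p a ≠ p b)
    (hle : CoeffLE (childSum lv p w (p b)) (childSum lv p w (p a))) :
    CoeffLE (childSum lv p w b) (childSum lv p w a) := by
  refine hw.childSum_le_of_coeffLE (htot a b ha hb) ?_
  by_contra hcon
  have hwab : CoeffLE (w a) (w b) := hw.coeffLE_of_childSum_le
    ((htot a b ha hb).resolve_left fun h' => hcon (hw.coeffLE_of_childSum_le h'))
  obtain ⟨i, hi⟩ := CoeffLE.exists_lt hcon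
  have hlab : lv a = lv b := ha.trans hb.symm
  have hpa := hp a (by omega)
  have hpb := hp b (by omega)
  have hmaj := hq.weakMaj_sum_children (hp.comp_swap hlab) (fun v => by
    rw [levelChildren_comp_swap hlab, Finset.card_map, hc])
    (hq.weakMaj_coeff hp hc hws hw i (l + 1))
  have h1 := (hmaj.mul hmaj (fun v _ => Finset.sum_nonneg fun u _ => hw.coeff_nonneg i u)
    (by
      have := hq.childSum_antitoneOn hws i l
      simpa only [IsBranchSeries.coeff_childSum] using this)
    (fun v _ => Finset.sum_nonneg fun u _ => hws.coeff_nonneg i u)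
    (fun v _ => Finset.sum_nonneg fun u _ => hws.coeff_nonneg i u)).sum_le
  have h2 := h i
  simp only [IsBranchSeries.coeff_childSum] at h2
  rw [← h2] at h1
  obtain ⟨e1, e2, e3⟩ := sum_levelChildren_comp_swap (p := p) hlab (by omega) hab
    (fun v => coeff i (w v))
  have h3 : ∑ v ∈ levelSet lv l, ((∑ x ∈ levelChildren lv (p ∘ Equiv.swap a b) v, coeff i (w x)) *
      (∑ x ∈ levelChildren lv (p ∘ Equiv.swap a b) v, coeff i (w x)) -
      (∑ x ∈ levelChildren lv p v, coeff i (w x)) * (∑ x ∈ levelChildren lv p v, coeff i (w x))) =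
      ∑ v ∈ {p a, p b}, ((∑ x ∈ levelChildren lv (p ∘ Equiv.swap a b) v, coeff i (w x)) *
      (∑ x ∈ levelChildren lv (p ∘ Equiv.swap a b) v, coeff i (w x)) -
      (∑ x ∈ levelChildren lv p v, coeff i (w x)) *
      (∑ x ∈ levelChildren lv p v, coeff i (w x))) := by
    refine (Finset.sum_subset ?_ ?_).symm
    · intro x hx
      rw [Finset.mem_insert, Finset.mem_singleton] at hx
      rw [mem_levelSet]
      rcases hx with rfl | rfl <;> omega
    · intro x _ hx
      rw [Finset.mem_insert, Finset.mem_singleton, not_or] at hx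
      rw [e3 x hx.1 hx.2, sub_self]
  rw [Finset.sum_pair hab, e1, e2, Finset.sum_sub_distrib] at h3
  have h4 := hle i
  rw [IsBranchSeries.coeff_childSum, IsBranchSeries.coeff_childSum] at h4
  have h5 : 0 < (coeff i (w b) - coeff i (w a)) * (coeff i (w b) - coeff i (w a)) :=
    mul_pos (sub_pos.2 hi) (sub_pos.2 hi)
  have h6 := mul_nonneg (sub_nonneg.2 h4) (sub_pos.2 hi).le
  -- With `δ = coeff i (w b) - coeff i (w a)`, the sum of squares grows by `2 * δ` times the
  -- difference of the parents' child sums, plus `2 * δ ^ 2`.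
  nlinarith

end IsGreedyForest

end EqualityInLevels

/-! ### Spectral moments of a tree from its closed-walk series -/

section Spectrum

open Finset PowerSeries

/-- The children of `v` in the tree on `Fin n` with root `0` and parent function `p`. -/
def treeChildren {n : ℕ} (p : Fin n → Fin n) (v : Fin n) : Finset (Fin n) :=
  univ.filter fun u => (u : ℕ) ≠ 0 ∧ p u = v

theorem mem_treeChildren {n : ℕ} {p : Fin n → Fin n} {u v : Fin n} :
    u ∈ treeChildren p v ↔ (u : ℕ) ≠ 0 ∧ p u = v := by
  simp [treeChildren]

/-- The graph in which every vertex other than `0` is joined to its parent. -/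
def parentGraph {n : ℕ} (p : Fin n → Fin n) : SimpleGraph (Fin n) :=
  SimpleGraph.fromRel fun i j => j ∈ treeChildren p i

/-- Every vertex other than `0` has a parent with a smaller number. -/
def IsParentFun {n : ℕ} (p : Fin n → Fin n) : Prop := ∀ j : Fin n, (j : ℕ) ≠ 0 → p j < j

theorem IsParentFun.lt {n : ℕ} {p : Fin n → Fin n} (hp : IsParentFun p) {u v : Fin n}
    (h : u ∈ treeChildren p v) : v < u := by
  rw [mem_treeChildren] at h
  exact h.2 ▸ hp u h.1

theorem parentGraph_adj {n : ℕ} {p : Fin n → Fin n} (hp : IsParentFun p) {i j : Fin n} :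
    (parentGraph p).Adj i j ↔ i ∈ treeChildren p j ∨ j ∈ treeChildren p i := by
  rw [parentGraph, SimpleGraph.fromRel_adj]
  constructor
  · rintro ⟨_, h | h⟩
    · exact Or.inr h
    · exact Or.inl h
  · rintro (h | h)
    · exact ⟨(hp.lt h).ne', Or.inr h⟩
    · exact ⟨(hp.lt h).ne, Or.inl h⟩

/-- Gaussian elimination from the leaves upwards: `1 - X A = U D Uᵀ` with `U` unitriangular, since
parents precede their children, and `D` the diagonal matrix of the factors. -/
theorem IsParentFun.det_eq_prod {n : ℕ} {p : Fin n → Fin n} (hp : IsParentFun p)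
    [DecidableRel (parentGraph p).Adj] {W : Fin n → ℝ⟦X⟧}
    (hW : ∀ v, W v * (1 - X ^ 2 * ∑ u ∈ treeChildren p v, W u) = 1) :
    (1 - (X : ℝ⟦X⟧) • ((parentGraph p).adjMatrix ℝ).map (C : ℝ →+* ℝ⟦X⟧)).det =
      ∏ v, (1 - X ^ 2 * ∑ u ∈ treeChildren p v, W u) := by
  set d : Fin n → ℝ⟦X⟧ := fun v => 1 - X ^ 2 * ∑ u ∈ treeChildren p v, W u with hd
  -- As `W k` inverts the diagonal entry at `k`, the entries of `N D` are `-X`, and `N D Nᵀ` is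
  -- diagonal because each vertex has one parent.
  let N : Matrix (Fin n) (Fin n) ℝ⟦X⟧ :=
    Matrix.of fun i k => if k ∈ treeChildren p i then -(X * W k) else 0
  have hN : ∀ i k, N i k = if k ∈ treeChildren p i then -(X * W k) else 0 := fun _ _ => rfl
  have hdet : (1 + N).det = 1 := by
    rw [Matrix.det_of_isUpperTriangular]
    · refine Finset.prod_eq_one fun i _ => ?_
      rw [Matrix.add_apply, Matrix.one_apply_eq, hN, if_neg, add_zero]
      exact fun h => lt_irrefl _ (hp.lt h)
    · intro i j hij
      have hij' : j < i := hij
      rw [Matrix.add_apply, Matrix.one_apply_ne hij'.ne', hN, if_neg, add_zero]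
      exact fun h => lt_asymm hij' (hp.lt h)
  have hfac : 1 - (X : ℝ⟦X⟧) • ((parentGraph p).adjMatrix ℝ).map (C : ℝ →+* ℝ⟦X⟧) =
      (1 + N) * Matrix.diagonal d * (1 + N).transpose := by
    rw [Matrix.transpose_add, Matrix.transpose_one, add_mul, one_mul, mul_add, mul_one, add_mul (Matrix.diagonal d)]
    ext1 i j
    have hND : (N * Matrix.diagonal d) i j = if j ∈ treeChildren p i then -X else 0 := by
      rw [Matrix.mul_diagonal, hN]
      split_ifs
      · linear_combination (-X) * hW j
      · rw [zero_mul]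
    have hDN : (Matrix.diagonal d * N.transpose) i j =
        if i ∈ treeChildren p j then -X else 0 := by
      rw [Matrix.diagonal_mul, Matrix.transpose_apply, hN]
      split_ifs
      · linear_combination (-X) * hW i
      · rw [mul_zero]
    have hNDN : (N * Matrix.diagonal d * N.transpose) i j =
        if i = j then X ^ 2 * ∑ u ∈ treeChildren p i, W u else 0 := by
      rw [Matrix.mul_apply]
      simp only [Matrix.mul_diagonal, Matrix.transpose_apply]
      split_ifs with hij
      · subst hij
        rw [Finset.mul_sum, ← Finset.sum_subset (Finset.subset_univ (treeChildren p i))]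
        · refine Finset.sum_congr rfl fun k hk => ?_
          simp only [hN, if_pos hk]
          linear_combination (X ^ 2 * W k) * hW k
        · intro k _ hk
          simp only [hN, if_neg hk, mul_zero]
      · refine Finset.sum_eq_zero fun k _ => ?_
        simp only [hN]
        split_ifs with h1 h2
        · exact absurd ((mem_treeChildren.1 h1).2.symm.trans (mem_treeChildren.1 h2).2) hij
        · rw [mul_zero]
        · rw [zero_mul, zero_mul]
        · rw [zero_mul, zero_mul]
    rw [Matrix.add_apply, Matrix.add_apply, Matrix.add_apply, hND, hDN, hNDN, Matrix.sub_apply,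
      Matrix.smul_apply, Matrix.map_apply, SimpleGraph.adjMatrix_apply]
    rcases eq_or_ne i j with rfl | hij
    · have h1 : i ∉ treeChildren p i := fun h => lt_irrefl _ (hp.lt h)
      rw [if_neg h1, if_neg ((parentGraph p).irrefl), if_pos rfl, Matrix.one_apply_eq,
        Matrix.diagonal_apply_eq, hd]
      simp
    · rw [Matrix.one_apply_ne hij, Matrix.diagonal_apply_ne _ hij, if_neg hij]
      by_cases h1 : i ∈ treeChildren p j
      · have h2 : j ∉ treeChildren p i := fun h => lt_asymm (hp.lt h) (hp.lt h1)
        rw [if_pos ((parentGraph_adj hp).2 (Or.inl h1)), if_pos h1, if_neg h2]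
        simp
      · by_cases h2 : j ∈ treeChildren p i
        · rw [if_pos ((parentGraph_adj hp).2 (Or.inr h2)), if_pos h2, if_neg h1]
          simp
        · rw [if_neg fun h => ((parentGraph_adj hp).1 h).elim h1 h2, if_neg h1, if_neg h2]
          simp
  rw [hfac, Matrix.det_mul, Matrix.det_mul, Matrix.det_transpose, hdet, Matrix.det_diagonal,
    one_mul, mul_one]

/-- The negative logarithmic derivative, multiplied by the variable. -/
noncomputable def PowerSeries.negLogDeriv (P : ℝ⟦X⟧) : ℝ⟦X⟧ := -(X * d⁄dX ℝ P * P⁻¹)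

theorem PowerSeries.negLogDeriv_mul {P Q : ℝ⟦X⟧} (hP : constantCoeff P ≠ 0)
    (hQ : constantCoeff Q ≠ 0) : negLogDeriv (P * Q) = negLogDeriv P + negLogDeriv Q := by
  rw [negLogDeriv, negLogDeriv, negLogDeriv, PowerSeries.mul_inv_rev, Derivation.leibniz,
    smul_eq_mul, smul_eq_mul]
  linear_combination (-(X * d⁄dX ℝ Q * Q⁻¹)) * PowerSeries.mul_inv_cancel P hP +
    (-(X * d⁄dX ℝ P * P⁻¹)) * PowerSeries.mul_inv_cancel Q hQ

theorem PowerSeries.negLogDeriv_prod {ι : Type*} (s : Finset ι) (P : ι → ℝ⟦X⟧)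
    (hP : ∀ i, constantCoeff (P i) ≠ 0) :
    negLogDeriv (∏ i ∈ s, P i) = ∑ i ∈ s, negLogDeriv (P i) := by
  classical
  induction s using Finset.induction_on with
  | empty => simp [negLogDeriv]
  | insert a s ha ih =>
    rw [Finset.prod_insert ha, Finset.sum_insert ha, negLogDeriv_mul (hP a), ih]
    rw [map_prod]
    exact Finset.prod_ne_zero_iff.2 fun i _ => hP i

theorem PowerSeries.negLogDeriv_one_sub {Y W : ℝ⟦X⟧} (h : W * (1 - Y) = 1) :
    negLogDeriv (1 - Y) = X * d⁄dX ℝ Y * W := by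
  have hc : constantCoeff (1 - Y) ≠ 0 := by
    intro h0
    have := congrArg constantCoeff h
    rw [map_mul, h0, mul_zero, map_one] at this
    exact zero_ne_one this
  have : (1 - Y)⁻¹ = W := by
    rw [eq_comm, PowerSeries.eq_inv_iff_mul_eq_one hc, h]
  rw [negLogDeriv, this, map_sub, map_one_eq_zero]
  ring
where
  map_one_eq_zero : d⁄dX ℝ (1 : ℝ⟦X⟧) = 0 := derivative_one

/-- The inverse of `1 - a X` is the geometric series. The exponent 0 is excluded because
`negLogDeriv` has no constant term. -/
theorem PowerSeries.coeff_negLogDeriv_linear (a : ℝ) {k : ℕ} (hk : k ≠ 0) :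
    coeff k (negLogDeriv (1 - C a * X)) = a ^ k := by
  have h : (PowerSeries.mk fun i => a ^ i) * (1 - C a * X) = 1 := by
    ext i
    rw [mul_sub, mul_one, map_sub, ← mul_assoc, mul_comm _ (C a), mul_assoc]
    cases i with
    | zero => simp
    | succ i => simp [PowerSeries.coeff_one, coeff_succ_mul_X, pow_succ']
  rw [negLogDeriv_one_sub h]
  obtain ⟨k, rfl⟩ := Nat.exists_eq_succ_of_ne_zero hk
  have : X * d⁄dX ℝ (C a * X) * (PowerSeries.mk fun i => a ^ i) =
      X * (C a * PowerSeries.mk fun i => a ^ i) := by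
    rw [Derivation.leibniz, derivative_C, derivative_X]
    simp [mul_assoc]
  rw [this, coeff_succ_X_mul, coeff_C_mul, coeff_mk, pow_succ']

/-- The determinant is the reversed characteristic polynomial, viewed as a power series. -/
theorem Matrix.IsHermitian.det_one_sub_X_smul {V : Type*} [Fintype V] [DecidableEq V]
    {A : Matrix V V ℝ} (hA : A.IsHermitian) :
    (1 - (X : ℝ⟦X⟧) • A.map (C : ℝ →+* ℝ⟦X⟧)).det = ∏ i, (1 - C (hA.eigenvalues i) * X) := by
  have h1 : A.charpolyRev = ∏ i, (1 - Polynomial.C (hA.eigenvalues i) * Polynomial.X) := by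
    rw [← Matrix.reverse_charpoly, hA.charpoly_eq]
    have : ∀ s : Finset V, (∏ i ∈ s, (Polynomial.X -
        Polynomial.C ((hA.eigenvalues i : ℝ) : ℝ))).reverse =
        ∏ i ∈ s, (1 - Polynomial.C (hA.eigenvalues i) * Polynomial.X) := by
      intro s
      induction s using Finset.induction_on with
      | empty => exact Polynomial.reverse_C 1
      | insert a s ha ih =>
        rw [Finset.prod_insert ha, Finset.prod_insert ha, Polynomial.reverse_mul_of_domain, ih]
        congr 1
        have hX : (Polynomial.X : Polynomial ℝ).reverse = 1 := by
          have := Polynomial.reverse_X_mul (1 : Polynomial ℝ)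
          rw [mul_one] at this
          exact this.trans (Polynomial.reverse_C 1)
        rw [sub_eq_add_neg, ← Polynomial.C_neg, Polynomial.reverse_add_C, hX,
          Polynomial.natDegree_X, pow_one, Polynomial.C_neg, neg_mul, sub_eq_add_neg]
    exact this univ
  have h2 := congrArg (Polynomial.coeToPowerSeries.ringHom (R := ℝ)) h1
  rw [Matrix.charpolyRev, RingHom.map_det, map_prod] at h2
  convert h2 using 2
  · ext1 i j
    simp only [Matrix.sub_apply, Matrix.smul_apply, Matrix.map_apply, RingHom.mapMatrix_apply,
      Matrix.one_apply, Polynomial.coeToPowerSeries.ringHom_apply, smul_eq_mul]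
    split_ifs <;> simp <;> exact mul_comm _ _
  · simp

theorem SimpleGraph.sum_eigenvalues_pow {V : Type*} [Fintype V] [DecidableEq V]
    (G : SimpleGraph V) [DecidableRel G.Adj] {k : ℕ} (hk : k ≠ 0) :
    ∑ i, (adjMatrix_isHermitian G).eigenvalues i ^ k =
      coeff k (negLogDeriv (1 - (X : ℝ⟦X⟧) • (G.adjMatrix ℝ).map (C : ℝ →+* ℝ⟦X⟧)).det) := by
  rw [(adjMatrix_isHermitian G).det_one_sub_X_smul, negLogDeriv_prod _ _ fun i => by simp, map_sum]
  exact Finset.sum_congr rfl fun i _ => (coeff_negLogDeriv_linear _ hk).symm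

theorem IsParentFun.sum_eigenvalues_pow {n : ℕ} {p : Fin n → Fin n} (hp : IsParentFun p)
    [DecidableRel (parentGraph p).Adj] {W : Fin n → ℝ⟦X⟧}
    (hW : ∀ v, W v * (1 - X ^ 2 * ∑ u ∈ treeChildren p v, W u) = 1) {k : ℕ} (hk : k ≠ 0) :
    ∑ i, (adjMatrix_isHermitian (parentGraph p)).eigenvalues i ^ k =
      ∑ v, coeff k (negLogDeriv (1 - X ^ 2 * ∑ u ∈ treeChildren p v, W u)) := by
  rw [SimpleGraph.sum_eigenvalues_pow _ hk, hp.det_eq_prod hW,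
    negLogDeriv_prod _ _ fun i => by simp, map_sum]

end Spectrum

/-! ### Comparison of the contributions of two adjacent roots -/

section TwoRoots

open Finset PowerSeries

namespace PowerSeries

/-- All coefficients are nonnegative. -/
def CoeffNonneg (f : ℝ⟦X⟧) : Prop := ∀ i, 0 ≤ coeff i f

theorem CoeffNonneg.mul {f g : ℝ⟦X⟧} (hf : CoeffNonneg f) (hg : CoeffNonneg g) :
    CoeffNonneg (f * g) := fun i => by
  rw [coeff_mul]
  exact Finset.sum_nonneg fun x _ => mul_nonneg (hf _) (hg _)

theorem CoeffNonneg.X_pow_mul {f : ℝ⟦X⟧} (hf : CoeffNonneg f) (k : ℕ) :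
    CoeffNonneg (X ^ k * f) := fun i => by
  rw [coeff_X_pow_mul']
  split_ifs
  · exact hf _
  · exact le_rfl

theorem CoeffNonneg.of_mul_one_sub_eq_one {Y W : ℝ⟦X⟧} (hY : CoeffNonneg Y)
    (hY0 : constantCoeff Y = 0) (hW : W * (1 - Y) = 1) : CoeffNonneg W := by
  have hW' : W = 1 + Y * W := by linear_combination hW
  intro N
  induction N using Nat.strong_induction_on with
  | _ N ih =>
    rw [hW', map_add, coeff_mul, PowerSeries.coeff_one]
    refine add_nonneg (by split_ifs <;> norm_num) (Finset.sum_nonneg fun x hx => ?_)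
    have hx' := mem_antidiagonal.1 hx
    rcases Nat.eq_zero_or_pos x.1 with h | h
    · rw [h, coeff_zero_eq_constantCoeff_apply, hY0, zero_mul]
    · exact mul_nonneg (hY _) (ih _ (by omega))

theorem inv_mul_one_sub {Y : ℝ⟦X⟧} (hY0 : constantCoeff Y = 0) : (1 - Y)⁻¹ * (1 - Y) = 1 :=
  PowerSeries.inv_mul_cancel _ (by rw [map_sub, hY0, map_one, sub_zero]; exact one_ne_zero)

theorem CoeffNonneg.inv_one_sub {Y : ℝ⟦X⟧} (hY : CoeffNonneg Y) (hY0 : constantCoeff Y = 0) :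
    CoeffNonneg (1 - Y)⁻¹ :=
  of_mul_one_sub_eq_one hY hY0 (inv_mul_one_sub hY0)

/-- Keep only the leading term of `X Y' / (1 - Y) = X Y' + X Y' Y / (1 - Y)`. -/
theorem CoeffNonneg.le_coeff_negLogDeriv {Y : ℝ⟦X⟧} (hY : CoeffNonneg Y)
    (hY0 : constantCoeff Y = 0) (N : ℕ) : N * coeff N Y ≤ coeff N (negLogDeriv (1 - Y)) := by
  have h := inv_mul_one_sub hY0
  have hW := hY.inv_one_sub hY0
  rw [negLogDeriv_one_sub h]
  have h2 : X * d⁄dX ℝ Y * (1 - Y)⁻¹ = X * d⁄dX ℝ Y + X * d⁄dX ℝ Y * (Y * (1 - Y)⁻¹) := by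
    linear_combination (X * d⁄dX ℝ Y) * h
  rw [h2, map_add, coeff_X_mul_derivative, le_add_iff_nonneg_right]
  have h3 : CoeffNonneg (X * d⁄dX ℝ Y) := fun i => by
    rw [coeff_X_mul_derivative]
    exact mul_nonneg (Nat.cast_nonneg _) (hY i)
  exact h3.mul (hY.mul hW) N

theorem CoeffNonneg.coeff_negLogDeriv_nonneg {Y : ℝ⟦X⟧} (hY : CoeffNonneg Y)
    (hY0 : constantCoeff Y = 0) (N : ℕ) : 0 ≤ coeff N (negLogDeriv (1 - Y)) :=
  (mul_nonneg (Nat.cast_nonneg _) (hY N)).trans (hY.le_coeff_negLogDeriv hY0 N)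

/-- The contribution to the determinant of two adjacent roots whose branches are given by `S`
and `T`. -/
noncomputable def edgeDet (S T : ℝ⟦X⟧) : ℝ⟦X⟧ := (1 - X ^ 2 * S) * (1 - X ^ 2 * T) - X ^ 2

theorem constantCoeff_edgeDet (S T : ℝ⟦X⟧) : constantCoeff (edgeDet S T) = 1 := by
  simp [edgeDet]

theorem edgeDet_comm (S T : ℝ⟦X⟧) : edgeDet S T = edgeDet T S := by
  rw [edgeDet, edgeDet, mul_comm (1 - X ^ 2 * S)]

theorem exists_inv_edgeDet {S T : ℝ⟦X⟧} (hS : CoeffNonneg S) (hT : CoeffNonneg T) :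
    ∃ I, edgeDet S T * I = 1 ∧ CoeffNonneg I ∧ CoeffNonneg ((1 - X ^ 2 * T) * I) := by
  have hS0 : constantCoeff (X ^ 2 * S) = 0 := by simp
  have hT0 : constantCoeff (X ^ 2 * T) = 0 := by simp
  have hS' := (hS.X_pow_mul 2).inv_one_sub hS0
  have hT' := (hT.X_pow_mul 2).inv_one_sub hT0
  have hS1 := inv_mul_one_sub hS0
  have hT1 := inv_mul_one_sub hT0
  set a := (1 - X ^ 2 * S)⁻¹
  set b := (1 - X ^ 2 * T)⁻¹
  have hab0 : constantCoeff (X ^ 2 * (a * b)) = 0 := by simp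
  have hab := ((hS'.mul hT').X_pow_mul 2).inv_one_sub hab0
  have hab1 := inv_mul_one_sub hab0
  set c := (1 - X ^ 2 * (a * b))⁻¹
  -- The determinant factors as `(1 - X ^ 2 * S) * (1 - X ^ 2 * T) * (1 - X ^ 2 * (a * b))`, and
  -- each factor has a nonnegative inverse.
  refine ⟨a * b * c, ?_, (hS'.mul hT').mul hab, ?_⟩
  · rw [edgeDet]
    linear_combination hab1 + (b * c * (1 - X ^ 2 * T)) * hS1 + c * hT1
  · have : (1 - X ^ 2 * T) * (a * b * c) = a * c := by linear_combination (a * c) * hT1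
    rw [this]
    exact hS'.mul hab

/-- Enlarging `S` multiplies the determinant by some `1 - Z` with `Z` nonnegative, and such a factor
contributes nonnegatively. -/
theorem negLogDeriv_edgeDet_mono_left {S S' T : ℝ⟦X⟧} (hS : CoeffNonneg S) (hT : CoeffNonneg T)
    (h : CoeffLE S S') (N : ℕ) :
    coeff N (negLogDeriv (edgeDet S T)) ≤ coeff N (negLogDeriv (edgeDet S' T)) := by
  obtain ⟨I, hI, -, hTI⟩ := exists_inv_edgeDet hS hT
  have hd : CoeffNonneg (S' - S) := fun i => by rw [map_sub]; exact sub_nonneg.2 (h i)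
  have hZ := (hd.mul hTI).X_pow_mul 2
  have hZ0 : constantCoeff (X ^ 2 * ((S' - S) * ((1 - X ^ 2 * T) * I))) = 0 := by simp
  have hD : edgeDet S' T =
      edgeDet S T * (1 - X ^ 2 * ((S' - S) * ((1 - X ^ 2 * T) * I))) := by
    have e : edgeDet S' T = edgeDet S T - X ^ 2 * ((S' - S) * (1 - X ^ 2 * T)) := by
      rw [edgeDet, edgeDet]; ring
    rw [e]
    linear_combination (X ^ 2 * ((S' - S) * (1 - X ^ 2 * T))) * hI
  rw [hD, negLogDeriv_mul (by rw [constantCoeff_edgeDet]; exact one_ne_zero)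
    (by rw [map_sub, hZ0]; simp), map_add, le_add_iff_nonneg_right]
  exact hZ.coeff_negLogDeriv_nonneg hZ0 N

theorem negLogDeriv_edgeDet_mono {S S' T T' : ℝ⟦X⟧} (hS : CoeffNonneg S) (hT : CoeffNonneg T)
    (hSS : CoeffLE S S') (hTT : CoeffLE T T') (N : ℕ) :
    coeff N (negLogDeriv (edgeDet S T)) ≤ coeff N (negLogDeriv (edgeDet S' T')) := by
  refine (negLogDeriv_edgeDet_mono_left hS hT hSS N).trans ?_
  rw [edgeDet_comm S', edgeDet_comm S']
  exact negLogDeriv_edgeDet_mono_left hT (fun i => (hS i).trans (hSS i)) hTT N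

/-- With the sum fixed, the determinant changes only by `-X ^ 4 * (S * T - G * H)`. The quantitative
gain is kept for the case of equality. -/
theorem negLogDeriv_edgeDet_spread {S T G H : ℝ⟦X⟧} (hS : CoeffNonneg S) (hT : CoeffNonneg T)
    (hsum : G + H = S + T) (hE : CoeffNonneg (S * T - G * H)) (N : ℕ) :
    N * coeff N (X ^ 4 * (S * T - G * H)) + coeff N (negLogDeriv (edgeDet S T)) ≤
      coeff N (negLogDeriv (edgeDet G H)) := by
  obtain ⟨I, hI, hI0, -⟩ := exists_inv_edgeDet hS hT
  set E := S * T - G * H with hEdef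
  have hZ := (hE.mul hI0).X_pow_mul 4
  have hZ0 : constantCoeff (X ^ 4 * (E * I)) = 0 := by simp
  have hD : edgeDet G H = edgeDet S T * (1 - X ^ 4 * (E * I)) := by
    have e : edgeDet G H = edgeDet S T - X ^ 4 * E := by
      rw [edgeDet, edgeDet, hEdef]; linear_combination (-X ^ 2) * hsum
    rw [e]
    linear_combination (X ^ 4 * E) * hI
  rw [hD, negLogDeriv_mul (by rw [constantCoeff_edgeDet]; exact one_ne_zero)
    (by rw [map_sub, hZ0]; simp), map_add, add_comm]
  refine add_le_add le_rfl (le_trans ?_ (hZ.le_coeff_negLogDeriv hZ0 N))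
  refine mul_le_mul_of_nonneg_left ?_ (Nat.cast_nonneg _)
  have hI1 : coeff 0 I = 1 := by
    have := congrArg constantCoeff hI
    rw [map_mul, constantCoeff_edgeDet, one_mul, map_one] at this
    simpa using this
  rw [coeff_X_pow_mul', coeff_X_pow_mul']
  split_ifs
  · rw [coeff_mul]
    have := Finset.single_le_sum (f := fun x : ℕ × ℕ => coeff x.1 E * coeff x.2 I)
      (fun x _ => mul_nonneg (hE _) (hI0 _)) (a := (N - 4, 0))
      (mem_antidiagonal.2 (add_zero (N - 4)))
    simpa only [hI1, mul_one] using this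
  · exact le_rfl

section Compare

/-- The largest possible difference of the coefficients of two power series with sum `S + T`
and coefficients at most those of `A`. -/
noncomputable def spread (S T A : ℝ⟦X⟧) (i : ℕ) : ℝ :=
  2 * min (coeff i A) (coeff i (S + T)) - coeff i (S + T)

/-- The gain in the product of two coefficients of the difference. -/
noncomputable def spreadCoeff (S T A : ℝ⟦X⟧) (i j : ℕ) : ℝ :=
  (spread S T A i * spread S T A j - coeff i (S - T) * coeff j (S - T)) / 4

variable {S T A B : ℝ⟦X⟧} (hS : CoeffNonneg S) (hT : CoeffNonneg T)
  (hSA : CoeffLE S A) (hTA : CoeffLE T A)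

include hS hT hSA hTA

theorem abs_le_spread (i : ℕ) : |coeff i (S - T)| ≤ spread S T A i := by
  have h1 := hS i
  have h2 := hT i
  have h3 := hSA i
  have h4 := hTA i
  rw [spread, map_add, map_sub]
  rcases min_cases (coeff i A) (coeff i S + coeff i T) with ⟨h, _⟩ | ⟨h, _⟩ <;>
    rw [h, abs_le] <;> constructor <;> linarith

theorem spreadCoeff_nonneg (i j : ℕ) : 0 ≤ spreadCoeff S T A i j := by
  refine div_nonneg (sub_nonneg.2 ?_) (by norm_num)
  have hd := abs_le_spread hS hT hSA hTA
  calc coeff i (S - T) * coeff j (S - T) ≤ |coeff i (S - T)| * |coeff j (S - T)| := by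
        rw [← abs_mul]; exact le_abs_self _
    _ ≤ _ := mul_le_mul (hd _) (hd _) (abs_nonneg _) ((abs_nonneg _).trans (hd _))

variable (hsum : CoeffLE (S + T) (A + B)) (hB : CoeffNonneg B)

include hsum hB

theorem negLogDeriv_edgeDet_aux (N : ℕ) :
    N * coeff N (X ^ 4 * (PowerSeries.mk fun k => ∑ x ∈ antidiagonal k,
      spreadCoeff S T A x.1 x.2)) + coeff N (negLogDeriv (edgeDet S T)) ≤
      coeff N (negLogDeriv (edgeDet A B)) := by
  -- Move as much of `S + T` as `A` permits to one root. The remainder `S + T - G` is then at most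
  -- `B`, so the comparison splits into a spreading step and a monotone step.
  let G : ℝ⟦X⟧ := PowerSeries.mk fun i => min (coeff i A) (coeff i (S + T))
  have hG : ∀ i, coeff i G = min (coeff i A) (coeff i (S + T)) := fun i => coeff_mk _ _
  have hE : S * T - G * (S + T - G) = PowerSeries.mk fun k => ∑ x ∈ antidiagonal k,
      spreadCoeff S T A x.1 x.2 := by
    -- A product with given sum is a quarter of the square of the sum minus the square of the
    -- difference.
    have e : S * T - G * (S + T - G) =
        C (1 / 4 : ℝ) * ((2 * G - (S + T)) * (2 * G - (S + T)) - (S - T) * (S - T)) := by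
      have : (C (1 / 4 : ℝ) : ℝ⟦X⟧) * 4 = 1 := by
        rw [← map_ofNat (C : ℝ →+* ℝ⟦X⟧) 4, ← map_mul]; norm_num
      linear_combination (-(S * T - G * (S + T - G))) * this
    have h2 : ∀ i, coeff i (2 * G) = 2 * coeff i G := fun i => by
      rw [two_mul, map_add, two_mul]
    rw [e]
    ext k
    rw [coeff_C_mul, map_sub, coeff_mul, coeff_mul, coeff_mk, ← Finset.sum_sub_distrib,
      Finset.mul_sum]
    refine Finset.sum_congr rfl fun x _ => ?_
    rw [spreadCoeff, spread, spread, map_sub (coeff x.1) (2 * G), map_sub (coeff x.2) (2 * G), h2, h2, hG, hG]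
    ring
  have hE0 : CoeffNonneg (S * T - G * (S + T - G)) := fun k => by
    rw [hE, coeff_mk]
    exact Finset.sum_nonneg fun x _ => spreadCoeff_nonneg hS hT hSA hTA _ _
  rw [← hE]
  refine (negLogDeriv_edgeDet_spread hS hT (by ring) hE0 N).trans
    (negLogDeriv_edgeDet_mono (fun i => ?_) (fun i => ?_) (fun i => ?_) (fun i => ?_) N)
  · rw [hG, map_add]
    exact le_min ((hS i).trans (hSA i)) (add_nonneg (hS i) (hT i))
  · rw [map_sub, hG, sub_nonneg]
    exact min_le_right _ _
  · rw [hG]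
    exact min_le_left _ _
  · rw [map_sub, hG]
    have h1 := hsum i
    have h2 := hB i
    rw [map_add (coeff i) A] at h1
    rcases min_cases (coeff i A) (coeff i (S + T)) with ⟨h, _⟩ | ⟨h, _⟩ <;> rw [h] <;> linarith

theorem negLogDeriv_edgeDet_le (N : ℕ) :
    coeff N (negLogDeriv (edgeDet S T)) ≤ coeff N (negLogDeriv (edgeDet A B)) := by
  refine le_trans ?_ (negLogDeriv_edgeDet_aux hS hT hSA hTA hsum hB N)
  rw [le_add_iff_nonneg_left]
  refine mul_nonneg (Nat.cast_nonneg _) (CoeffNonneg.X_pow_mul (fun k => ?_) 4 N)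
  rw [coeff_mk]
  exact Finset.sum_nonneg fun x _ => spreadCoeff_nonneg hS hT hSA hTA _ _

/-- The moment of index `i + j + 4` gains a positive multiple of a sum of nonnegative terms, one of
which is the term `(i, j)`. -/
theorem spreadCoeff_eq_zero_of_eq
    (h : ∀ N, Even N →
      coeff N (negLogDeriv (edgeDet S T)) = coeff N (negLogDeriv (edgeDet A B)))
    {i j : ℕ} (hij : Even (i + j)) : spreadCoeff S T A i j = 0 := by
  have h1 := negLogDeriv_edgeDet_aux hS hT hSA hTA hsum hB (i + j + 4)
  rw [h _ (hij.add (by decide)), coeff_X_pow_mul, coeff_mk, add_le_iff_nonpos_left] at h1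
  have h0 : ∀ x ∈ antidiagonal (i + j), 0 ≤ spreadCoeff S T A x.1 x.2 :=
    fun x _ => spreadCoeff_nonneg hS hT hSA hTA _ _
  have h2 : ∑ x ∈ antidiagonal (i + j), spreadCoeff S T A x.1 x.2 = 0 := by
    refine le_antisymm ?_ (Finset.sum_nonneg h0)
    refine le_of_mul_le_mul_left ?_ (Nat.cast_pos.2 (Nat.succ_pos (i + j + 3)) : (0 : ℝ) < _)
    rw [mul_zero]
    exact h1
  exact (Finset.sum_eq_zero_iff_of_nonneg h0).1 h2 (i, j) (mem_antidiagonal.2 rfl)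

end Compare

end PowerSeries

end TwoRoots

/-! ### Rearranging a tree by levels, from a vertex or from an edge -/

section Rearrangement

open Finset PowerSeries

variable {n : ℕ}

/-- In a forest whose levels are numbered from left to right, the children can be rearranged in
the order of their parents. -/
theorem IsLevelForest.exists_isGreedyForest {lv : Fin n → ℕ} {p : Fin n → Fin n}
    (hp : IsLevelForest lv p) (hlv : Monotone lv)
    (hanti : ∀ u v, u ≤ v → lv u = lv v →
      (levelChildren lv p v).card ≤ (levelChildren lv p u).card) :
    ∃ q, IsGreedyForest lv q ∧
      ∀ v, (levelChildren lv p v).card = (levelChildren lv q v).card := by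
  -- The shift by 1 keeps the vertices of level 0 in front of all others when sorting by parents.
  let key : Fin n → ℕ := fun j => if lv j = 0 then 0 else (p j : ℕ) + 1
  let τ := Tuple.sort key
  have hτ : Monotone (key ∘ τ) := Tuple.monotone_sort key
  have hkey : ∀ a b, lv a ≠ 0 → key a ≤ key b → lv b ≠ 0 ∧ p a ≤ p b := by
    intro a b ha hab
    simp only [key, if_neg ha] at hab
    by_cases hb : lv b = 0
    · rw [if_pos hb] at hab; omega
    · rw [if_neg hb] at hab
      exact ⟨hb, Fin.le_def.2 (by omega)⟩
  have hmono : Monotone (lv ∘ τ) := by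
    intro i j hij
    have h := hτ hij
    simp only [Function.comp_apply] at h ⊢
    by_cases h0 : lv (τ i) = 0
    · omega
    obtain ⟨h1, h2⟩ := hkey _ _ h0 h
    rw [← hp _ h0, ← hp _ h1]
    exact Nat.succ_le_succ (hlv h2)
  -- Both `lv ∘ τ` and `lv` are monotone rearrangements of the same values, so they agree.
  have hlvτ : ∀ j, lv (τ j) = lv j := fun j =>
    congrFun (Tuple.unique_monotone (τ := Equiv.refl _) hmono (by simpa using hlv)) j
  have hcard : ∀ v, (levelChildren lv p v).card = (levelChildren lv (p ∘ τ) v).card := by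
    intro v
    symm
    refine Finset.card_equiv τ fun j => ?_
    rw [mem_levelChildren, mem_levelChildren, hlvτ]
    rfl
  refine ⟨p ∘ τ, ⟨fun j hj => ?_, fun i j hij hi _ => ?_, fun u v huv hl => ?_⟩, hcard⟩
  · have := hp (τ j) (by rwa [hlvτ])
    rwa [hlvτ] at this
  · exact (hkey _ _ (by rwa [hlvτ]) (hτ hij)).2
  · rw [← hcard, ← hcard]
    exact hanti u v huv hl

/-- The vertices can be ranked such that, in each level, the vertices of smaller rank have at
least as many children, and the children of different vertices are ranked like their parents. -/
def LevelOrdered (lv : Fin n → ℕ) (p : Fin n → Fin n) : Prop :=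
  ∃ ρ : Fin n → ℕ,
    (∀ a b, lv a ≠ 0 → lv a = lv b → p a ≠ p b → ρ (p a) ≤ ρ (p b) → ρ a ≤ ρ b) ∧
    ∀ u v, lv u = lv v → ρ u ≤ ρ v → (levelChildren lv p v).card ≤ (levelChildren lv p u).card

/-- A total preorder on each level becomes a numerical rank by counting the vertices of the level
that are strictly larger. -/
theorem LevelOrdered.of_coeffLE {lv : Fin n → ℕ} {p : Fin n → Fin n} (hp : IsLevelForest lv p)
    (S : Fin n → ℝ⟦X⟧)
    (htot : ∀ u v, lv u = lv v → CoeffLE (S v) (S u) ∨ CoeffLE (S u) (S v))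
    (hch : ∀ a b, lv a ≠ 0 → lv a = lv b → p a ≠ p b → CoeffLE (S (p b)) (S (p a)) →
      CoeffLE (S b) (S a))
    (hcard : ∀ u v, CoeffLE (S v) (S u) →
      (levelChildren lv p v).card ≤ (levelChildren lv p u).card) : LevelOrdered lv p := by
  classical
  let above : Fin n → Finset (Fin n) := fun v =>
    univ.filter fun u => lv u = lv v ∧ ¬ CoeffLE (S u) (S v)
  have hsub : ∀ u v, lv u = lv v → CoeffLE (S v) (S u) → above u ⊆ above v := by
    intro u v huv h x hx
    simp only [above, mem_filter, mem_univ, true_and] at hx ⊢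
    exact ⟨hx.1.trans huv, fun h' => hx.2 (h'.trans h)⟩
  have hiff : ∀ u v, lv u = lv v → ((above u).card ≤ (above v).card ↔ CoeffLE (S v) (S u)) := by
    intro u v huv
    refine ⟨fun h => ?_, fun h => Finset.card_le_card (hsub u v huv h)⟩
    by_contra hcon
    have h1 := (htot u v huv).resolve_left hcon
    have h2 : above v ⊂ above u := by
      refine (Finset.ssubset_iff_of_subset (hsub v u huv.symm h1)).2 ⟨v, ?_, ?_⟩
      · simp only [above, mem_filter, mem_univ, true_and]
        exact ⟨huv.symm, hcon⟩
      · simp only [above, mem_filter, mem_univ, true_and]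
        exact fun h' => h' (CoeffLE.refl _)
    exact absurd (Finset.card_lt_card h2) (not_lt.2 h)
  refine ⟨fun v => (above v).card, fun a b ha hab hpab h => ?_, fun u v huv h => ?_⟩
  · have h1 := hp a ha
    have h2 := hp b (hab ▸ ha)
    exact (hiff a b hab).2 (hch a b ha hab hpab ((hiff _ _ (by omega)).1 h))
  · exact hcard u v ((hiff u v huv).1 h)

instance (p : Fin n → Fin n) : DecidableRel (parentGraph p).Adj := fun i j =>
  inferInstanceAs (Decidable (i ≠ j ∧ (j ∈ treeChildren p i ∨ i ∈ treeChildren p j)))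

/-- The spectral moments of a graph. -/
noncomputable def spectralMoment {V : Type*} [Fintype V] [DecidableEq V] (G : SimpleGraph V)
    [DecidableRel G.Adj] (k : ℕ) : ℝ :=
  ∑ i, (adjMatrix_isHermitian G).eigenvalues i ^ k

/-- The contribution of a level to the spectral moments. -/
noncomputable def levelTerm (lv : Fin n → ℕ) (p : Fin n → Fin n) (w : Fin n → ℝ⟦X⟧) (N l : ℕ) :
    ℝ :=
  ∑ v ∈ levelSet lv l, coeff N (X * d⁄dX ℝ (X ^ 2 * childSum lv p w v) * w v)

theorem levelTerm_zero (lv : Fin n → ℕ) (p : Fin n → Fin n) (w : Fin n → ℝ⟦X⟧) (l : ℕ) :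
    levelTerm lv p w 0 l = 0 :=
  Finset.sum_eq_zero fun v _ => by rw [mul_assoc]; simp

theorem IsBranchSeries.sum_negLogDeriv_eq_levelTerm {lv : Fin n → ℕ} {p : Fin n → Fin n}
    {w : Fin n → ℝ⟦X⟧} (hw : IsBranchSeries lv p w) (N l : ℕ) :
    ∑ v ∈ levelSet lv l, coeff N (negLogDeriv (1 - X ^ 2 * childSum lv p w v)) =
      levelTerm lv p w N l :=
  Finset.sum_congr rfl fun v _ => by rw [negLogDeriv_one_sub (hw v)]

/-! ### Levels seen from a vertex -/

section VertexRoot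

variable {lv : Fin n → ℕ} {p q : Fin n → Fin n} {w ws : Fin n → ℝ⟦X⟧}

theorem levelChildren_eq_treeChildren (hlv : ∀ j : Fin n, lv j = 0 ↔ (j : ℕ) = 0)
    (p : Fin n → Fin n) (v : Fin n) : levelChildren lv p v = treeChildren p v := by
  ext u
  rw [mem_levelChildren, mem_treeChildren, Ne, Ne, hlv]

theorem IsLevelForest.isParentFun (hp : IsLevelForest lv p) (hmono : Monotone lv)
    (hlv : ∀ j : Fin n, lv j = 0 ↔ (j : ℕ) = 0) : IsParentFun p := by
  intro j hj
  have := hp j (by rwa [Ne, hlv])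
  by_contra hcon
  have := hmono (not_lt.1 hcon)
  omega

theorem IsLevelForest.spectralMoment_eq (hp : IsLevelForest lv p) (hmono : Monotone lv)
    (hlv : ∀ j : Fin n, lv j = 0 ↔ (j : ℕ) = 0) (hw : IsBranchSeries lv p w) {k : ℕ}
    (hk : k ≠ 0) :
    spectralMoment (parentGraph p) k = ∑ l ∈ univ.image lv, levelTerm lv p w k l := by
  have hch := levelChildren_eq_treeChildren hlv p
  have h := (hp.isParentFun hmono hlv).sum_eigenvalues_pow (W := w)
    (fun v => by rw [← hch]; exact hw v) hk
  rw [spectralMoment, h]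
  simp only [← hw.sum_negLogDeriv_eq_levelTerm, levelSet, childSum, hch]
  exact (Finset.sum_fiberwise_of_maps_to (fun v _ => Finset.mem_image_of_mem lv (mem_univ v))
    _).symm

theorem LevelOrdered.of_levelTerm_eq (hq : IsGreedyForest lv q) (hp : IsLevelForest lv p)
    (hc : ∀ v, (levelChildren lv p v).card = (levelChildren lv q v).card)
    (hws : IsBranchSeries lv q ws) (hw : IsBranchSeries lv p w)
    (h : ∀ l N, Even N → levelTerm lv p w N l = levelTerm lv q ws N l) :
    LevelOrdered lv p := by
  have h1 := fun l => hq.sum_childSum_mul_eq hp hc hws hw (l := l) (h l)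
  have htot := fun l u v => hq.childSum_total_of_sum_eq hp hc hws hw (h1 l) (u := u) (v := v)
  refine .of_coeffLE hp (childSum lv p w) (fun u v huv => htot (lv v) u v huv rfl)
    (fun a b ha hab hpab hle => ?_) (fun u v huv => ?_)
  · obtain ⟨l, hl⟩ := Nat.exists_eq_succ_of_ne_zero ha
    exact hq.children_le_of_sum_eq hp hc hws hw (l := l) (fun i => h1 l i i (Even.add_self i))
      (fun a b ha hb => htot (l + 1) a b ha hb) hl (hab ▸ hl) hpab hle
  · have := huv 0
    rw [hw.childSum_coeff_zero, hw.childSum_coeff_zero] at this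
    exact_mod_cast this

/-- Rearranging a tree level by level, seen from a vertex, does not decrease any spectral moment,
and if it changes no even moment, then the levels were ordered from the outset. -/
theorem IsLevelForest.exists_rearrangement (hp : IsLevelForest lv p) (hmono : Monotone lv)
    (hlv : ∀ j : Fin n, lv j = 0 ↔ (j : ℕ) = 0)
    (hanti : ∀ u v, u ≤ v → lv u = lv v →
      (levelChildren lv p v).card ≤ (levelChildren lv p u).card) :
    ∃ q, IsParentFun q ∧ (∀ v, (treeChildren p v).card = (treeChildren q v).card) ∧
      (∀ k, k ≠ 0 → spectralMoment (parentGraph p) k ≤ spectralMoment (parentGraph q) k) ∧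
      ((∀ k, k ≠ 0 → Even k →
        spectralMoment (parentGraph p) k = spectralMoment (parentGraph q) k) →
        LevelOrdered lv p) := by
  obtain ⟨q, hq, hc⟩ := hp.exists_isGreedyForest hmono hanti
  obtain ⟨w, hw⟩ := exists_isBranchSeries hp
  obtain ⟨ws, hws⟩ := exists_isBranchSeries hq.forest
  refine ⟨q, hq.forest.isParentFun hmono hlv, fun v => ?_, fun k hk => ?_, fun h => ?_⟩
  · rw [← levelChildren_eq_treeChildren hlv, ← levelChildren_eq_treeChildren hlv]
    exact hc v
  · rw [hp.spectralMoment_eq hmono hlv hw hk, hq.forest.spectralMoment_eq hmono hlv hws hk]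
    exact Finset.sum_le_sum fun l _ => hq.sum_level_le hp hc hws hw k l
  · refine LevelOrdered.of_levelTerm_eq hq hp hc hws hw fun l N hN => ?_
    rcases Nat.eq_zero_or_pos N with rfl | hN0
    · rw [levelTerm_zero, levelTerm_zero]
    have h1 := h N hN0.ne' hN
    rw [hp.spectralMoment_eq hmono hlv hw hN0.ne', hq.forest.spectralMoment_eq hmono hlv hws hN0.ne']
      at h1
    by_cases hl : l ∈ univ.image lv
    · exact (Finset.sum_eq_sum_iff_of_le
        fun l _ => hq.sum_level_le hp hc hws hw N l).1 h1 l hl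
    · have : levelSet lv l = ∅ := by
        refine Finset.eq_empty_of_forall_notMem fun v hv => hl ?_
        rw [← mem_levelSet.1 hv]
        exact Finset.mem_image_of_mem lv (mem_univ v)
      rw [levelTerm, levelTerm, this, Finset.sum_empty, Finset.sum_empty]

end VertexRoot

/-! ### Levels seen from an edge, whose ends `z` and `o` have level 0 -/

section EdgeRoot

variable {lv : Fin n → ℕ} {p q : Fin n → Fin n} {w ws : Fin n → ℝ⟦X⟧} {z o : Fin n}
  (hz : (z : ℕ) = 0) (ho : (o : ℕ) = 1)

include hz ho

omit hz in
theorem treeChildren_eq_levelChildren_of_ne (hlv : ∀ j : Fin n, lv j = 0 ↔ (j : ℕ) ≤ 1)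
    (hpo : p o = z) {v : Fin n} (hv : v ≠ z) : treeChildren p v = levelChildren lv p v := by
  ext u
  rw [mem_levelChildren, mem_treeChildren, Ne, Ne, hlv]
  constructor
  · rintro ⟨h1, h2⟩
    refine ⟨fun h => hv ?_, h2⟩
    rw [← h2, ← hpo]
    congr 1
    exact Fin.ext (by omega)
  · rintro ⟨h1, h2⟩
    exact ⟨by omega, h2⟩

omit hz in
theorem treeChildren_root (hlv : ∀ j : Fin n, lv j = 0 ↔ (j : ℕ) ≤ 1) (hpo : p o = z) :
    treeChildren p z = insert o (levelChildren lv p z) := by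
  ext u
  rw [Finset.mem_insert, mem_levelChildren, mem_treeChildren, Ne, Ne, hlv]
  constructor
  · rintro ⟨h1, h2⟩
    by_cases hu : u = o
    · exact Or.inl hu
    · refine Or.inr ⟨fun h => hu (Fin.ext (by omega)), h2⟩
  · rintro (rfl | ⟨h1, h2⟩)
    · exact ⟨by omega, hpo⟩
    · exact ⟨by omega, h2⟩

omit hz in
theorem not_mem_levelChildren_root (hlv : ∀ j : Fin n, lv j = 0 ↔ (j : ℕ) ≤ 1) (v : Fin n) :
    o ∉ levelChildren lv p v := by
  rw [mem_levelChildren, Ne, hlv]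
  omega

theorem levelSet_zero_eq (hlv : ∀ j : Fin n, lv j = 0 ↔ (j : ℕ) ≤ 1) : levelSet lv 0 = {z, o} := by
  ext v
  rw [mem_levelSet, hlv, Finset.mem_insert, Finset.mem_singleton, Fin.ext_iff, Fin.ext_iff]
  omega

theorem IsLevelForest.isParentFun_edge (hp : IsLevelForest lv p) (hmono : Monotone lv)
    (hlv : ∀ j : Fin n, lv j = 0 ↔ (j : ℕ) ≤ 1) (hpo : p o = z) : IsParentFun p := by
  intro j hj
  by_cases hj0 : lv j = 0
  · have : j = o := Fin.ext (by have := (hlv j).1 hj0; omega)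
    rw [this, hpo]
    exact Fin.lt_def.2 (by omega)
  have := hp j hj0
  by_contra hcon
  have := hmono (not_lt.1 hcon)
  omega

theorem IsLevelForest.spectralMoment_eq_edge (hp : IsLevelForest lv p) (hmono : Monotone lv)
    (hlv : ∀ j : Fin n, lv j = 0 ↔ (j : ℕ) ≤ 1) (hpo : p o = z) (hw : IsBranchSeries lv p w)
    {k : ℕ} (hk : k ≠ 0) :
    spectralMoment (parentGraph p) k =
      coeff k (negLogDeriv (edgeDet (childSum lv p w z) (childSum lv p w o))) +
      ∑ l ∈ (univ.image lv).erase 0, levelTerm lv p w k l := by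
  have hzo : z ≠ o := by rintro rfl; omega
  have hpf := hp.isParentFun_edge hz ho hmono hlv hpo
  -- In the tree the second root `o` is a child of `z`, whereas in the levelled forest both are
  -- roots. Only the series at `z` has to be corrected.
  set W : Fin n → ℝ⟦X⟧ :=
    Function.update w z (1 - X ^ 2 * (childSum lv p w z + w o))⁻¹ with hWdef
  have hWne : ∀ v, v ≠ z → W v = w v := fun v hv => Function.update_of_ne hv _ _
  have hsumW : ∀ v, ∑ u ∈ treeChildren p v, W u = ∑ u ∈ treeChildren p v, w u := by
    intro v
    refine Finset.sum_congr rfl fun u hu => hWne u ?_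
    rintro rfl
    exact (mem_treeChildren.1 hu).1 hz
  have hroot : ∑ u ∈ treeChildren p z, w u = childSum lv p w z + w o := by
    rw [treeChildren_root ho hlv hpo,
      Finset.sum_insert (not_mem_levelChildren_root ho hlv z), childSum, add_comm]
  have hother : ∀ v, v ≠ z → ∑ u ∈ treeChildren p v, w u = childSum lv p w v := fun v hv => by
    rw [treeChildren_eq_levelChildren_of_ne ho hlv hpo hv, childSum]
  have hW : ∀ v, W v * (1 - X ^ 2 * ∑ u ∈ treeChildren p v, W u) = 1 := by
    intro v
    rw [hsumW]
    by_cases hv : v = z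
    · rw [hv, hroot, hWdef, Function.update_self]
      exact inv_mul_one_sub (by simp)
    · rw [hother v hv, hWne v hv]
      exact hw v
  rw [spectralMoment, hpf.sum_eigenvalues_pow hW hk]
  simp only [hsumW]
  have hsplit : ∀ f : Fin n → ℝ, ∑ v, f v =
      (f z + f o) + ∑ l ∈ (univ.image lv).erase 0, ∑ v ∈ levelSet lv l, f v := by
    intro f
    rw [← Finset.sum_pair hzo, ← levelSet_zero_eq hz ho hlv,
      Finset.add_sum_erase (univ.image lv) (fun l => ∑ v ∈ levelSet lv l, f v)]
    · exact (Finset.sum_fiberwise_of_maps_to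
        (fun v _ => Finset.mem_image_of_mem lv (mem_univ v)) _).symm
    · exact Finset.mem_image.2 ⟨z, mem_univ z, (hlv z).2 (by omega)⟩
  rw [hsplit, hroot, hother o hzo.symm, ← map_add, ← negLogDeriv_mul (by simp) (by simp)]
  congr 1
  -- The equation `w o * (1 - X ^ 2 * childSum lv p w o) = 1` merges the two root factors into
  -- `edgeDet`.
  · congr 2
    rw [edgeDet]
    linear_combination (-X ^ 2) * hw o
  · refine Finset.sum_congr rfl fun l hl => ?_
    rw [← hw.sum_negLogDeriv_eq_levelTerm]
    refine Finset.sum_congr rfl fun v hv => ?_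
    rw [hother v]
    rintro rfl
    rw [mem_levelSet, (hlv v).2 (by omega)] at hv
    exact (Finset.mem_erase.1 hl).1 hv.symm

omit ho in
theorem isInitialIn_root (hlv : ∀ j : Fin n, lv j = 0 ↔ (j : ℕ) ≤ 1) :
    ({z} : Finset (Fin n)).IsInitialIn (levelSet lv 0) := by
  constructor
  · rw [Finset.singleton_subset_iff, mem_levelSet, hlv]; omega
  · intro a ha b _ hba
    rw [Finset.mem_singleton] at ha ⊢
    exact Fin.ext (by have := Fin.le_def.1 hba; rw [ha] at this; omega)

section

variable (hlv : ∀ j : Fin n, lv j = 0 ↔ (j : ℕ) ≤ 1)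
  (hq : IsGreedyForest lv q) (hp : IsLevelForest lv p)
  (hc : ∀ v, (levelChildren lv p v).card = (levelChildren lv q v).card)
  (hws : IsBranchSeries lv q ws) (hw : IsBranchSeries lv p w)

include hlv hq hp hc hws hw

omit ho in
theorem childSum_le_root {v : Fin n} (hv : lv v = 0) :
    CoeffLE (childSum lv p w v) (childSum lv q ws z) := fun i => by
  have := hq.weakMaj_childSum hp hc hws hw i 0 {v}
    (by rw [Finset.singleton_subset_iff, mem_levelSet, hv]) {z} (isInitialIn_root hz hlv)
    (by simp)
  simpa using this

theorem childSum_add_le_root :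
    CoeffLE (childSum lv p w z + childSum lv p w o)
      (childSum lv q ws z + childSum lv q ws o) := fun i => by
  have := (hq.weakMaj_childSum hp hc hws hw i 0).sum_le
  have hzo : z ≠ o := by rintro rfl; omega
  rw [levelSet_zero_eq hz ho hlv, Finset.sum_pair hzo, Finset.sum_pair hzo] at this
  simpa using this

theorem negLogDeriv_edgeDet_root_le (N : ℕ) :
    coeff N (negLogDeriv (edgeDet (childSum lv p w z) (childSum lv p w o))) ≤
      coeff N (negLogDeriv (edgeDet (childSum lv q ws z) (childSum lv q ws o))) :=
  negLogDeriv_edgeDet_le (fun i => hw.childSum_nonneg i z) (fun i => hw.childSum_nonneg i o)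
    (childSum_le_root hz hlv hq hp hc hws hw ((hlv z).2 (by omega)))
    (childSum_le_root hz hlv hq hp hc hws hw ((hlv o).2 (by omega)))
    (childSum_add_le_root hz ho hlv hq hp hc hws hw) (fun i => hws.childSum_nonneg i o) N

/-- Deeper levels are handled as for a vertex root. At level 0, equality says that the difference of
the two root child sums already attains `spread`, which replaces the sum-of-squares argument. -/
theorem LevelOrdered.of_edge_eq
    (hroot : ∀ N, Even N →
      coeff N (negLogDeriv (edgeDet (childSum lv p w z) (childSum lv p w o))) =
      coeff N (negLogDeriv (edgeDet (childSum lv q ws z) (childSum lv q ws o))))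
    (h : ∀ l, l ≠ 0 → ∀ N, Even N → levelTerm lv p w N l = levelTerm lv q ws N l) :
    LevelOrdered lv p := by
  have hz0 : lv z = 0 := (hlv z).2 (by omega)
  have ho0 : lv o = 0 := (hlv o).2 (by omega)
  have hS := fun i => hw.childSum_nonneg i z
  have hT := fun i => hw.childSum_nonneg i o
  have hSA := childSum_le_root hz hlv hq hp hc hws hw hz0
  have hTA := childSum_le_root hz hlv hq hp hc hws hw ho0
  have hspread : ∀ i j, Even (i + j) → spread (childSum lv p w z) (childSum lv p w o)
      (childSum lv q ws z) i * spread (childSum lv p w z) (childSum lv p w o)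
      (childSum lv q ws z) j = coeff i (childSum lv p w z - childSum lv p w o) *
        coeff j (childSum lv p w z - childSum lv p w o) := by
    intro i j hij
    have h := spreadCoeff_eq_zero_of_eq hS hT hSA hTA
      (childSum_add_le_root hz ho hlv hq hp hc hws hw) (fun i => hws.childSum_nonneg i o) hroot hij
    rw [spreadCoeff] at h
    linarith
  have habs := abs_le_spread hS hT hSA hTA
  have h1 := fun l hl => hq.sum_childSum_mul_eq hp hc hws hw (l := l) (h l hl)
  have hzo : CoeffLE (childSum lv p w z) (childSum lv p w o) ∨
      CoeffLE (childSum lv p w o) (childSum lv p w z) := by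
    -- Opposite signs in coefficients `i` and `j` would make the product of the differences
    -- negative, although it equals a product of nonnegative spreads.
    refine coeffLE_total_of fun i j hi hj => ?_
    have hi' : Even i := by
      rw [← Nat.not_odd_iff_even]
      intro hodd
      rw [hw.childSum_odd z hodd, hw.childSum_odd o hodd] at hi
      exact lt_irrefl _ hi
    have hj' : Even j := by
      rw [← Nat.not_odd_iff_even]
      intro hodd
      rw [hw.childSum_odd z hodd, hw.childSum_odd o hodd] at hj
      exact lt_irrefl _ hj
    have h2 := hspread i j (hi'.add hj')
    have h3 := mul_nonneg ((abs_nonneg _).trans (habs i)) ((abs_nonneg _).trans (habs j))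
    rw [h2, map_sub, map_sub] at h3
    have := mul_pos (sub_pos.2 hi) (sub_pos.2 hj)
    linarith
  have hcases : ∀ v, lv v = 0 → v = z ∨ v = o := fun v hv => by
    have := (hlv v).1 hv
    rcases Nat.eq_zero_or_pos (v : ℕ) with h | h
    · exact Or.inl (Fin.ext (by omega))
    · exact Or.inr (Fin.ext (by omega))
  have htot : ∀ u v, lv u = lv v → CoeffLE (childSum lv p w v) (childSum lv p w u) ∨
      CoeffLE (childSum lv p w u) (childSum lv p w v) := by
    intro u v huv
    by_cases hu : lv u = 0
    · rcases hcases u hu with rfl | rfl <;> rcases hcases v (huv ▸ hu) with rfl | rfl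
      · exact Or.inl (CoeffLE.refl _)
      · exact hzo.symm
      · exact hzo
      · exact Or.inl (CoeffLE.refl _)
    · exact hq.childSum_total_of_sum_eq hp hc hws hw (h1 (lv u) hu) rfl huv.symm
  refine .of_coeffLE hp (childSum lv p w) htot (fun a b ha hab hpab hle => ?_)
    (fun u v huv => ?_)
  · obtain ⟨l, hl⟩ := Nat.exists_eq_succ_of_ne_zero ha
    rcases Nat.eq_zero_or_pos l with rfl | hl0
    · refine hw.childSum_le_of_coeffLE (htot a b hab) ?_
      by_contra hcon
      have hwab : CoeffLE (w a) (w b) := hw.coeffLE_of_childSum_le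
        ((htot a b hab).resolve_left fun h' => hcon (hw.coeffLE_of_childSum_le h'))
      obtain ⟨i, hi⟩ := CoeffLE.exists_lt hcon
      have hpa : lv (p a) = 0 := by have := hp a ha; omega
      have hpb : lv (p b) = 0 := by have := hp b (hab ▸ ha); omega
      have hmaj := hq.weakMaj_sum_children (l := 0) (hp.comp_swap hab) (fun v => by
        rw [levelChildren_comp_swap hab, Finset.card_map, hc])
        (hq.weakMaj_coeff hp hc hws hw i 1)
      -- After exchanging the branches at `a` and `b`, the child sum at `p a` still respects the
      -- greedy bound and the one at `p b` is nonnegative. So a larger difference was possible,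
      -- contradicting that `spread` is attained.
      have h2 := hmaj {p a} (by rw [Finset.singleton_subset_iff, mem_levelSet, hpa]) {z}
        (isInitialIn_root hz hlv) (by simp)
      obtain ⟨e1, e2, -⟩ := sum_levelChildren_comp_swap (p := p) hab ha hpab
        (fun v => coeff i (w v))
      rw [Finset.sum_singleton, Finset.sum_singleton, e1] at h2
      have h3 : 0 ≤ ∑ x ∈ levelChildren lv (p ∘ Equiv.swap a b) (p b), coeff i (w x) :=
        Finset.sum_nonneg fun x _ => hw.coeff_nonneg i x
      rw [e2] at h3
      simp only [← IsBranchSeries.coeff_childSum] at h2 h3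
      have h4 := hspread i i (Even.add_self i)
      have h5 := hle i
      have h6 : coeff i (childSum lv p w (p a)) - coeff i (childSum lv p w (p b)) <
          spread (childSum lv p w z) (childSum lv p w o) (childSum lv q ws z) i := by
        have h7 : coeff i (childSum lv p w z + childSum lv p w o) =
            coeff i (childSum lv p w (p a)) + coeff i (childSum lv p w (p b)) := by
          rw [map_add]
          rcases hcases _ hpa with h | h <;> rcases hcases _ hpb with h' | h'
          · exact absurd (h.trans h'.symm) hpab
          · rw [h, h']
          · rw [h, h', add_comm]
          · exact absurd (h.trans h'.symm) hpab
        rw [spread, h7]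
        have h8 := le_min h2 (show coeff i (childSum lv p w (p a)) +
          (coeff i (w b) - coeff i (w a)) ≤ coeff i (childSum lv p w (p a)) +
          coeff i (childSum lv p w (p b)) by linarith)
        linarith
      have h9 : coeff i (childSum lv p w z - childSum lv p w o) *
          coeff i (childSum lv p w z - childSum lv p w o) =
          (coeff i (childSum lv p w (p a)) - coeff i (childSum lv p w (p b))) *
          (coeff i (childSum lv p w (p a)) - coeff i (childSum lv p w (p b))) := by
        rw [map_sub]
        rcases hcases _ hpa with h | h <;> rcases hcases _ hpb with h' | h'
        · exact absurd (h.trans h'.symm) hpab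
        · rw [h, h']
        · rw [h, h']; ring
        · exact absurd (h.trans h'.symm) hpab
      rw [h9] at h4
      have := mul_self_lt_mul_self (sub_nonneg.2 h5) h6
      linarith
    · exact hq.children_le_of_sum_eq hp hc hws hw (l := l)
        (fun i => h1 l hl0.ne' i i (Even.add_self i))
        (fun a b ha hb => htot a b (ha.trans hb.symm)) hl (hab ▸ hl) hpab hle
  · have := huv 0
    rw [hw.childSum_coeff_zero, hw.childSum_coeff_zero] at this
    exact_mod_cast this

end

/-- Rearranging a tree level by level, seen from an edge, does not decrease any spectral moment,
and if it changes no even moment, then the levels were ordered from the outset. -/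
theorem IsLevelForest.exists_rearrangement_edge (hp : IsLevelForest lv p) (hmono : Monotone lv)
    (hlv : ∀ j : Fin n, lv j = 0 ↔ (j : ℕ) ≤ 1) (hpo : p o = z)
    (hanti : ∀ u v, u ≤ v → lv u = lv v →
      (levelChildren lv p v).card ≤ (levelChildren lv p u).card) :
    ∃ q, IsParentFun q ∧ (∀ v, (treeChildren p v).card = (treeChildren q v).card) ∧
      (∀ k, k ≠ 0 → spectralMoment (parentGraph p) k ≤ spectralMoment (parentGraph q) k) ∧
      ((∀ k, k ≠ 0 → Even k →
        spectralMoment (parentGraph p) k = spectralMoment (parentGraph q) k) →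
        LevelOrdered lv p) := by
  obtain ⟨q₀, hq₀, hc₀⟩ := hp.exists_isGreedyForest hmono hanti
  have ho0 : lv o = 0 := (hlv o).2 (by omega)
  -- The greedy forest leaves parents at level 0 unspecified; the root edge requires `o` to be a
  -- child of `z`.
  let q := Function.update q₀ o z
  have hqo : q o = z := Function.update_self _ _ _
  have hqe : ∀ j, lv j ≠ 0 → q j = q₀ j := fun j hj =>
    Function.update_of_ne (by rintro rfl; exact hj ho0) _ _
  have hch : ∀ v, levelChildren lv q v = levelChildren lv q₀ v := by
    intro v
    ext j
    rw [mem_levelChildren, mem_levelChildren]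
    exact and_congr_right fun hj => by rw [hqe j hj]
  have hq : IsGreedyForest lv q := by
    refine ⟨fun j hj => ?_, fun i j hij hi hl => ?_, fun u v huv hl => ?_⟩
    · rw [hqe j hj]; exact hq₀.forest j hj
    · rw [hqe i hi, hqe j (hl ▸ hi)]; exact hq₀.mono i j hij hi hl
    · rw [hch, hch]; exact hq₀.anti u v huv hl
  have hc : ∀ v, (levelChildren lv p v).card = (levelChildren lv q v).card := fun v => by
    rw [hch, hc₀]
  obtain ⟨w, hw⟩ := exists_isBranchSeries hp
  obtain ⟨ws, hws⟩ := exists_isBranchSeries hq.forest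
  refine ⟨q, hq.forest.isParentFun_edge hz ho hmono hlv hqo, fun v => ?_, fun k hk => ?_,
    fun h => ?_⟩
  · by_cases hv : v = z
    · rw [hv, treeChildren_root ho hlv hpo, treeChildren_root ho hlv hqo,
        Finset.card_insert_of_notMem (not_mem_levelChildren_root ho hlv z),
        Finset.card_insert_of_notMem (not_mem_levelChildren_root ho hlv z), hc]
    · rw [treeChildren_eq_levelChildren_of_ne ho hlv hpo hv,
        treeChildren_eq_levelChildren_of_ne ho hlv hqo hv, hc]
  · rw [hp.spectralMoment_eq_edge hz ho hmono hlv hpo hw hk,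
      hq.forest.spectralMoment_eq_edge hz ho hmono hlv hqo hws hk]
    exact add_le_add (negLogDeriv_edgeDet_root_le hz ho hlv hq hp hc hws hw k)
      (Finset.sum_le_sum fun l _ => hq.sum_level_le hp hc hws hw k l)
  · have key : ∀ N, Even N →
        coeff N (negLogDeriv (edgeDet (childSum lv p w z) (childSum lv p w o))) =
        coeff N (negLogDeriv (edgeDet (childSum lv q ws z) (childSum lv q ws o))) ∧
        ∀ l ∈ (univ.image lv).erase 0, levelTerm lv p w N l = levelTerm lv q ws N l := by
      intro N hN
      rcases Nat.eq_zero_or_pos N with rfl | hN0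
      · refine ⟨?_, fun l _ => by rw [levelTerm_zero, levelTerm_zero]⟩
        rw [negLogDeriv, negLogDeriv, mul_assoc, mul_assoc]
        simp
      have h1 := h N hN0.ne' hN
      rw [hp.spectralMoment_eq_edge hz ho hmono hlv hpo hw hN0.ne',
        hq.forest.spectralMoment_eq_edge hz ho hmono hlv hqo hws hN0.ne'] at h1
      have h2 := negLogDeriv_edgeDet_root_le hz ho hlv hq hp hc hws hw N
      have h3 := Finset.sum_le_sum fun l (_ : l ∈ (univ.image lv).erase 0) =>
        hq.sum_level_le hp hc hws hw N l
      have h4 : ∑ l ∈ (univ.image lv).erase 0, levelTerm lv p w N l ≤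
        ∑ l ∈ (univ.image lv).erase 0, levelTerm lv q ws N l := h3
      refine ⟨by linarith, ?_⟩
      exact (Finset.sum_eq_sum_iff_of_le
        fun l _ => hq.sum_level_le hp hc hws hw N l).1
          (show ∑ l ∈ (univ.image lv).erase 0, levelTerm lv p w N l =
            ∑ l ∈ (univ.image lv).erase 0, levelTerm lv q ws N l by linarith)
    refine LevelOrdered.of_edge_eq hz ho hlv hq hp hc hws hw (fun N hN => (key N hN).1)
      fun l hl N hN => ?_
    by_cases hl' : l ∈ univ.image lv
    · exact (key N hN).2 l (Finset.mem_erase.2 ⟨hl, hl'⟩)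
    · have : levelSet lv l = ∅ := by
        refine Finset.eq_empty_of_forall_notMem fun v hv => hl' ?_
        rw [← mem_levelSet.1 hv]
        exact Finset.mem_image_of_mem lv (mem_univ v)
      rw [levelTerm, levelTerm, this, Finset.sum_empty, Finset.sum_empty]

end EdgeRoot

end Rearrangement

/-! ### Power sums of eigenvalues and the spectral sum -/

section SpectralSum

open Finset Filter Topology

/-- After division by the `k`-th power of the largest base, all other terms tend to 0, so the
leading coefficient vanishes; then remove that base. -/
theorem eq_zero_of_frequently_sum_mul_pow_eq_zero {s : Finset ℝ} (hs : ∀ t ∈ s, 0 < t)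
    {c : ℝ → ℝ} (h : ∃ᶠ k in atTop, ∑ t ∈ s, c t * t ^ k = 0) : ∀ t ∈ s, c t = 0 := by
  induction s using Finset.induction_on_max with
  | empty => intro t ht; exact absurd ht (Finset.notMem_empty t)
  | insert a s ha ih =>
    have ha' : a ∉ s := fun h => lt_irrefl _ (ha a h)
    have ha0 : 0 < a := hs a (Finset.mem_insert_self _ _)
    have hlim : Tendsto (fun k : ℕ => c a + ∑ t ∈ s, c t * (t / a) ^ k) atTop (𝓝 (c a)) := by
      have h1 : Tendsto (fun k : ℕ => ∑ t ∈ s, c t * (t / a) ^ k) atTop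
          (𝓝 (∑ t ∈ s, c t * 0)) := by
        refine tendsto_finsetSum _ fun t ht => Tendsto.const_mul _ ?_
        have ht0 := hs t (Finset.mem_insert_of_mem ht)
        exact tendsto_pow_atTop_nhds_zero_of_lt_one (div_nonneg ht0.le ha0.le)
          ((div_lt_one ha0).2 (ha t ht))
      simpa using h1.const_add (c a)
    have hca : c a = 0 := by
      refine tendsto_nhds_unique_of_frequently_eq hlim tendsto_const_nhds (h.mono fun k hk => ?_)
      rw [Finset.sum_insert ha'] at hk
      have hpow : a ^ k ≠ 0 := (pow_pos ha0 k).ne'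
      refine mul_right_cancel₀ hpow ?_
      rw [zero_mul, ← hk, add_mul, Finset.sum_mul]
      congr 1
      refine Finset.sum_congr rfl fun t _ => ?_
      rw [mul_assoc, div_pow, div_mul_cancel₀ _ hpow]
    intro t ht
    rcases Finset.mem_insert.1 ht with rfl | ht
    · exact hca
    · refine ih (fun t ht => hs t (Finset.mem_insert_of_mem ht)) (h.mono fun k hk => ?_) t ht
      rwa [Finset.sum_insert ha', hca, zero_mul, zero_add] at hk

theorem sum_card_mul_pow {ν : Type*} [Fintype ν] {s : Finset ℝ} (u : ν → ℝ)
    (hu : ∀ i, 0 < u i ^ 2 → u i ^ 2 ∈ s) (m : ℕ) (hm : m ≠ 0) :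
    ∑ t ∈ s, (∑ i, (if u i ^ 2 = t then 1 else 0)) * t ^ m = ∑ i, u i ^ (2 * m) := by
  simp only [Finset.sum_mul]
  rw [Finset.sum_comm]
  refine Finset.sum_congr rfl fun i _ => ?_
  simp only [ite_mul, one_mul, zero_mul, Finset.sum_ite_eq]
  rw [pow_mul]
  split_ifs with hi
  · rfl
  · have h0 : u i ^ 2 = 0 := by
      by_contra hne
      exact hi (hu i (lt_of_le_of_ne (sq_nonneg _) (Ne.symm hne)))
    rw [h0, zero_pow hm]

/-- If infinitely many even power sums of two finite families agree, then all of them do. -/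
theorem sum_pow_even_eq {ι κ : Type*} [Fintype ι] [Fintype κ] {x : ι → ℝ} {y : κ → ℝ}
    (h : {k : ℕ | Even k ∧ ∑ i, x i ^ k = ∑ i, y i ^ k}.Infinite) {k : ℕ} (hk : k ≠ 0)
    (hk2 : Even k) : ∑ i, x i ^ k = ∑ i, y i ^ k := by
  classical
  let s : Finset ℝ := ((univ.image fun i => x i ^ 2) ∪ (univ.image fun i => y i ^ 2)).filter
    fun t => 0 < t
  -- Difference of the multiplicities of `t` among the squares. The square 0 is left out, as it does
  -- not contribute to positive powers.
  let c : ℝ → ℝ := fun t => ∑ i, (if x i ^ 2 = t then 1 else 0) -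
    ∑ i, (if y i ^ 2 = t then 1 else 0)
  have hx : ∀ m, m ≠ 0 → ∑ t ∈ s, (∑ i, (if x i ^ 2 = t then 1 else 0)) * t ^ m =
      ∑ i, x i ^ (2 * m) := sum_card_mul_pow x fun i hi => mem_filter.2
    ⟨mem_union_left _ (mem_image_of_mem (fun i => x i ^ 2) (mem_univ i)), hi⟩
  have hy : ∀ m, m ≠ 0 → ∑ t ∈ s, (∑ i, (if y i ^ 2 = t then 1 else 0)) * t ^ m =
      ∑ i, y i ^ (2 * m) := sum_card_mul_pow y fun i hi => mem_filter.2
    ⟨mem_union_right _ (mem_image_of_mem (fun i => y i ^ 2) (mem_univ i)), hi⟩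
  have hc : ∀ m, m ≠ 0 → ∑ t ∈ s, c t * t ^ m =
      ∑ i, x i ^ (2 * m) - ∑ i, y i ^ (2 * m) := by
    intro m hm
    simp only [c, sub_mul, Finset.sum_sub_distrib]
    rw [hx m hm, hy m hm]
  have hzero : ∀ t ∈ s, c t = 0 := by
    refine eq_zero_of_frequently_sum_mul_pow_eq_zero (fun t ht => (mem_filter.1 ht).2) ?_
    rw [frequently_atTop]
    intro N
    obtain ⟨j, ⟨hj, hjeq⟩, hjN⟩ := h.exists_gt (2 * N + 1)
    obtain ⟨m, rfl⟩ := hj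
    refine ⟨m, by omega, ?_⟩
    rw [hc m (by omega), two_mul, hjeq, sub_self]
  obtain ⟨m, rfl⟩ := hk2
  have := hc m (by omega)
  rw [Finset.sum_eq_zero fun t ht => by rw [hzero t ht, zero_mul], two_mul] at this
  linarith

variable {V W : Type*} [Fintype V] [DecidableEq V] [Fintype W] [DecidableEq W]

theorem spectralSum_eq_roots (f : ℝ → ℝ) (G : SimpleGraph V) [DecidableRel G.Adj] :
    spectralSum f G = ((G.adjMatrix ℝ).charpoly.roots.map f).sum := by
  rw [(adjMatrix_isHermitian G).roots_charpoly_eq_eigenvalues, spectralSum, Multiset.map_map]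
  rfl

theorem SimpleGraph.Iso.spectralSum_eq {G : SimpleGraph V} {H : SimpleGraph W}
    [DecidableRel G.Adj] [DecidableRel H.Adj] (e : G ≃g H) (f : ℝ → ℝ) :
    spectralSum f G = spectralSum f H := by
  have h : G.adjMatrix ℝ = Matrix.reindex e.toEquiv.symm e.toEquiv.symm (H.adjMatrix ℝ) := by
    ext i j
    rw [Matrix.reindex_apply, Matrix.submatrix_apply, SimpleGraph.adjMatrix_apply,
      SimpleGraph.adjMatrix_apply]
    exact if_congr e.map_adj_iff.symm rfl rfl
  rw [spectralSum_eq_roots, spectralSum_eq_roots, h, Matrix.charpoly_reindex]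

theorem hasSum_spectralSum {f : ℝ → ℝ} {a : ℕ → ℝ}
    (hf : ∀ x : ℝ, HasSum (fun k => a k * x ^ k) (f x)) (G : SimpleGraph V)
    [DecidableRel G.Adj] : HasSum (fun k => a k * spectralMoment G k) (spectralSum f G) := by
  have := hasSum_sum fun i (_ : i ∈ (univ : Finset V)) =>
    hf ((adjMatrix_isHermitian G).eigenvalues i)
  simpa only [spectralMoment, Finset.mul_sum, spectralSum] using this

theorem spectralMoment_zero (G : SimpleGraph V) [DecidableRel G.Adj] :
    spectralMoment G 0 = Fintype.card V := by
  simp [spectralMoment]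

/-- If all spectral moments of `G` are at most those of `H`, but `G` has at least as large a
spectral sum, then the even spectral moments agree. -/
theorem spectralMoment_eq_of_spectralSum_le {f : ℝ → ℝ} {a : ℕ → ℝ} (ha : ∀ k, 0 ≤ a k)
    (hf : ∀ x : ℝ, HasSum (fun k => a k * x ^ k) (f x))
    (hinf : {k : ℕ | Even k ∧ 0 < a k}.Infinite) {G : SimpleGraph V} {H : SimpleGraph W}
    [DecidableRel G.Adj] [DecidableRel H.Adj] (hcard : Fintype.card V = Fintype.card W)
    (hle : ∀ k, k ≠ 0 → spectralMoment G k ≤ spectralMoment H k)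
    (hsum : spectralSum f H ≤ spectralSum f G) {k : ℕ} (hk : k ≠ 0) (hk2 : Even k) :
    spectralMoment G k = spectralMoment H k := by
  have hle' : ∀ k, spectralMoment G k ≤ spectralMoment H k := by
    intro k
    rcases Nat.eq_zero_or_pos k with rfl | h
    · rw [spectralMoment_zero, spectralMoment_zero, hcard]
    · exact hle k h.ne'
  have h1 := (hasSum_spectralSum hf H).sub (hasSum_spectralSum hf G)
  have h2 : ∀ k, 0 ≤ a k * spectralMoment H k - a k * spectralMoment G k := fun k =>
    sub_nonneg.2 (mul_le_mul_of_nonneg_left (hle' k) (ha k))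
  have h3 : spectralSum f H - spectralSum f G = 0 :=
    le_antisymm (sub_nonpos.2 hsum) (h1.nonneg h2)
  rw [h3] at h1
  have h4 := (hasSum_zero_iff_of_nonneg h2).1 h1
  refine sum_pow_even_eq (hinf.mono fun j hj => ⟨hj.1, ?_⟩) hk hk2
  have := congrFun h4 j
  simp only [Pi.zero_apply] at this
  exact mul_left_cancel₀ hj.2.ne' (sub_eq_zero.1 this).symm

end SpectralSum

/-! ### Graphs of parent functions are trees -/

section ParentGraph

open Finset

variable {n : ℕ} {p q : Fin n → Fin n}

theorem IsParentFun.degree_eq (hp : IsParentFun p) (v : Fin n) :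
    (parentGraph p).degree v = (treeChildren p v).card + if (v : ℕ) = 0 then 0 else 1 := by
  rw [← SimpleGraph.card_neighborFinset_eq_degree]
  split_ifs with hv
  · rw [add_zero]
    congr 1
    ext u
    rw [SimpleGraph.mem_neighborFinset, parentGraph_adj hp, mem_treeChildren (u := v)]
    simp [hv]
  · rw [← Finset.card_insert_of_notMem (a := p v) (s := treeChildren p v)]
    · congr 1
      ext u
      rw [SimpleGraph.mem_neighborFinset, parentGraph_adj hp, Finset.mem_insert,
        mem_treeChildren (u := v)]
      simp [hv, eq_comm]
    · exact fun h => lt_asymm (hp.lt h) (hp v hv)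

theorem IsParentFun.isTree (hp : IsParentFun p) (hn : 0 < n) : (parentGraph p).IsTree := by
  let z : Fin n := ⟨0, hn⟩
  have hreach : ∀ k (v : Fin n), (v : ℕ) ≤ k → (parentGraph p).Reachable v z := by
    intro k
    induction k with
    | zero => intro v hv; rw [show v = z from Fin.ext (by simpa using hv)]
    | succ k ih =>
      intro v hv
      by_cases h0 : (v : ℕ) = 0
      · rw [show v = z from Fin.ext h0]
      · have hlt := hp v h0
        have hadj : (parentGraph p).Adj v (p v) :=
          (parentGraph_adj hp).2 (Or.inl (mem_treeChildren.2 ⟨h0, rfl⟩))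
        exact hadj.reachable.trans (ih _ (by have := Fin.lt_def.1 hlt; omega))
  have hconn : (parentGraph p).Connected :=
    { preconnected := fun u v => (hreach u u le_rfl).trans (hreach v v le_rfl).symm
      nonempty := ⟨z⟩ }
  rw [SimpleGraph.isTree_iff_connected_and_card]
  refine ⟨hconn, ?_⟩
  rw [Nat.card_eq_fintype_card, Nat.card_eq_fintype_card, Fintype.card_fin,
    ← SimpleGraph.edgeFinset_card]
  have h1 := (parentGraph p).sum_degrees_eq_twice_card_edges
  simp only [hp.degree_eq, Finset.sum_add_distrib] at h1
  have h2 : ∑ v, (treeChildren p v).card = (univ.filter fun u : Fin n => (u : ℕ) ≠ 0).card := by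
    rw [Finset.card_eq_sum_card_fiberwise (f := p) (t := univ) fun _ _ => mem_coe.2 (mem_univ _)]
    refine Finset.sum_congr rfl fun v _ => ?_
    rw [treeChildren, Finset.filter_filter]
  have h3 : (univ.filter fun u : Fin n => (u : ℕ) ≠ 0) = univ.erase z := by
    ext u
    rw [Finset.mem_filter, Finset.mem_erase, Ne, Ne, Fin.ext_iff]
    simp [z]
  have h4 : ∑ v : Fin n, (if (v : ℕ) = 0 then 0 else 1) =
      (univ.filter fun u : Fin n => (u : ℕ) ≠ 0).card := by
    rw [Finset.card_filter]
    exact Finset.sum_congr rfl fun v _ => by split_ifs <;> simp_all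
  have h5 : (univ.erase z).card + 1 = n := by
    rw [Finset.card_erase_add_one (mem_univ z), Finset.card_univ, Fintype.card_fin]
  rw [h4, h2, h3] at h1
  omega

theorem IsParentFun.hasDegreeSequence_congr (hp : IsParentFun p) (hq : IsParentFun q)
    (h : ∀ v, (treeChildren p v).card = (treeChildren q v).card) {D : Fin n → ℕ}
    (hD : HasDegreeSequence (parentGraph p) D) : HasDegreeSequence (parentGraph q) D := by
  obtain ⟨hanti, σ, hσ⟩ := hD
  refine ⟨hanti, σ, fun i => ?_⟩
  rw [hq.degree_eq, ← h, ← hp.degree_eq, hσ]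

theorem HasDegreeSequence.of_iso {V W : Type*} [Fintype V] [Fintype W] {G : SimpleGraph V}
    {H : SimpleGraph W} [DecidableRel G.Adj] [DecidableRel H.Adj] {D : Fin n → ℕ}
    (hD : HasDegreeSequence G D) (e : G ≃g H) : HasDegreeSequence H D := by
  obtain ⟨hanti, σ, hσ⟩ := hD
  exact ⟨hanti, σ.trans e.toEquiv, fun i => (e.degree_eq (σ i)).trans (hσ i)⟩

end ParentGraph

/-! ### Levels of an abstract tree, and orderedness of a maximizer -/

section TreeLevels

open Finset

variable {V : Type*} {T : SimpleGraph V}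

theorem SimpleGraph.IsTree.dist_adj_cases (hT : T.IsTree) (r : V) {u v : V} (h : T.Adj u v) :
    T.dist r u + 1 = T.dist r v ∨ T.dist r v + 1 = T.dist r u := by
  rcases hT.dist_eq_dist_add_one_of_adj r h with h | h
  · exact Or.inr h.symm
  · exact Or.inl h.symm

theorem SimpleGraph.Connected.exists_adj_dist_succ (hT : T.Connected) {r v : V} (h : v ≠ r) :
    ∃ u, T.Adj v u ∧ T.dist r u + 1 = T.dist r v := by
  obtain ⟨w, hw⟩ := hT.exists_walk_length_eq_dist v r
  cases w with
  | nil => exact absurd rfl h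
  | @cons _ u _ hadj w =>
    refine ⟨u, hadj, ?_⟩
    rw [SimpleGraph.Walk.length_cons] at hw
    have h1 := SimpleGraph.dist_le w
    have h2 := hT.dist_triangle (u := v) (v := u) (w := r)
    rw [SimpleGraph.dist_eq_one_iff_adj.2 hadj] at h2
    rw [SimpleGraph.dist_comm (u := r) (v := u), SimpleGraph.dist_comm (u := r) (v := v)]
    omega

theorem SimpleGraph.IsTree.eq_of_adj_of_dist (hT : T.IsTree) {r v u u' : V} (hu : T.Adj v u)
    (hu' : T.Adj v u') (h : T.dist r u + 1 = T.dist r v) (h' : T.dist r u' + 1 = T.dist r v) :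
    u = u' := by
  obtain ⟨w, hw⟩ := hT.1.exists_walk_length_eq_dist r u
  obtain ⟨w', hw'⟩ := hT.1.exists_walk_length_eq_dist r u'
  have h1 : (w.concat hu.symm).IsPath := SimpleGraph.Walk.isPath_of_length_eq_dist _ (by
    rw [SimpleGraph.Walk.length_concat, hw, h])
  have h2 : (w'.concat hu'.symm).IsPath := SimpleGraph.Walk.isPath_of_length_eq_dist _ (by
    rw [SimpleGraph.Walk.length_concat, hw', h'])
  have h3 := (hT.existsUnique_path r v).unique h1 h2
  have h4 := congrArg SimpleGraph.Walk.penultimate h3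
  simpa using h4

/-- `L` and `par` describe the levels and the parents in `T`, seen from the set of vertices of
level `0`. -/
structure IsLevelling (T : SimpleGraph V) (L : V → ℕ) (par : V → V) : Prop where
  adj : ∀ v, L v ≠ 0 → T.Adj v (par v)
  level : ∀ v, L v ≠ 0 → L (par v) + 1 = L v
  cases : ∀ u v, T.Adj u v → (L u ≠ 0 ∧ par u = v) ∨ (L v ≠ 0 ∧ par v = u) ∨ (L u = 0 ∧ L v = 0)

theorem SimpleGraph.IsTree.exists_isLevelling_vertex (hT : T.IsTree) (r : V) :
    ∃ par, IsLevelling T (T.dist r) par := by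
  classical
  choose! par hpar using fun v (h : v ≠ r) => hT.1.exists_adj_dist_succ h
  have hne : ∀ v, T.dist r v ≠ 0 → v ≠ r := by
    rintro v h rfl
    exact h (SimpleGraph.dist_self)
  have huniq : ∀ u v, T.Adj u v → T.dist r v + 1 = T.dist r u → T.dist r u ≠ 0 ∧ par u = v := by
    intro u v huv h
    have h0 : T.dist r u ≠ 0 := by omega
    have h1 := hpar u (hne u h0)
    exact ⟨h0, hT.eq_of_adj_of_dist h1.1 huv h1.2 h⟩
  refine ⟨par, fun v hv => (hpar v (hne v hv)).1, fun v hv => (hpar v (hne v hv)).2,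
    fun u v huv => ?_⟩
  rcases hT.dist_adj_cases r huv with h | h
  · exact Or.inr (Or.inl (huniq v u huv.symm h))
  · exact Or.inl (huniq u v huv h)

/-- The level of a vertex, seen from an edge. -/
noncomputable def edgeLevel (T : SimpleGraph V) (a b x : V) : ℕ := min (T.dist a x) (T.dist b x)

theorem edgeLevel_comm (a b : V) : edgeLevel T a b = edgeLevel T b a :=
  funext fun _ => min_comm _ _

theorem SimpleGraph.IsTree.dist_edge_cases (hT : T.IsTree) {a b : V} (hab : T.Adj a b) (x : V) :
    (T.dist a x = edgeLevel T a b x ∧ T.dist b x = edgeLevel T a b x + 1) ∨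
      (T.dist b x = edgeLevel T a b x ∧ T.dist a x = edgeLevel T a b x + 1) := by
  have h := hT.dist_adj_cases x hab
  rw [SimpleGraph.dist_comm (u := x), SimpleGraph.dist_comm (u := x)] at h
  rw [edgeLevel]
  omega

theorem SimpleGraph.IsTree.edgeLevel_eq_zero (hT : T.IsTree) {a b x : V} :
    edgeLevel T a b x = 0 ↔ x = a ∨ x = b := by
  rw [edgeLevel, Nat.min_eq_zero_iff, hT.1.dist_eq_zero_iff, hT.1.dist_eq_zero_iff, eq_comm,
    eq_comm (a := b)]

/-- The parent is the neighbour towards the nearer end of the edge, so it stays on the same side of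
the edge. -/
theorem SimpleGraph.IsTree.exists_isLevelling_edge (hT : T.IsTree) {a b : V} (hab : T.Adj a b) :
    ∃ par, IsLevelling T (edgeLevel T a b) par ∧
      ∀ x, edgeLevel T a b x ≠ 0 →
        (T.dist a x < T.dist b x ↔ T.dist a (par x) < T.dist b (par x)) := by
  classical
  have hex : ∀ x, edgeLevel T a b x ≠ 0 → ∃ y, T.Adj x y ∧
      edgeLevel T a b y + 1 = edgeLevel T a b x ∧
      (T.dist a x < T.dist b x ↔ T.dist a y < T.dist b y) ∧
      ∀ y', T.Adj x y' → edgeLevel T a b y' + 1 = edgeLevel T a b x → y' = y := by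
    have main : ∀ a b, T.Adj a b → ∀ x, edgeLevel T a b x ≠ 0 →
        T.dist a x = edgeLevel T a b x → T.dist b x = edgeLevel T a b x + 1 →
        ∃ y, T.Adj x y ∧ edgeLevel T a b y + 1 = edgeLevel T a b x ∧
        T.dist a y < T.dist b y ∧
        ∀ y', T.Adj x y' → edgeLevel T a b y' + 1 = edgeLevel T a b x → y' = y := by
      intro a b hab x hx h1 h2
      have hxa : x ≠ a := by
        rintro rfl
        exact hx ((hT.edgeLevel_eq_zero).2 (Or.inl rfl))
      obtain ⟨y, hy, hya⟩ := hT.1.exists_adj_dist_succ hxa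
      have h3 := hT.dist_adj_cases b hy
      have h4 := hT.dist_edge_cases hab y
      refine ⟨y, hy, by omega, by omega, fun y' hy' hl => ?_⟩
      have h5 := hT.dist_adj_cases b hy'
      have h6 := hT.dist_edge_cases hab y'
      exact hT.eq_of_adj_of_dist hy' hy (by omega) hya
    intro x hx
    rcases hT.dist_edge_cases hab x with ⟨h1, h2⟩ | ⟨h1, h2⟩
    · obtain ⟨y, hy1, hy2, hy3, hy4⟩ := main a b hab x hx h1 h2
      exact ⟨y, hy1, hy2, by omega, hy4⟩
    · rw [edgeLevel_comm] at hx h1 h2 ⊢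
      obtain ⟨y, hy1, hy2, hy3, hy4⟩ := main b a hab.symm x hx h1 h2
      exact ⟨y, hy1, hy2, by omega, hy4⟩
  choose! par hadj hlev hside huniq using hex
  refine ⟨par, ⟨hadj, hlev, fun u v huv => ?_⟩, hside⟩
  have hu := hT.dist_edge_cases hab u
  have hv := hT.dist_edge_cases hab v
  have h1 := hT.dist_adj_cases a huv
  have h2 := hT.dist_adj_cases b huv
  have key : ∀ u v, T.Adj u v → edgeLevel T a b v + 1 = edgeLevel T a b u →
      edgeLevel T a b u ≠ 0 ∧ par u = v := fun u v huv h =>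
    ⟨by omega, (huniq u (by omega) v huv h).symm⟩
  by_cases h : edgeLevel T a b u = edgeLevel T a b v
  · -- the edge joins the two sides
    refine Or.inr (Or.inr ?_)
    by_contra hcon
    have hu0 : edgeLevel T a b u ≠ 0 := by omega
    have hv0 : edgeLevel T a b v ≠ 0 := by omega
    have e1 := hlev u hu0
    have e2 := hside u hu0
    have e3 := hadj u hu0
    have e4 := hT.dist_edge_cases hab (par u)
    -- Seen from the farther end, both `v` and the parent of `u` are the neighbour of `u` towards
    -- that end. They would coincide, although their levels differ.
    rcases hu with hu | hu
    · exact absurd (hT.eq_of_adj_of_dist (r := b) (v := u) huv e3 (by omega) (by omega))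
        (fun hvp => by rw [hvp] at h; omega)
    · exact absurd (hT.eq_of_adj_of_dist (r := a) (v := u) huv e3 (by omega) (by omega))
        (fun hvp => by rw [hvp] at h; omega)
  · have h3 : edgeLevel T a b u + 1 = edgeLevel T a b v ∨
        edgeLevel T a b v + 1 = edgeLevel T a b u := by omega
    rcases h3 with h3 | h3
    · exact Or.inr (Or.inl (key v u huv.symm h3))
    · exact Or.inl (key u v huv h3)

/-- The number of children of a vertex in a levelling. -/
def levelChildCount [Fintype V] [DecidableEq V] (L : V → ℕ) (par : V → V) (v : V) : ℕ :=
  (univ.filter fun u => L u ≠ 0 ∧ par u = v).card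

theorem exists_enumeration [Fintype V] {n : ℕ} (hn : Fintype.card V = n) {α : Type*}
    [LinearOrder α] (key : V → α) : ∃ e : Fin n ≃ V, Monotone fun i => key (e i) := by
  let e₀ : Fin n ≃ V := (Fintype.equivFinOfCardEq hn).symm
  exact ⟨(Tuple.sort (key ∘ e₀)).trans e₀, Tuple.monotone_sort (key ∘ e₀)⟩

/-- The vertices can be ranked in such a way that in each level vertices of smaller rank have
larger degree, and the children of different vertices are ranked like their parents. -/
def IsRanked (T : SimpleGraph V) [T.LocallyFinite] (L : V → ℕ) (par : V → V) : Prop :=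
  ∃ ρ : V → ℕ,
    (∀ a b, L a ≠ 0 → L a = L b → par a ≠ par b → ρ (par a) ≤ ρ (par b) → ρ a ≤ ρ b) ∧
    ∀ u v, L u = L v → ρ u ≤ ρ v → T.degree v ≤ T.degree u

theorem SimpleGraph.IsTree.dist_enumeration_eq_zero (hT : T.IsTree) {n : ℕ} (e : Fin n ≃ V)
    {r : V} (hmono : Monotone fun j => T.dist r (e j)) (j : Fin n) :
    T.dist r (e j) = 0 ↔ (j : ℕ) = 0 := by
  have hn0 : 0 < n := j.pos
  have hroot : e ⟨0, hn0⟩ = r := by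
    have h1 := hmono (show (⟨0, hn0⟩ : Fin n) ≤ e.symm r from Fin.le_def.2 (Nat.zero_le _))
    simp only [Equiv.apply_symm_apply, SimpleGraph.dist_self] at h1
    exact ((hT.1.dist_eq_zero_iff).1 (Nat.le_zero.1 h1)).symm
  rw [hT.1.dist_eq_zero_iff]
  constructor
  · intro h
    rw [← hroot] at h
    rw [← e.injective h]
  · intro h
    rw [show j = ⟨0, hn0⟩ from Fin.ext h, hroot]

/-- Numbering the vertices of a tree level by level turns it into the graph of a parent
function. -/
theorem IsLevelling.parentGraph_enumeration {par : V → V} {r : V}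
    (hL : IsLevelling T (T.dist r) par) (hT : T.IsTree) {n : ℕ} (e : Fin n ≃ V)
    (hmono : Monotone fun j => T.dist r (e j)) :
    IsParentFun (fun j => e.symm (par (e j))) ∧
      ∀ i j, (parentGraph fun j => e.symm (par (e j))).Adj i j ↔ T.Adj (e i) (e j) := by
  set p : Fin n → Fin n := fun j => e.symm (par (e j)) with hp
  have hpe : ∀ j, e (p j) = par (e j) := fun j => e.apply_symm_apply _
  have hlv := hT.dist_enumeration_eq_zero e hmono
  have hforest : IsLevelForest (fun j => T.dist r (e j)) p := by
    intro j hj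
    beta_reduce
    rw [hpe]
    exact hL.level _ hj
  have hpf := hforest.isParentFun hmono hlv
  refine ⟨hpf, fun i j => ?_⟩
  rw [parentGraph_adj hpf, mem_treeChildren, mem_treeChildren, Ne, Ne, ← hlv, ← hlv]
  constructor
  · rintro (⟨h1, h2⟩ | ⟨h1, h2⟩)
    · rw [← h2, hpe]; exact hL.adj _ h1
    · rw [← h2, hpe]; exact (hL.adj _ h1).symm
  · intro h
    rcases hL.cases _ _ h with h' | h' | h'
    · exact Or.inl ⟨h'.1, e.injective (by rw [hpe, h'.2])⟩
    · exact Or.inr ⟨h'.1, e.injective (by rw [hpe, h'.2])⟩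
    · rw [hT.1.dist_eq_zero_iff, hT.1.dist_eq_zero_iff] at h'
      exact absurd (h'.1.symm.trans h'.2) h.ne

variable [Fintype V] [DecidableEq V] [DecidableRel T.Adj] {L : V → ℕ} {par : V → V} {n : ℕ}

theorem levelChildren_card_eq (e : Fin n ≃ V) {p : Fin n → Fin n}
    (hp : ∀ j, L (e j) ≠ 0 → e (p j) = par (e j)) (v : Fin n) :
    (levelChildren (fun j => L (e j)) p v).card = levelChildCount L par (e v) := by
  refine Finset.card_equiv e fun j => ?_
  rw [mem_levelChildren, mem_filter]
  constructor
  · rintro ⟨h1, h2⟩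
    exact ⟨mem_univ _, h1, by rw [← hp j h1, h2]⟩
  · rintro ⟨-, h1, h2⟩
    exact ⟨h1, e.injective (by rw [hp j h1, h2])⟩

theorem LevelOrdered.isRanked (e : Fin n ≃ V) {p : Fin n → Fin n}
    (hp : ∀ j, L (e j) ≠ 0 → e (p j) = par (e j))
    (hdeg : ∀ u v, L u = L v → levelChildCount L par v ≤ levelChildCount L par u →
      T.degree v ≤ T.degree u)
    (h : LevelOrdered (fun j => L (e j)) p) : IsRanked T L par := by
  obtain ⟨ρ, h1, h2⟩ := h
  refine ⟨fun v => ρ (e.symm v), fun a b ha hab hpab hle => ?_, fun u v huv hle => ?_⟩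
  · have e1 : ∀ x, L x ≠ 0 → p (e.symm x) = e.symm (par x) := fun x hx => by
      rw [Equiv.eq_symm_apply, hp _ (by simpa using hx), Equiv.apply_symm_apply]
    refine h1 _ _ (by simpa using ha) (by simpa using hab) ?_ ?_
    · rw [e1 a ha, e1 b (hab ▸ ha)]
      exact fun h => hpab (e.symm.injective h)
    · rw [e1 a ha, e1 b (hab ▸ ha)]
      exact hle
  · refine hdeg u v huv ?_
    have := h2 (e.symm u) (e.symm v) (by simpa using huv) hle
    rwa [levelChildren_card_eq e hp, levelChildren_card_eq e hp, Equiv.apply_symm_apply,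
      Equiv.apply_symm_apply] at this

variable {D : Fin n → ℕ} {f : ℝ → ℝ} {c : ℕ → ℝ}

/-- The tree `T` has maximal spectral sum among the trees with the given degree sequence. -/
def IsSpectralMax (T : SimpleGraph V) [DecidableRel T.Adj] (D : Fin n → ℕ) (f : ℝ → ℝ) : Prop :=
  ∀ (p : Fin n → Fin n), IsParentFun p → HasDegreeSequence (parentGraph p) D →
    spectralSum f (parentGraph p) ≤ spectralSum f T

/-- Equal child counts give the competitor the same degree sequence, so its spectral sum cannot be
larger although its moments are at least as large. -/
theorem IsSpectralMax.moments_eq (hmax : IsSpectralMax T D f) (hTD : HasDegreeSequence T D)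
    (hc : ∀ k, 0 ≤ c k) (hf : ∀ x : ℝ, HasSum (fun k => c k * x ^ k) (f x))
    (hinf : {k : ℕ | Even k ∧ 0 < c k}.Infinite) {p q : Fin n → Fin n} (hp : IsParentFun p)
    (hq : IsParentFun q) (e : T ≃g parentGraph p)
    (hcard : ∀ v, (treeChildren p v).card = (treeChildren q v).card)
    (hle : ∀ k, k ≠ 0 → spectralMoment (parentGraph p) k ≤ spectralMoment (parentGraph q) k) :
    ∀ k, k ≠ 0 → Even k → spectralMoment (parentGraph p) k = spectralMoment (parentGraph q) k := by
  intro k hk hk2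
  refine spectralMoment_eq_of_spectralSum_le hc hf hinf rfl hle ?_ hk hk2
  rw [← e.spectralSum_eq f]
  exact hmax q hq (hp.hasDegreeSequence_congr hq hcard (hTD.of_iso e))

theorem exists_level_enumeration (hn : Fintype.card V = n) (L : V → ℕ) (par : V → V) :
    ∃ e : Fin n ≃ V, Monotone (fun j => L (e j)) ∧ ∀ u v, u ≤ v → L (e u) = L (e v) →
      levelChildCount L par (e v) ≤ levelChildCount L par (e u) := by
  obtain ⟨e, he⟩ := exists_enumeration hn
    -- Increasing level first, then decreasing number of children within the level.
    (fun v => toLex (L v, OrderDual.toDual (levelChildCount L par v)))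
  refine ⟨e, fun i j hij => ?_, fun u v huv hl => ?_⟩
  · rcases Prod.Lex.le_iff.1 (he hij) with h | h
    · exact h.le
    · exact h.1.le
  · rcases Prod.Lex.le_iff.1 (he huv) with h | h
    · exact absurd h (by simp [hl])
    · exact h.2

theorem IsSpectralMax.isRanked_vertex (hmax : IsSpectralMax T D f) (hT : T.IsTree)
    (hn : Fintype.card V = n) (hTD : HasDegreeSequence T D)
    (hc : ∀ k, 0 ≤ c k) (hf : ∀ x : ℝ, HasSum (fun k => c k * x ^ k) (f x))
    (hinf : {k : ℕ | Even k ∧ 0 < c k}.Infinite) {r : V}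
    (hL : IsLevelling T (T.dist r) par) : IsRanked T (T.dist r) par := by
  obtain ⟨e, hmono, hanti⟩ := exists_level_enumeration hn (T.dist r) par
  let p : Fin n → Fin n := fun j => e.symm (par (e j))
  have hpe : ∀ j, e (p j) = par (e j) := fun j => e.apply_symm_apply _
  have hlv := hT.dist_enumeration_eq_zero e hmono
  have hforest : IsLevelForest (fun j => T.dist r (e j)) p := by
    intro j hj
    beta_reduce
    rw [hpe]
    exact hL.level _ hj
  have hpf := hforest.isParentFun hmono hlv
  obtain ⟨q, hq, hcard, hle, heq⟩ := hforest.exists_rearrangement hmono hlv fun u v huv hl => by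
    rw [levelChildren_card_eq e fun j _ => hpe j, levelChildren_card_eq e fun j _ => hpe j]
    exact hanti u v huv hl
  have hiso : ∀ i j, (parentGraph p).Adj i j ↔ T.Adj (e i) (e j) :=
    (hL.parentGraph_enumeration hT e hmono).2
  let E : T ≃g parentGraph p :=
    { toEquiv := e.symm, map_rel_iff' := by intro a b; simp [hiso] }
  have hdeg : ∀ v, T.degree v = levelChildCount (T.dist r) par v + if v = r then 0 else 1 := by
    intro v
    rw [← E.degree_eq, hpf.degree_eq, ← levelChildren_eq_treeChildren hlv,
      levelChildren_card_eq e fun j _ => hpe j]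
    have h1 : e (E v) = v := e.apply_symm_apply v
    have h2 : ((E v : Fin n) : ℕ) = 0 ↔ v = r := by
      rw [← hlv, h1, hT.1.dist_eq_zero_iff, eq_comm]
    simp only [h1, h2]
  refine LevelOrdered.isRanked e (fun j _ => hpe j) (fun u v huv hle => ?_)
    (heq (hmax.moments_eq hTD hc hf hinf hpf hq E hcard hle))
  rw [hdeg, hdeg]
  have : u = r ↔ v = r := by
    rw [eq_comm, ← hT.1.dist_eq_zero_iff, huv, hT.1.dist_eq_zero_iff, eq_comm]
  simp only [this]
  omega

theorem IsSpectralMax.isRanked_edge (hmax : IsSpectralMax T D f) (hT : T.IsTree)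
    (hn : Fintype.card V = n) (hTD : HasDegreeSequence T D)
    (hc : ∀ k, 0 ≤ c k) (hf : ∀ x : ℝ, HasSum (fun k => c k * x ^ k) (f x))
    (hinf : {k : ℕ | Even k ∧ 0 < c k}.Infinite) {a b : V} (hab : T.Adj a b)
    (hL : IsLevelling T (edgeLevel T a b) par) :
    IsRanked T (edgeLevel T a b) par ∧
      ∀ v, T.degree v = levelChildCount (edgeLevel T a b) par v + 1 := by
  obtain ⟨e, hmono, hanti⟩ := exists_level_enumeration hn (edgeLevel T a b) par
  have hn1 : 1 < n := hn ▸ Fintype.one_lt_card_iff.2 ⟨a, b, hab.ne⟩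
  let z : Fin n := ⟨0, by omega⟩
  let o : Fin n := ⟨1, hn1⟩
  have hz : (z : ℕ) = 0 := rfl
  have ho : (o : ℕ) = 1 := rfl
  have hlv0 : ∀ x, edgeLevel T a b x = 0 ↔ x = a ∨ x = b := fun x => hT.edgeLevel_eq_zero
  -- Exactly two vertices have level 0, and a numbering by levels puts them first.
  have hlv : ∀ j : Fin n, edgeLevel T a b (e j) = 0 ↔ (j : ℕ) ≤ 1 := by
    have hset : (univ.filter fun j : Fin n => edgeLevel T a b (e j) = 0).card = 2 := by
      rw [← Finset.card_pair hab.ne]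
      refine Finset.card_equiv e fun j => ?_
      simp [hlv0]
    intro j
    constructor
    · intro hj
      have hsub : Finset.Iic j ⊆ univ.filter fun j : Fin n => edgeLevel T a b (e j) = 0 :=
        fun i hi => mem_filter.2 ⟨mem_univ _,
          Nat.le_zero.1 ((hmono (Finset.mem_Iic.1 hi)).trans hj.le)⟩
      have := Finset.card_le_card hsub
      rw [hset, Fin.card_Iic] at this
      omega
    · intro hj
      by_contra hcon
      have hsub : (univ.filter fun j : Fin n => edgeLevel T a b (e j) = 0) ⊆ Finset.Iio j := by
        intro i hi
        rw [Finset.mem_Iio]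
        by_contra hij
        exact hcon (Nat.le_zero.1 ((hmono (not_lt.1 hij)).trans (mem_filter.1 hi).2.le))
      have := Finset.card_le_card hsub
      rw [hset, Fin.card_Iio] at this
      omega
  let p : Fin n → Fin n := fun j => if j = o then z else e.symm (par (e j))
  have hpo : p o = z := if_pos rfl
  have hpe : ∀ j, edgeLevel T a b (e j) ≠ 0 → e (p j) = par (e j) := fun j hj => by
    have : j ≠ o := by rintro rfl; exact hj ((hlv o).2 le_rfl)
    simp only [p, if_neg this, Equiv.apply_symm_apply]
  have hforest : IsLevelForest (fun j => edgeLevel T a b (e j)) p := by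
    intro j hj
    beta_reduce
    rw [hpe j hj]
    exact hL.level _ hj
  have hpf := hforest.isParentFun_edge hz ho hmono hlv hpo
  obtain ⟨q, hq, hcard, hle, heq⟩ :=
    hforest.exists_rearrangement_edge hz ho hmono hlv hpo fun u v huv hl => by
      rw [levelChildren_card_eq e hpe, levelChildren_card_eq e hpe]
      exact hanti u v huv hl
  have hroots : ∀ i j : Fin n, i ≠ j → edgeLevel T a b (e i) = 0 → edgeLevel T a b (e j) = 0 →
      T.Adj (e i) (e j) := by
    intro i j hij hi hj
    rw [hlv0] at hi hj
    rcases hi with hi | hi <;> rcases hj with hj | hj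
    · exact absurd (e.injective (hi.trans hj.symm)) hij
    · rw [hi, hj]; exact hab
    · rw [hi, hj]; exact hab.symm
    · exact absurd (e.injective (hi.trans hj.symm)) hij
  have hzo : z ≠ o := fun h => by rw [h] at hz; omega
  have hmem : ∀ i j, i ∈ treeChildren p j ↔
      (i = o ∧ j = z) ∨ (edgeLevel T a b (e i) ≠ 0 ∧ par (e i) = e j) := by
    intro i j
    rw [mem_treeChildren]
    by_cases hi : i = o
    · subst hi
      rw [hpo, Ne, Ne, hlv]
      simp [ho, eq_comm]
    · rw [Ne, Ne, hlv]
      constructor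
      · rintro ⟨h1, h2⟩
        have h3 : ¬ (i : ℕ) ≤ 1 := fun h => hi (Fin.ext (by omega))
        exact Or.inr ⟨h3, by rw [← h2, hpe i fun h => h3 ((hlv i).1 h)]⟩
      · rintro (h | ⟨h1, h2⟩)
        · exact absurd h.1 hi
        · exact ⟨by omega, e.injective (by rw [hpe i fun h => h1 ((hlv i).1 h), h2])⟩
  have hiso : ∀ i j, (parentGraph p).Adj i j ↔ T.Adj (e i) (e j) := by
    intro i j
    rw [parentGraph_adj hpf, hmem, hmem]
    constructor
    · rintro ((⟨rfl, rfl⟩ | ⟨h1, h2⟩) | (⟨rfl, rfl⟩ | ⟨h1, h2⟩))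
      · exact hroots _ _ hzo.symm ((hlv _).2 (by omega)) ((hlv _).2 (by omega))
      · rw [← h2]; exact hL.adj _ h1
      · exact hroots _ _ hzo ((hlv _).2 (by omega)) ((hlv _).2 (by omega))
      · rw [← h2]; exact (hL.adj _ h1).symm
    · intro h
      rcases hL.cases _ _ h with h' | h' | h'
      · exact Or.inl (Or.inr h')
      · exact Or.inr (Or.inr h')
      · rw [hlv, hlv] at h'
        have hij : (i : ℕ) ≠ j := fun hij => h.ne (congrArg e (Fin.ext hij))
        rcases Nat.eq_zero_or_pos (i : ℕ) with hi | hi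
        · exact Or.inr (Or.inl ⟨Fin.ext (by omega), Fin.ext (by omega)⟩)
        · exact Or.inl (Or.inl ⟨Fin.ext (by omega), Fin.ext (by omega)⟩)
  let E : T ≃g parentGraph p :=
    { toEquiv := e.symm, map_rel_iff' := by intro a b; simp [hiso] }
  have hdeg : ∀ v, T.degree v = levelChildCount (edgeLevel T a b) par v + 1 := by
    intro v
    rw [← E.degree_eq, hpf.degree_eq]
    have h1 : e (E v) = v := e.apply_symm_apply v
    by_cases hv : E v = z
    · rw [hv, treeChildren_root ho hlv hpo,
        Finset.card_insert_of_notMem (not_mem_levelChildren_root ho hlv z),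
        levelChildren_card_eq e hpe, ← hv, h1]
      simp [hv, hz]
    · rw [treeChildren_eq_levelChildren_of_ne ho hlv hpo hv, levelChildren_card_eq e hpe, h1,
        if_neg]
      exact fun h => hv (Fin.ext (by omega))
  refine ⟨LevelOrdered.isRanked e hpe (fun u v _ hle => ?_)
    (heq (hmax.moments_eq hTD hc hf hinf hpf hq E hcard hle)), hdeg⟩
  rw [hdeg, hdeg]
  omega

end TreeLevels

/-! ### Comparing the two sides of an edge; centroids -/

section EdgeSides

open Finset

variable {V : Type*} [Fintype V] [DecidableEq V] {T : SimpleGraph V} [DecidableRel T.Adj]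
  {L : V → ℕ} {par : V → V}

omit [DecidableRel T.Adj] in
theorem IsLevelling.card_level_succ (hL : IsLevelling T L par) (P : V → Prop) [DecidablePred P]
    (hP : ∀ x, L x ≠ 0 → (P x ↔ P (par x))) (t : ℕ) :
    (univ.filter fun x => P x ∧ L x = t + 1).card =
      ∑ x ∈ univ.filter (fun x => P x ∧ L x = t), levelChildCount L par x := by
  rw [Finset.card_eq_sum_card_fiberwise (f := par) (t := univ.filter fun x => P x ∧ L x = t)]
  · refine Finset.sum_congr rfl fun x hx => ?_
    rw [Finset.filter_filter, levelChildCount]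
    congr 1
    ext u
    simp only [mem_filter, mem_univ, true_and] at hx ⊢
    constructor
    · rintro ⟨⟨-, h2⟩, h3⟩
      exact ⟨by omega, h3⟩
    · rintro ⟨h1, h2⟩
      have h3 := hL.level u h1
      rw [h2] at h3
      exact ⟨⟨(hP u h1).2 (h2 ▸ hx.1), by omega⟩, h2⟩
  · intro u hu
    simp only [coe_filter, mem_univ, true_and, Set.mem_ofPred_eq] at hu ⊢
    have h1 : L u ≠ 0 := by omega
    have h3 := hL.level u h1
    exact ⟨(hP u h1).1 hu.1, by omega⟩

omit [Fintype V] [DecidableEq V] [DecidableRel T.Adj] in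
-- Vertices on different sides have different parents, again on different sides, so the order of the
-- two roots is inherited level by level.
theorem IsLevelling.rank_le_of_sides (hL : IsLevelling T L par) {ρ : V → ℕ}
    (hρ : ∀ a b, L a ≠ 0 → L a = L b → par a ≠ par b → ρ (par a) ≤ ρ (par b) → ρ a ≤ ρ b)
    (P : V → Prop) (hP : ∀ x, L x ≠ 0 → (P x ↔ P (par x)))
    (h0 : ∀ x y, P x → ¬ P y → L x = 0 → L y = 0 → ρ x ≤ ρ y) (t : ℕ) :
    ∀ x y, P x → ¬ P y → L x = t → L y = t → ρ x ≤ ρ y := by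
  induction t with
  | zero => exact h0
  | succ t ih =>
    intro x y hx hy hxt hyt
    have hx0 : L x ≠ 0 := by omega
    have hy0 : L y ≠ 0 := by omega
    have h1 := hL.level x hx0
    have h2 := hL.level y hy0
    have hx' := (hP x hx0).1 hx
    have hy' := fun h => hy ((hP y hy0).2 h)
    refine hρ x y hx0 (by omega) (fun h => hy' (h ▸ hx')) ?_
    exact ih _ _ hx' hy' (by omega) (by omega)

omit [DecidableEq V] in
theorem card_filter_eq_sum_level (P : V → Prop) [DecidablePred P] (L : V → ℕ) :
    (univ.filter P).card =
      ∑ t ∈ univ.image L, (univ.filter fun x => P x ∧ L x = t).card := by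
  rw [Finset.card_eq_sum_card_fiberwise (f := L) (t := univ.image L) fun x _ =>
    mem_coe.2 (mem_image_of_mem L (mem_univ x))]
  exact Finset.sum_congr rfl fun t _ => by rw [Finset.filter_filter]

omit [DecidableRel T.Adj] in
/-- If one side of an edge dominates the other one, but does not have more vertices, then the
vertices on both sides have the same numbers of children. -/
theorem IsLevelling.childCount_eq_of_sides (hL : IsLevelling T L par)
    (P : V → Prop) [DecidablePred P] (hP : ∀ x, L x ≠ 0 → (P x ↔ P (par x)))
    (hdom : ∀ x y, P x → ¬ P y → L x = L y → levelChildCount L par x ≤ levelChildCount L par y)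
    (h0 : (univ.filter fun x => P x ∧ L x = 0).card ≤ (univ.filter fun x => ¬ P x ∧ L x = 0).card)
    (hsize : (univ.filter fun x => ¬ P x).card ≤ (univ.filter fun x => P x).card)
    {x y : V} (hx : P x) (hy : ¬ P y) (hxy : L x = L y) :
    levelChildCount L par x = levelChildCount L par y := by
  have hP' : ∀ x, L x ≠ 0 → (¬ P x ↔ ¬ P (par x)) := fun x hx => not_congr (hP x hx)
  have hdom' : ∀ t, ∀ x ∈ univ.filter (fun x => P x ∧ L x = t),
      ∀ y ∈ univ.filter (fun x => ¬ P x ∧ L x = t),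
      (levelChildCount L par x : ℝ) ≤ levelChildCount L par y := by
    intro t x hx y hy
    simp only [mem_filter, mem_univ, true_and] at hx hy
    exact_mod_cast hdom x y hx.1 hy.1 (hx.2.trans hy.2.symm)
  have hle : ∀ t, (univ.filter fun x => P x ∧ L x = t).card ≤
      (univ.filter fun x => ¬ P x ∧ L x = t).card := by
    intro t
    induction t with
    | zero => exact h0
    | succ t ih =>
      rw [hL.card_level_succ P hP, hL.card_level_succ (fun x => ¬ P x) hP']
      exact_mod_cast Finset.sum_le_sum_of_dominated ih (hdom' t) fun _ _ => Nat.cast_nonneg _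
  have heq : ∀ t, (univ.filter fun x => P x ∧ L x = t).card =
      (univ.filter fun x => ¬ P x ∧ L x = t).card := by
    intro t
    by_cases ht : t ∈ univ.image L
    · rw [card_filter_eq_sum_level P L, card_filter_eq_sum_level (fun x => ¬ P x) L] at hsize
      exact (Finset.sum_eq_sum_iff_of_le fun t _ => hle t).1
        (le_antisymm (Finset.sum_le_sum fun t _ => hle t) hsize) t ht
    · have hempty : ∀ Q : V → Prop, ∀ [DecidablePred Q],
          (univ.filter fun x => Q x ∧ L x = t) = ∅ := fun Q _ =>
        Finset.filter_eq_empty_iff.2 fun x _ hx =>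
          ht (hx.2 ▸ mem_image_of_mem L (mem_univ x))
      rw [hempty P, hempty fun x => ¬ P x]
  have hsum := heq (L x + 1)
  rw [hL.card_level_succ P hP, hL.card_level_succ (fun x => ¬ P x) hP'] at hsum
  have := Finset.eq_of_dominated_of_sum_eq (heq (L x)) (hdom' (L x))
    (fun _ _ => Nat.cast_nonneg _) (by exact_mod_cast hsum)
    (mem_filter.2 ⟨mem_univ x, hx, rfl⟩) (mem_filter.2 ⟨mem_univ y, hy, hxy.symm⟩)
  exact_mod_cast this

/-- Either the side of `a` ranks first, and the claim is immediate, or the side of `b` does. In the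
latter case it dominates without having more vertices, so the child counts agree. -/
theorem SimpleGraph.IsTree.degree_le_of_edge (hT : T.IsTree) {a b : V} (hab : T.Adj a b)
    (hL : IsLevelling T (edgeLevel T a b) par)
    (hside : ∀ x, edgeLevel T a b x ≠ 0 →
        (T.dist a x < T.dist b x ↔ T.dist a (par x) < T.dist b (par x)))
    (hrank : IsRanked T (edgeLevel T a b) par)
    (hdeg : ∀ v, T.degree v = levelChildCount (edgeLevel T a b) par v + 1)
    (hsize : (univ.filter fun x => T.dist b x < T.dist a x).card ≤
      (univ.filter fun x => T.dist a x < T.dist b x).card) {x y : V}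
    (hx : T.dist a x < T.dist b x) (hy : T.dist b y < T.dist a y)
    (hxy : T.dist a x = T.dist b y) : T.degree y ≤ T.degree x := by
  obtain ⟨ρ, hρ, hρd⟩ := hrank
  have hLxy : edgeLevel T a b x = edgeLevel T a b y := by
    rw [edgeLevel, edgeLevel]; omega
  have hnot : ∀ x, ¬ T.dist a x < T.dist b x ↔ T.dist b x < T.dist a x := by
    intro x
    have := hT.dist_edge_cases hab x
    omega
  have hzero : ∀ x, T.dist a x < T.dist b x → edgeLevel T a b x = 0 → x = a := by
    intro x h h0
    rcases hT.edgeLevel_eq_zero.1 h0 with h1 | h1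
    · exact h1
    · rw [h1, SimpleGraph.dist_self] at h; omega
  have hzero' : ∀ x, ¬ T.dist a x < T.dist b x → edgeLevel T a b x = 0 → x = b := by
    intro x h h0
    rcases hT.edgeLevel_eq_zero.1 h0 with h1 | h1
    · rw [hnot, h1, SimpleGraph.dist_self] at h; omega
    · exact h1
  rcases le_total (ρ a) (ρ b) with h | h
  · refine hρd x y hLxy (hL.rank_le_of_sides hρ (fun x => T.dist a x < T.dist b x) hside ?_ _
      x y hx (by omega) hLxy rfl)
    intro x y hx hy hx0 hy0
    rw [hzero x hx hx0, hzero' y hy hy0]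
    exact h
  · have hrk : ∀ x y, T.dist a x < T.dist b x → ¬ T.dist a y < T.dist b y →
        edgeLevel T a b x = edgeLevel T a b y → ρ y ≤ ρ x := by
      intro x y hx hy hxy
      refine hL.rank_le_of_sides hρ (fun x => ¬ T.dist a x < T.dist b x)
        (fun x hx => not_congr (hside x hx)) ?_ _ y x hy (not_not.2 hx) hxy.symm rfl
      intro y x hy hx hy0 hx0
      rw [hzero x (not_not.1 hx) hx0, hzero' y hy hy0]
      exact h
    have := hL.childCount_eq_of_sides (fun x => T.dist a x < T.dist b x) hside
      (fun x y hx hy hxy => by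
        have := hρd y x hxy.symm (hrk x y hx hy hxy)
        rw [hdeg, hdeg] at this
        omega) ?_ ?_ hx (by omega) hLxy
    · rw [hdeg, hdeg, this]
    · have h1 : (univ.filter fun x => T.dist a x < T.dist b x ∧ edgeLevel T a b x = 0) ⊆ {a} :=
        fun x hx => by
          simp only [mem_filter, mem_univ, true_and] at hx
          exact mem_singleton.2 (hzero x hx.1 hx.2)
      have h2 : {b} ⊆ univ.filter fun x => ¬ T.dist a x < T.dist b x ∧ edgeLevel T a b x = 0 := by
        rw [Finset.singleton_subset_iff, mem_filter]
        refine ⟨mem_univ _, ?_, hT.edgeLevel_eq_zero.2 (Or.inr rfl)⟩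
        rw [SimpleGraph.dist_self]
        omega
      have h1 := Finset.card_le_card h1
      have h2 := Finset.card_le_card h2
      rw [Finset.card_singleton] at h1 h2
      exact h1.trans h2
    · simp only [hnot]
      exact hsize

omit [DecidableEq V] [DecidableRel T.Adj] in
/-- A vertex such that each edge has at least half of the vertices on the side of this vertex. -/
theorem SimpleGraph.IsTree.exists_centroid (hT : T.IsTree) : ∃ r, ∀ q c, T.Adj q c →
    T.dist r q + 1 = T.dist r c →
    (univ.filter fun x => T.dist c x < T.dist q x).card ≤
      (univ.filter fun x => T.dist q x < T.dist c x).card := by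
  have : Nonempty V := hT.1.nonempty
  obtain ⟨r, hr⟩ := Finite.exists_min fun r => ∑ x, T.dist r x
  refine ⟨r, ?_⟩
  have main : ∀ k q c, T.Adj q c → T.dist r q = k → T.dist r q + 1 = T.dist r c →
      (univ.filter fun x => T.dist c x < T.dist q x).card ≤
        (univ.filter fun x => T.dist q x < T.dist c x).card := by
    intro k
    induction k with
    | zero =>
      intro q c hqc hq _
      have hq' : r = q := hT.1.dist_eq_zero_iff.1 hq
      subst hq'
      -- Moving from `r`, which minimizes the total distance, to a neighbour `c` lowers the distance
      -- to the vertices nearer to `c` by 1 and raises all others by 1.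
      have h1 : ∑ x, (T.dist c x + if T.dist c x < T.dist r x then 1 else 0) =
          ∑ x, (T.dist r x + if T.dist r x < T.dist c x then 1 else 0) := by
        refine Finset.sum_congr rfl fun x _ => ?_
        have := hT.dist_adj_cases x hqc
        rw [SimpleGraph.dist_comm (u := x), SimpleGraph.dist_comm (u := x)] at this
        split_ifs <;> omega
      rw [Finset.sum_add_distrib, Finset.sum_add_distrib, ← Finset.card_filter,
        ← Finset.card_filter] at h1
      have := hr c
      omega
    | succ k ih =>
      intro q c hqc hq hc
      have hqr : q ≠ r := by
        rintro rfl
        rw [SimpleGraph.dist_self] at hq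
        omega
      obtain ⟨q', hq', hq'd⟩ := hT.1.exists_adj_dist_succ hqr
      have hne : q' ≠ c := by rintro rfl; omega
      -- Only one neighbour of `q` lies towards `x`. So the branch at `c` sits inside the branch at
      -- `q`, and the inequality passes from the edge above to the edge below.
      have key : ∀ x, ¬ (T.dist c x < T.dist q x ∧ T.dist q' x < T.dist q x) := by
        rintro x ⟨h1, h2⟩
        have h3 := hT.dist_adj_cases x hqc
        have h4 := hT.dist_adj_cases x hq'
        rw [SimpleGraph.dist_comm, SimpleGraph.dist_comm (u := q)] at h1 h2
        exact hne (hT.eq_of_adj_of_dist (r := x) hq' hqc (by omega) (by omega))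
      have h5 : ∀ x, T.dist q x ≠ T.dist q' x := fun x => by
        have := hT.dist_adj_cases x hq'
        rw [SimpleGraph.dist_comm (u := q), SimpleGraph.dist_comm (u := q')]
        omega
      have h6 : ∀ x, T.dist q x ≠ T.dist c x := fun x => by
        have := hT.dist_adj_cases x hqc
        rw [SimpleGraph.dist_comm (u := q), SimpleGraph.dist_comm (u := c)]
        omega
      refine le_trans (Finset.card_le_card ?_) ((ih q' q hq'.symm (by omega) hq'd).trans
        (Finset.card_le_card ?_))
      · intro x hx
        simp only [mem_filter, mem_univ, true_and] at hx ⊢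
        have := key x
        have := h5 x
        omega
      · intro x hx
        simp only [mem_filter, mem_univ, true_and] at hx ⊢
        have := key x
        have := h6 x
        omega
  exact fun q c hqc h => main _ q c hqc rfl h

end EdgeSides

/-! ### Degrees do not increase from one level to the next -/

section LevelDegrees

open Finset

variable {V : Type*} {T : SimpleGraph V} {par : V → V} {r : V}

theorem IsLevelling.dist_iterate (hL : IsLevelling T (T.dist r) par) (k : ℕ) :
    ∀ v, k ≤ T.dist r v → T.dist r (par^[k] v) + k = T.dist r v := by
  induction k with
  | zero => intro v _; rfl
  | succ k ih =>
    intro v hv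
    have h1 := hL.level v (by omega)
    have h2 := ih (par v) (by omega)
    rw [Function.iterate_succ_apply]
    omega

theorem IsLevelling.dist_iterate_self (hL : IsLevelling T (T.dist r) par) (hT : T.Connected)
    (k : ℕ) : ∀ v, k ≤ T.dist r v → T.dist (par^[k] v) v = k := by
  intro v hv
  refine le_antisymm ?_ ?_
  · induction k generalizing v with
    | zero => simp
    | succ k ih =>
      have h1 := hL.level v (by omega)
      have h2 := ih (par v) (by omega)
      rw [Function.iterate_succ_apply]
      have h3 := hT.dist_triangle (u := par^[k] (par v)) (v := par v) (w := v)
      rw [SimpleGraph.dist_eq_one_iff_adj.2 (hL.adj v (by omega)).symm] at h3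
      omega
  · have h1 := hL.dist_iterate k v hv
    have h2 := hT.dist_triangle (u := r) (v := par^[k] v) (w := v)
    omega

variable [Fintype V] [DecidableRel T.Adj]

theorem IsLevelling.degree_le_of_dist_lt (hL : IsLevelling T (T.dist r) par) (hT : T.IsTree)
    (hedge : ∀ q c, T.Adj q c → T.dist r q + 1 = T.dist r c → ∀ x y,
      T.dist q x < T.dist c x → T.dist c y < T.dist q y → T.dist q x = T.dist c y →
      T.degree y ≤ T.degree x) {x y : V} (hxy : T.dist r x < T.dist r y) :
    T.degree y ≤ T.degree x := by
  classical
  have main : ∀ x y, T.dist r y = T.dist r x + 1 → T.degree y ≤ T.degree x := by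
    intro x y hxy
    have hroot : ∀ v, par^[T.dist r v] v = r := by
      intro v
      have := hL.dist_iterate (T.dist r v) v le_rfl
      exact (hT.1.dist_eq_zero_iff.1 (by omega)).symm
    have hex : ∃ t, par^[t] x = par^[t + 1] y :=
      ⟨T.dist r x, by rw [hroot, ← hxy, hroot]⟩
    -- Climb from `x` and `y` until the paths meet at `q = par^[t] x`. The edge from `q` to `par^[t]
    -- y` has `x` and `y` at distance `t` from its respective ends. Minimality of `t` puts `x` on
    -- the side of `q`.
    obtain ⟨t, ht, hmin⟩ : ∃ t, par^[t] x = par^[t + 1] y ∧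
        ∀ s < t, par^[s] x ≠ par^[s + 1] y :=
      ⟨Nat.find hex, Nat.find_spec hex, fun s hs => Nat.find_min hex hs⟩
    have htl : t ≤ T.dist r x := by
      by_contra hcon
      exact hmin (T.dist r x) (not_le.1 hcon) (by rw [hroot, ← hxy, hroot])
    have hqx := hL.dist_iterate t x htl
    have hcy := hL.dist_iterate t y (by omega)
    have hqx' := hL.dist_iterate_self hT.1 t x htl
    have hcy' := hL.dist_iterate_self hT.1 t y (by omega)
    have hcq : par (par^[t] y) = par^[t] x := by rw [ht, Function.iterate_succ_apply']
    have hadj : T.Adj (par^[t] x) (par^[t] y) := by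
      rw [← hcq]
      exact (hL.adj _ (by omega)).symm
    refine hedge _ _ hadj (by omega) x y ?_ ?_ (by rw [hqx', hcy'])
    · by_contra hcon
      have h1 := hT.dist_adj_cases x hadj
      rw [SimpleGraph.dist_comm (u := x), SimpleGraph.dist_comm (u := x)] at h1
      obtain ⟨s, rfl⟩ : ∃ s, t = s + 1 := ⟨t - 1, by omega⟩
      have h2 := hL.dist_iterate_self hT.1 s x (by omega)
      have h3 := hL.dist_iterate s x (by omega)
      have h4 : T.Adj (par^[s + 1] x) (par^[s] x) := by
        rw [Function.iterate_succ_apply']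
        exact (hL.adj _ (by omega)).symm
      refine hmin s (Nat.lt_succ_self s) (hT.eq_of_adj_of_dist (r := x) h4 hadj ?_ ?_)
      · rw [SimpleGraph.dist_comm (u := x), SimpleGraph.dist_comm (u := x)]
        omega
      · rw [SimpleGraph.dist_comm (u := x), SimpleGraph.dist_comm (u := x)]
        omega
    · have := hT.1.dist_triangle (u := r) (v := par^[t] x) (w := y)
      omega
  obtain ⟨k, hk⟩ := Nat.exists_eq_add_of_lt hxy
  induction k generalizing y with
  | zero => exact main x y hk
  | succ k ih =>
    have h1 := hL.level y (by omega)
    exact (main (par y) y h1.symm).trans (ih (by omega) (by omega))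

end LevelDegrees

/-! ### Parent functions that are monotone in breadth-first order -/

section BreadthFirst

open Finset

variable {n : ℕ}

theorem Fin.iff_le_card_of_initial {P : Fin n → Prop} [DecidablePred P]
    (hP : ∀ i j : Fin n, (i : ℕ) ≠ 0 → i ≤ j → P j → P i) {j : Fin n} (hj : (j : ℕ) ≠ 0) :
    P j ↔ (j : ℕ) ≤ (univ.filter fun i : Fin n => (i : ℕ) ≠ 0 ∧ P i).card := by
  have hn : 0 < n := j.pos
  let z : Fin n := ⟨0, hn⟩
  constructor
  · intro h
    have hsub : Finset.Ioc z j ⊆ univ.filter fun i : Fin n => (i : ℕ) ≠ 0 ∧ P i := by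
      intro i hi
      rw [Finset.mem_Ioc] at hi
      have hi0 : (i : ℕ) ≠ 0 := by
        have := Fin.lt_def.1 hi.1
        omega
      exact mem_filter.2 ⟨mem_univ _, hi0, hP i j hi0 hi.2 h⟩
    have := Finset.card_le_card hsub
    rwa [Fin.card_Ioc, Nat.sub_zero] at this
  · intro h
    by_contra hcon
    have hsub : (univ.filter fun i : Fin n => (i : ℕ) ≠ 0 ∧ P i) ⊆ Finset.Ioo z j := by
      intro i hi
      rw [mem_filter] at hi
      rw [Finset.mem_Ioo]
      exact ⟨Fin.lt_def.2 (Nat.pos_of_ne_zero hi.2.1),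
        not_le.1 fun hji => hcon (hP j i hj hji hi.2.2)⟩
    have := Finset.card_le_card hsub
    rw [Fin.card_Ioo] at this
    have hz : (z : ℕ) = 0 := rfl
    omega

/-- A partial sum of child counts is the number of nonroot vertices whose parent lies in the given
range. As parents are monotone, these are exactly the first nonroot vertices. -/
theorem isGreedyChild_iff {p : Fin n → Fin n} {D : Fin n → ℕ}
    (hp : ∀ i j : Fin n, (i : ℕ) ≠ 0 → i ≤ j → p i ≤ p j)
    (hD : ∀ v, (treeChildren p v).card = greedyChildCount D v) (i j : Fin n) :
    IsGreedyChild D i j ↔ j ∈ treeChildren p i := by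
  have hsum : ∀ (Q : Fin n → Prop) [DecidablePred Q],
      ∑ m with Q m, greedyChildCount D m =
        (univ.filter fun j : Fin n => (j : ℕ) ≠ 0 ∧ Q (p j)).card := by
    intro Q _
    rw [Finset.card_eq_sum_card_fiberwise (f := p) (t := univ.filter fun m => Q m)
      fun j hj => by simpa using (mem_filter.1 hj).2.2]
    refine Finset.sum_congr rfl fun m hm => ?_
    rw [← hD, Finset.filter_filter]
    congr 1
    ext j
    rw [mem_treeChildren]
    simp only [mem_filter, mem_univ, true_and] at hm ⊢
    constructor
    · rintro ⟨h1, h2⟩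
      exact ⟨⟨h1, h2 ▸ hm⟩, h2⟩
    · rintro ⟨⟨h1, -⟩, h2⟩
      exact ⟨h1, h2⟩
  rw [IsGreedyChild, hsum fun m => m < i, hsum fun m => m ≤ i, mem_treeChildren]
  by_cases hj : (j : ℕ) = 0
  · simp [hj]
  · rw [← Fin.iff_le_card_of_initial (P := fun j => p j ≤ i)
      (fun a b ha hab h => (hp a b ha hab).trans h) hj, Nat.one_add_le_iff, ← not_le,
      ← Fin.iff_le_card_of_initial (P := fun j => p j < i)
      (fun a b ha hab h => (hp a b ha hab).trans_lt h) hj]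
    rw [not_lt, and_comm, ← le_antisymm_iff]
    simp [hj]

end BreadthFirst

/-! ### A maximizer is the greedy tree -/

section GreedyIso

open Finset

variable {V : Type*} [Fintype V] [DecidableEq V] {T : SimpleGraph V} [DecidableRel T.Adj]
  {par : V → V} {r : V} {n : ℕ} {D : Fin n → ℕ} {f : ℝ → ℝ} {c : ℕ → ℝ}

/-- The position of a vertex in its level, encoded by the labels `s` of its ancestors. -/
def breadthKey (n : ℕ) (par : V → V) (s : V → ℕ) : ℕ → V → ℕ
  | 0, _ => 0
  | k + 1, v => breadthKey n par s k (par v) * n + s v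

omit [Fintype V] [DecidableEq V] [DecidableRel T.Adj] in
theorem SimpleGraph.Connected.breadthKey_injective (hT : T.Connected)
    {s : V → ℕ} (hs : ∀ v, s v < n) (hinj : Function.Injective s) :
    ∀ k u v, T.dist r u = k → T.dist r v = k →
      breadthKey n par s k u = breadthKey n par s k v → u = v
  | 0, u, v, hu, hv, _ => (hT.dist_eq_zero_iff.1 hu).symm.trans (hT.dist_eq_zero_iff.1 hv)
  | k + 1, u, v, _, _, h => by
    have := congrArg (· % n) h
    simp only [breadthKey, Nat.mul_add_mod_self_right, Nat.mod_eq_of_lt (hs _)] at this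
    exact hinj this

omit [Fintype V] [DecidableEq V] in
-- The key is a base-`n` numeral with the label of the vertex as last digit; division by `n` yields
-- the key of the parent.
theorem breadthKey_parent_le {s : V → ℕ} (hs : ∀ v, s v < n) {k : ℕ} {u v : V}
    (h : breadthKey n par s (k + 1) u ≤ breadthKey n par s (k + 1) v) :
    breadthKey n par s k (par u) ≤ breadthKey n par s k (par v) := by
  have := Nat.div_le_div_right (c := n) h
  have hn : 0 < n := (Nat.zero_le _).trans_lt (hs u)
  simpa only [breadthKey, mul_comm _ n, Nat.mul_add_div hn, Nat.div_eq_of_lt (hs _),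
    add_zero] using this

omit [Fintype V] [DecidableEq V] [DecidableRel T.Adj] in
-- Induction on the level: siblings are compared by their labels, and vertices with different
-- parents inherit the order of the parents.
theorem IsLevelling.rank_le_of_breadthKey_le (hL : IsLevelling T (T.dist r) par)
    (hT : T.Connected) {ρ s : V → ℕ} (hs : ∀ v, s v < n) (hinj : Function.Injective s)
    (hsρ : ∀ u v, s u ≤ s v → ρ u ≤ ρ v)
    (hρ : ∀ a b, T.dist r a ≠ 0 → T.dist r a = T.dist r b → par a ≠ par b →
      ρ (par a) ≤ ρ (par b) → ρ a ≤ ρ b) :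
    ∀ k u v, T.dist r u = k → T.dist r v = k →
      breadthKey n par s k u ≤ breadthKey n par s k v → ρ u ≤ ρ v
  | 0, u, v, hu, hv, _ => by
    rw [← hT.dist_eq_zero_iff.1 hu, ← hT.dist_eq_zero_iff.1 hv]
  | k + 1, u, v, hu, hv, h => by
    by_cases hp : par u = par v
    · refine hsρ u v ?_
      rw [breadthKey, breadthKey, hp] at h
      omega
    · have h1 := hL.level u (by omega)
      have h2 := hL.level v (by omega)
      exact hρ u v (by omega) (by omega) hp
        (hL.rank_le_of_breadthKey_le hT hs hinj hsρ hρ k _ _ (by omega) (by omega)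
          (breadthKey_parent_le hs h))

omit [DecidableEq V] in
/-- A tree whose degrees decrease in a suitable breadth-first order is the greedy tree. -/
theorem IsRanked.nonempty_iso_greedyTree (hrank : IsRanked T (T.dist r) par) (hT : T.IsTree)
    (hn : Fintype.card V = n) (hTD : HasDegreeSequence T D)
    (hL : IsLevelling T (T.dist r) par)
    (hdist : ∀ x y, T.dist r x < T.dist r y → T.degree y ≤ T.degree x) :
    Nonempty (T ≃g greedyTree D) := by
  obtain ⟨ρ, hρ, hρd⟩ := hrank
  obtain ⟨e₀, he₀⟩ := exists_enumeration hn ρ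
  -- An injective refinement of the rank, which breaks ties and supplies the digits of the key.
  let s : V → ℕ := fun v => (e₀.symm v : ℕ)
  have hs : ∀ v, s v < n := fun v => (e₀.symm v).2
  have hinj : Function.Injective s := Fin.val_injective.comp e₀.symm.injective
  have hsρ : ∀ u v, s u ≤ s v → ρ u ≤ ρ v := fun u v h => by
    simpa using he₀ (Fin.le_def.2 h)
  let K : V → ℕ := fun v => breadthKey n par s (T.dist r v) v
  obtain ⟨e, he⟩ := exists_enumeration hn fun v => toLex (T.dist r v, K v)
  have hkey : ∀ i j, i ≤ j → T.dist r (e i) < T.dist r (e j) ∨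
      T.dist r (e i) = T.dist r (e j) ∧ K (e i) ≤ K (e j) := fun i j hij =>
    Prod.Lex.toLex_le_toLex.1 (he hij)
  have hmono : Monotone fun j => T.dist r (e j) := fun i j hij => by
    rcases hkey i j hij with h | h
    · exact h.le
    · exact h.1.le
  have hlv := hT.dist_enumeration_eq_zero e hmono
  obtain ⟨hpf, hadj⟩ := hL.parentGraph_enumeration hT e hmono
  set p : Fin n → Fin n := fun j => e.symm (par (e j)) with hp
  have hpe : ∀ j, e (p j) = par (e j) := fun j => e.apply_symm_apply _
  have hpm : ∀ i j : Fin n, (i : ℕ) ≠ 0 → i ≤ j → p i ≤ p j := by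
    intro i j hi hij
    by_contra hcon
    have h1 := hL.level (e i) (by rwa [Ne, hlv])
    have h2 := hL.level (e j) (by rw [Ne, hlv]; have := Fin.le_def.1 hij; omega)
    have h3 := hkey _ _ (not_le.1 hcon).le
    rw [hpe, hpe] at h3
    rcases hkey i j hij with h | ⟨h, h'⟩
    · omega
    · have h4 : K (par (e i)) ≤ K (par (e j)) := by
        simp only [K] at h' ⊢
        rw [← h1, ← h2] at h'
        have h5 : T.dist r (par (e j)) = T.dist r (par (e i)) := by omega
        rw [h5] at h' ⊢
        exact breadthKey_parent_le hs h'
      have h5 : K (par (e j)) ≤ K (par (e i)) := by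
        rcases h3 with h3 | h3
        · omega
        · exact h3.2
      have h6 : par (e i) = par (e j) := by
        have h7 : T.dist r (par (e j)) = T.dist r (par (e i)) := by omega
        have h8 := le_antisymm h4 h5
        simp only [K, h7] at h8
        exact hT.1.breadthKey_injective hs hinj _ _ _ rfl h7 h8
      exact hcon (by simp only [hp, h6, le_refl])
  have hanti : Antitone fun i => T.degree (e i) := by
    intro i j hij
    rcases hkey i j hij with h | ⟨h, h'⟩
    · exact hdist _ _ h
    · refine hρd _ _ h ?_
      simp only [K, ← h] at h'
      exact hL.rank_le_of_breadthKey_le hT.1 hs hinj hsρ hρ _ _ _ rfl h.symm h'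
  -- Two antitone rearrangements of the same degrees coincide.
  have hD : ∀ i, D i = T.degree (e i) := by
    obtain ⟨hDa, σ, hσ⟩ := hTD
    have h1 : (fun i => T.degree (e i)) ∘ (σ.trans e.symm) = D := by
      funext i
      exact (congrArg (fun v => T.degree v) (e.apply_symm_apply (σ i))).trans (hσ i)
    have h2 := Tuple.unique_antitone (f := fun i => T.degree (e i)) (σ := σ.trans e.symm)
      (τ := Equiv.refl _) (by rw [h1]; exact hDa) (by exact hanti)
    intro i
    rw [← congrFun h1 i, h2]
    rfl
  let E : T ≃g parentGraph p :=
    { toEquiv := e.symm, map_rel_iff' := by intro a b; simp [hadj] }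
  have hcard : ∀ v, (treeChildren p v).card = greedyChildCount D v := by
    intro v
    have h1 := hpf.degree_eq v
    have h2 := E.degree_eq (e v)
    have h3 : E (e v) = v := e.symm_apply_apply v
    rw [h3, h1, ← hD] at h2
    rw [greedyChildCount, ← h2]
    split_ifs <;> omega
  have hgreedy : parentGraph p = greedyTree D := by
    ext i j
    rw [greedyTree, SimpleGraph.fromRel_adj, isGreedyChild_iff hpm hcard,
      isGreedyChild_iff hpm hcard, ← or_comm, ← parentGraph_adj hpf]
    exact ⟨fun h => ⟨h.ne, h⟩, fun h => h.2⟩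
  exact ⟨hgreedy ▸ E⟩

theorem IsSpectralMax.nonempty_iso_greedyTree (hmax : IsSpectralMax T D f) (hT : T.IsTree)
    (hn : Fintype.card V = n) (hTD : HasDegreeSequence T D)
    (hc : ∀ k, 0 ≤ c k) (hf : ∀ x : ℝ, HasSum (fun k => c k * x ^ k) (f x))
    (hinf : {k : ℕ | Even k ∧ 0 < c k}.Infinite) : Nonempty (T ≃g greedyTree D) := by
  obtain ⟨r, hr⟩ := hT.exists_centroid
  obtain ⟨par, hL⟩ := hT.exists_isLevelling_vertex r
  refine (hmax.isRanked_vertex hT hn hTD hc hf hinf hL).nonempty_iso_greedyTree hT hn hTD hL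
    fun x y hxy => hL.degree_le_of_dist_lt hT (fun q c hqc hd x y hx hy hxy => ?_) hxy
  obtain ⟨par', hL', hside⟩ := hT.exists_isLevelling_edge hqc
  obtain ⟨hrank, hdeg⟩ := hmax.isRanked_edge hT hn hTD hc hf hinf hqc hL'
  exact hT.degree_le_of_edge hqc hL' hside hrank hdeg (hr q c hqc hd) hx hy hxy

end GreedyIso

/-! ### Existence of a maximizer and conclusion -/

section Extremal

variable {V : Type*} [Fintype V] [DecidableEq V] {T : SimpleGraph V} [DecidableRel T.Adj]
  {n : ℕ} {D : Fin n → ℕ} {f : ℝ → ℝ} {c : ℕ → ℝ}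

omit [DecidableEq V] [DecidableRel T.Adj] in
theorem SimpleGraph.IsTree.exists_iso_parentGraph (hT : T.IsTree) (hn : Fintype.card V = n) :
    ∃ p : Fin n → Fin n, IsParentFun p ∧ Nonempty (T ≃g parentGraph p) := by
  classical
  obtain ⟨r⟩ := hT.1.nonempty
  obtain ⟨par, hL⟩ := hT.exists_isLevelling_vertex r
  obtain ⟨e, he⟩ := exists_enumeration hn (T.dist r)
  obtain ⟨hpf, hadj⟩ := hL.parentGraph_enumeration hT e he
  exact ⟨_, hpf, ⟨{ toEquiv := e.symm, map_rel_iff' := by intro a b; simp [hadj] }⟩⟩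

omit [DecidableEq V] in
theorem exists_isSpectralMax (f : ℝ → ℝ) (hT : T.IsTree) (hn : Fintype.card V = n)
    (hTD : HasDegreeSequence T D) : ∃ p : Fin n → Fin n, IsParentFun p ∧
      HasDegreeSequence (parentGraph p) D ∧ IsSpectralMax (parentGraph p) D f := by
  classical
  obtain ⟨q, hq, ⟨E⟩⟩ := hT.exists_iso_parentGraph hn
  let A := {p : Fin n → Fin n // IsParentFun p ∧ HasDegreeSequence (parentGraph p) D}
  have : Nonempty A := ⟨⟨q, hq, hTD.of_iso E⟩⟩
  obtain ⟨⟨p, hp, hpD⟩, hmax⟩ :=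
    Finite.exists_max fun p : A => spectralSum f (parentGraph p.1)
  exact ⟨p, hp, hpD, fun q hq hqD => hmax ⟨q, hq, hqD⟩⟩

/-- The greedy tree is the unique tree with the largest spectral sum. -/
theorem spectralSum_lt_greedyTree (hT : T.IsTree) (hTD : HasDegreeSequence T D)
    (hc : ∀ k, 0 ≤ c k) (hf : ∀ x : ℝ, HasSum (fun k => c k * x ^ k) (f x))
    (hinf : {k : ℕ | Even k ∧ 0 < c k}.Infinite) :
    ((greedyTree D).IsTree ∧ HasDegreeSequence (greedyTree D) D) ∧
      spectralSum f T ≤ spectralSum f (greedyTree D) ∧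
      (IsEmpty (T ≃g greedyTree D) → spectralSum f T < spectralSum f (greedyTree D)) := by
  have hn : Fintype.card V = n := by
    obtain ⟨-, σ, -⟩ := hTD
    rw [← Fintype.card_congr σ, Fintype.card_fin]
  obtain ⟨v⟩ := hT.1.nonempty
  have hn0 : 0 < n := hn ▸ Fintype.card_pos_iff.2 ⟨v⟩
  obtain ⟨p, hp, hpD, hmax⟩ := exists_isSpectralMax f hT hn hTD
  obtain ⟨E⟩ := hmax.nonempty_iso_greedyTree (hp.isTree hn0) (Fintype.card_fin n) hpD hc hf hinf
  obtain ⟨q, hq, ⟨F⟩⟩ := hT.exists_iso_parentGraph hn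
  have hle : spectralSum f T ≤ spectralSum f (greedyTree D) := by
    rw [← E.spectralSum_eq, F.spectralSum_eq]
    exact hmax q hq (hTD.of_iso F)
  refine ⟨⟨E.isTree_iff.1 (hp.isTree hn0), hpD.of_iso E⟩, hle, fun hempty => ?_⟩
  refine lt_of_le_of_ne hle fun heq => ?_
  -- If `T` attains the value of the greedy tree, it is itself a maximizer and hence isomorphic to
  -- the greedy tree.
  have hmaxT : IsSpectralMax T D f := fun q hq hqD => by
    rw [heq, ← E.spectralSum_eq]
    exact hmax q hq hqD
  obtain ⟨G⟩ := hmaxT.nonempty_iso_greedyTree hT hn hTD hc hf hinf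
  exact hempty.false G

theorem Real.hasSum_exp_series (x : ℝ) :
    HasSum (fun k : ℕ => ((k.factorial : ℝ))⁻¹ * x ^ k) (Real.exp x) := by
  have := NormedSpace.expSeries_div_hasSum_exp x
  rw [← Real.exp_eq_exp_ℝ] at this
  simpa only [div_eq_inv_mul] using this

theorem infinite_even_factorial_inv_pos {a : ℕ → ℝ} (ha : ∀ k, 0 < a k) :
    {k : ℕ | Even k ∧ 0 < a k}.Infinite := by
  refine (Set.infinite_range_of_injective (mul_right_injective₀ (two_ne_zero (α := ℕ)))).mono ?_
  rintro _ ⟨k, rfl⟩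
  exact ⟨even_two_mul k, ha _⟩

theorem spectralSum_add_const_mul (f g : ℝ → ℝ) (t : ℝ) (G : SimpleGraph V) [DecidableRel G.Adj] :
    spectralSum (fun x => f x + t * g x) G = spectralSum f G + t * spectralSum g G := by
  simp only [spectralSum, Finset.sum_add_distrib, Finset.mul_sum]

/-- Adding `t * exp` with `t > 0` makes all coefficients positive, so the extremal result applies;
then let `t` become small. -/
theorem spectralSum_le_greedyTree (hT : T.IsTree) (hTD : HasDegreeSequence T D)
    (hc : ∀ k, 0 ≤ c k) (hf : ∀ x : ℝ, HasSum (fun k => c k * x ^ k) (f x)) :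
    spectralSum f T ≤ spectralSum f (greedyTree D) := by
  have hpert : ∀ t : ℝ, 0 < t → spectralSum f T + t * spectralSum Real.exp T ≤
      spectralSum f (greedyTree D) + t * spectralSum Real.exp (greedyTree D) := by
    intro t ht
    rw [← spectralSum_add_const_mul, ← spectralSum_add_const_mul]
    have hpos : ∀ k : ℕ, 0 < c k + t * ((k.factorial : ℝ))⁻¹ := fun k => by
      have := hc k
      positivity
    refine (spectralSum_lt_greedyTree (c := fun k => c k + t * ((k.factorial : ℝ))⁻¹) hT hTD
      (fun k => (hpos k).le) (fun x => ?_) (infinite_even_factorial_inv_pos hpos)).2.1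
    simpa only [add_mul, mul_assoc] using (hf x).add ((Real.hasSum_exp_series x).mul_left t)
  by_contra hcon
  rw [not_le] at hcon
  set A := spectralSum f T - spectralSum f (greedyTree D) with hA
  set B := spectralSum Real.exp (greedyTree D) - spectralSum Real.exp T with hB
  have hApos : 0 < A := sub_pos.2 hcon
  have h1 : ∀ t : ℝ, 0 < t → A ≤ t * B := fun t ht => by
    have := hpert t ht
    rw [hA, hB]
    linarith
  -- This choice of `t` makes `t * B ≤ A / 2`, which contradicts `A > 0`.
  have h2 := h1 (A / (2 * (|B| + 1))) (by positivity)
  have h3 : A / (2 * (|B| + 1)) * B ≤ A / 2 := by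
    rw [div_mul_eq_mul_div, div_le_div_iff₀ (by positivity) (by positivity)]
    nlinarith [le_abs_self B, abs_nonneg B]
  linarith

end Extremal

theorem mainTheorem6 {n : ℕ} (D : Fin n → ℕ)
    {V : Type*} [Fintype V] [DecidableEq V] (T : SimpleGraph V) [DecidableRel T.Adj]
    (hT : T.IsTree) (hTD : HasDegreeSequence T D) :
    ((greedyTree D).IsTree ∧ HasDegreeSequence (greedyTree D) D) ∧
    (∀ (f : ℝ → ℝ) (a : ℕ → ℝ), (∀ k, 0 ≤ a k) → (∀ x : ℝ, HasSum (fun k => a k * x ^ k) (f x)) →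
      spectralSum f T ≤ spectralSum f (greedyTree D) ∧
      ({k : ℕ | Even k ∧ 0 < a k}.Infinite → IsEmpty (T ≃g greedyTree D) →
        spectralSum f T < spectralSum f (greedyTree D))) ∧
    (IsEmpty (T ≃g greedyTree D) → estradaIndex T < estradaIndex (greedyTree D)) := by
  have hpos : ∀ k : ℕ, 0 < ((k.factorial : ℝ))⁻¹ := fun k => by positivity
  have hexp := spectralSum_lt_greedyTree hT hTD (fun k => (hpos k).le) Real.hasSum_exp_series
    (infinite_even_factorial_inv_pos hpos)
  exact ⟨hexp.1, fun f a ha hf => ⟨spectralSum_le_greedyTree hT hTD ha hf, fun hinf =>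
    (spectralSum_lt_greedyTree hT hTD ha hf hinf).2.2⟩, hexp.2.2⟩
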